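/- Let $\mathbb K\in\{\mathbb R,\mathbb C\}$, let $B,\bar B$ be Banach spaces over $\mathbb K$, $1\le l\le k$, $q\ge 2k+2$, $G\in C^q(B,\bar B)$ with $G[0]=0$, and let $z_0$ be a $C^q$ curve in $B$, defined near $\varepsilon=0$ in $\mathbb K$, with $z_0(\varepsilon)=\varepsilon\bar z_1+\dots+\frac1{k!}\varepsilon^k\bar z_k+O(|\varepsilon|^{k+1})$ and first non-zero coefficient $\bar z_l$. Write $G_0^\beta=G^{(\beta)}(0)$. **Fine resolution.** Put $N_0=B$, $R_0^c=\bar B$, $\bar S_1=G_0^1$ and, recursively for $i=1,\dots,k+1$, $S_i=P_{R_{i-1}^c}\bar S_i|_{N_{i-1}}$, $N_i=\ker S_i$, $R_i=\operatorname{ran}S_i$, with chosen decompositions $N_{i-1}=N_i^c\oplus N_i$, $R_{i-1}^c=R_i\oplus R_i^c$ into closed subspaces (all projections being continuous); $P_{R_i}$, $P_{R_i^c}$ are the projections belonging to $\bar B=R_1\oplus\dots\oplus R_i\oplus R_i^c$. Here, for $1\le n\le k$, $$\bar S_{n+1}=\sum_{i=1}^{n}W^{2n}_{2n-i}\,m^{(n)}_i+\frac{(2n)!}{(n!)^2}\,G_0^2\bar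 z_n ,\qquad W^{2n}_\mu=\frac1{\mu!}\sum_\beta G_0^\beta\sum\frac{(2n)!}{n_1!\cdots n_{n-1}!}\prod_{\tau=1}^{n-1}\Big(\frac{\bar z_\tau}{\tau!}\Big)^{n_\tau},$$ the inner sum being over $n_1+\dots+n_{n-1}+1=\beta$, $\sum_\tau\tau n_\tau+\mu=2n$ (one slot of $G_0^\beta$ stays free). With $E_{j,j}=I$, $E_{i,j}=-S_i^{-1}P_{R_i}\sum_{v=i+1}^{j}\bar S_vE_{v,j}$ for $i<j$, $E_{i,j}=0$ for $i>j$ (where $S_i^{-1}$ is the inverse of $S_i:N_i^c\to R_i$), $c_{m,j}=\binom{m}{j-1}/\binom{2j-2}{j-1}$ and $Q^m_{i,j}=c_{m,i}^{-1}c_{m,j}E_{i,j}$, the matrix operators $M^{2n+1}=(M^{2n+1}_{i,j})_{1\le i,j\le n}$ are given by $M^{2n+1}_{1,j}=Q^{2n}_{1,j}$, $M^{2n+1}_{2,j}=\sum_{s=1}^{n-1}Q^{2n-1}_{1,s}Q^{2n}_{s+1,j}$, $M^{2n+1}_{i,j}=\sum_{s,t=1}^{n-1}M^{2n-1}_{i-2,t}Q^{2n-1}_{t+1,s}Q^{2n}_{s+1,j}$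 for $i\ge3$; and $m^{(n)}_1=Q^{2n-1}_{1,n}$, $m^{(n)}_i=\sum_{t=1}^{n-1}M^{2n-1}_{i-1,t}Q^{2n-1}_{t+1,n}$ for $i\ge2$. (Thus $\bar S_2=2G_0^2\bar z_1$.) Let $N^c=N_1^c\oplus\dots\oplus N_{k+1}^c$, so that $B=N^c\oplus N_{k+1}$. The complements are chosen with $\bar z_l\notin N^c$; let $w\neq 0$ be the projection of $\bar z_l$ onto $N_{k+1}$ along $N^c$ and choose a closed $P$ with $N_{k+1}=P\oplus\mathbb Kw$. **Cone.** Let $\hat M_{k+1}=\mathrm{Diag}(I,M^{2k+1})$, $A_\varepsilon=[A^1_\varepsilon\cdots A^{k+1}_\varepsilon]=\big[\tfrac{\varepsilon^{2k+1}}{(2k+1)!}\cdots\tfrac{\varepsilon^{k+1}}{(k+1)!}\big]\hat M_{k+1}$, $\hat L_{k+1}=\frac1{(2k+1)!}[\bar S_1|\cdots|\bar S_{k+1}]\,\mathrm{Diag}(c_{2k+1,1},\dots,c_{2k+1,k+1})$ and $Z_k(\varepsilon,n^c,p)=z_0(\varepsilon)+A_\varepsilon n^c+A^{k+1}_\varepsilon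 p$ for $n^c\in N_1^c\times\dots\times N_{k+1}^c$, $p\in P$. Let $U_i\subset N_i^c$, $U^p\subset P$ be arbitrary bounded open sets containing $0$, $U=U_1\times\dots\times U_{k+1}$, and $C_k=\{Z_k(\varepsilon,n^c,p):0<|\varepsilon|<\delta,\ n^c\in U,\ p\in U^p\}$. $C_k$ is $k$-transversal if $R_1\oplus\dots\oplus R_{k+1}=\bar B$. **Theorem.** The following holds for $\varepsilon$ (that is, $\delta$) sufficiently small. (i) If $G[z]=0$ for some $z\in C_k$, then $\|G[z_0(\varepsilon)]\|=O(|\varepsilon|^{2k+1})$; moreover, with a constant $C$ independent of $\varepsilon,n^c,p$, $G[Z_k(\varepsilon,n^c,p)]=0$ implies $\|G[z_0(\varepsilon)]\|\le C|\varepsilon|^{2k+1}$. Now let $C_k$ be $k$-transversal. (ii) Suppose $\|G[z_0(\varepsilon)]\|=O(|\varepsilon|^{2k+1})$. Then there is $n^c=(n_1^c,\dots,n_{k+1}^c)$ of class $C^{q-2k-1}$ on $\{|\varepsilon|<\delta\}\times U^p$ with values in $N_1^c\times\dots\times N_{k+1}^c$ such that $z(\varepsilon,p)=Z_k(\varepsilon,n^c(\varepsilon,p),p)$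 satisfies $G[z(\varepsilon,p)]=0$, and all solutions in $C_k$ are of this form: if $0<|\varepsilon|<\delta$, $n\in U$, $p\in U^p$ and $G[Z_k(\varepsilon,n,p)]=0$, then $n=n^c(\varepsilon,p)$. The map $z(\varepsilon,p)$ is of class $C^{q-2k-1}$ and is regular for $\varepsilon\ne0$ (its derivative $\mathbb K\times P\to B$ has a continuous left inverse). (iii) Under the hypothesis of (ii), let $h\in C^q(B,\bar B)$, $h(z)=O(\|z\|^{2k+1})$ as $z\to 0$. Then $G+h$ has the same fine resolution and, in the same cone, a solution family $\tilde z(\varepsilon,p)$ as in (ii), with $\tilde z(\varepsilon,p)-z(\varepsilon,p)=O(|\varepsilon|^{k+1})$ for each $p\in U^p$; the $\varepsilon$-derivatives of $z$ and $\tilde z$ at $\varepsilon=0$ agree up to order $k$ (as far as the smoothness $C^{q-2k-1}$ provides them). Without the hypothesis of (ii): if $h\in C^q(B,\bar B)$ and $h(z)=O(\|z\|^{k+2})$, then $G+h$ has the same fine resolution as $G$; in particular the cone and its $k$-transversality persist. (iv) $\hat L_{k+1}:N_1^c\times\dots\times N_{k+1}^c\to\bar B$ and, for $\varepsilon\ne0$,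 $A_\varepsilon:N_1^c\times\dots\times N_{k+1}^c\to N^c$ are linear homeomorphisms. There are maps $J_{\varepsilon,p}$ ($0<|\varepsilon|<\delta$, $p\in U^p$) such that, with $G_{\varepsilon,p}[z]=G[z_0(\varepsilon)+z+A_\varepsilon^{k+1}p]$, the set $V_{\varepsilon,p}=G_{\varepsilon,p}[A_\varepsilon U]$ is open in $\bar B$, $J_{\varepsilon,p}$ is of class $C^q$ on $V_{\varepsilon,p}$, $J_{\varepsilon,p}=I+O(|\varepsilon|)$ and $J_{\varepsilon,p}'=I+O(|\varepsilon|)$ uniformly on $V_{\varepsilon,p}$ and in $p$, and $J_{\varepsilon,p}\circ G_{\varepsilon,p}\circ A_\varepsilon=\varepsilon^{2k+1}\hat L_{k+1}$ on $U$. (v) For $i=1,\dots,k+1$, $\big\|G'[z_0(\varepsilon)]|_{A_\varepsilon^i(N_i^c)}\big\|=O(|\varepsilon|^{i-1})$ as $\varepsilon\to0$, and this order is exact if $N_i^c\neq\{0\}$. For $\varepsilon\neq0$, $G_{N^c}[z_0(\varepsilon)]:=G'[z_0(\varepsilon)]|_{N^c}$ is a linear homeomorphism onto $\bar B$ with $\|G_{N^c}[z_0(\varepsilon)]^{-1}\|=O(|\varepsilon|^{-k})$.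 (vi) If $\dim N^c<\infty$, put $\chi=\sum_{i=1}^{k}i\cdot\dim N_{i+1}^c$. With respect to any bases of $N^c$ and $\bar B$, $\det\big(G'[Z_k(\varepsilon,n^c,p)]|_{N^c}\big)=\varepsilon^\chi\,r(\varepsilon,n^c,p)$ for $|\varepsilon|<\delta$, $n^c\in U$, $p\in U^p$, with $r$ of class $C^{q-2k-1}$ and $r\neq0$. -/

import Mathlib

open Filter Asymptotics Topology

namespace KTransversal

noncomputable section

section Operators

variable {𝕜 B B' : Type*} [RCLike 𝕜] [NormedAddCommGroup B] [NormedSpace 𝕜 B]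
  [NormedAddCommGroup B'] [NormedSpace 𝕜 B']

/-- The coefficients `z̄_i` of a curve `z₀(ε) = ∑ (1/i!) ε^i z̄_i + …`. -/
def coeff (z₀ : 𝕜 → B) (i : ℕ) : B := iteratedDeriv i z₀ 0

variable (𝕜) in
/-- The operator `W_μ^m(z_s, …, z_1)` of the system of undetermined coefficients:
`W_μ^m = (1/μ!) ∑_β G₀^β ∑_n m!/(n_1! ⋯ n_s!) ∏_τ (z_τ/τ!)^{n_τ}`, where
`n_1 + … + n_s + 1 = β` and `1·n_1 + … + s·n_s + μ = m`, one slot of the multilinear map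
`G₀^β = G^{(β)}(0)` being left free. The multi-indices are enumerated through the ordered
compositions of `m - μ` with `β - 1` blocks of size at most `s`; a multi-index corresponds to
`(β-1)!/(n_1! ⋯ n_s!)` of these. -/
def W (G : B → B') (z : ℕ → B) (m s μ : ℕ) : B →L[𝕜] B' :=
  ((m.factorial : 𝕜) / (μ.factorial : 𝕜)) • ∑ c : Composition (m - μ),
    if ∀ i, c.blocksFun i ≤ s then
      ((c.length.factorial : 𝕜)⁻¹) • iteratedFDeriv 𝕜 c.length (fderiv 𝕜 G) 0
        (fun i => ((c.blocksFun i).factorial : 𝕜)⁻¹ • z (c.blocksFun i))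
    else 0

variable (𝕜) in
/-- The scheme `c_{m,l}`, characterised by `c_{m,l} * C(2(l-1), l-1) = C(m, l-1)`, `l ≥ 1`. -/
def c (m l : ℕ) : 𝕜 := (m.choose (l - 1) : 𝕜) / ((2 * (l - 1)).choose (l - 1) : 𝕜)

/-- `E_{j,j} = I` and `E_{i,j} = - S_i⁻¹ P_{R_i} ∑_{v=i+1}^{j} S̄_v E_{v,j}` for `i < j`
(zero below the diagonal). Here `Sb v` stands for `S̄_v` and `T i` for `S_i⁻¹ P_{R_i}`. -/
def E (Sb : ℕ → B →L[𝕜] B') (T : ℕ → B' →L[𝕜] B) (i j : ℕ) : B →L[𝕜] B :=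
  if j < i then 0
  else if i = j then ContinuousLinearMap.id 𝕜 B
  else - (T i ∘L ∑ v : Fin (j - i), Sb (i + 1 + v.val) ∘L E Sb T (i + 1 + v.val) j)
termination_by j - i
decreasing_by have := v.isLt; omega

/-- Entries of `(C^m)⁻¹ E C^m`, with `C^m = Diag[c_{m,1}, c_{m,2}, …]`. For `m = 2n - 1` and
`m = 2n` the paper's blocks `(α^m ᾱ^m; A^m Ā^m)` are the entries with indices `1, …, n`: `α^m ᾱ^m`
is row `1`, `A^m Ā^m` are the rows `2, …, n`, and `ᾱ^m`, `Ā^m` belong to column `n`. -/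
def Q (Sb : ℕ → B →L[𝕜] B') (T : ℕ → B' →L[𝕜] B) (m i j : ℕ) : B →L[𝕜] B :=
  ((c 𝕜 m i)⁻¹ * c 𝕜 m j) • E Sb T i j

/-- `M Sb T k i j` is the entry `(i, j)`, `1 ≤ i, j ≤ k`, of the matrix operator `M^{2k+1}`. Its
rows are `(α^{2k} ᾱ^{2k})`, `α^{2k-1} (A^{2k} Ā^{2k})` and `M^{2k-1} A^{2k-1} (A^{2k} Ā^{2k})`, the
last row of this array being cancelled. -/
def M (Sb : ℕ → B →L[𝕜] B') (T : ℕ → B' →L[𝕜] B) : ℕ → ℕ → ℕ → (B →L[𝕜] B)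
  | 0, _, _ => 0
  | n + 1, i, j =>
    if i = 1 then Q Sb T (2 * (n + 1)) 1 j
    else if i = 2 then
      ∑ s ∈ Finset.Icc 1 n, Q Sb T (2 * n + 1) 1 s ∘L Q Sb T (2 * (n + 1)) (s + 1) j
    else
      ∑ t ∈ Finset.Icc 1 n, ∑ s ∈ Finset.Icc 1 n,
        M Sb T n (i - 2) t ∘L Q Sb T (2 * n + 1) (t + 1) s ∘L Q Sb T (2 * (n + 1)) (s + 1) j

/-- The matrix operator `M̂_{k+1} = Diag(I_B, M^{2k+1})`, indices `1, …, k+1`. -/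
def Mhat (Sb : ℕ → B →L[𝕜] B') (T : ℕ → B' →L[𝕜] B) (k i j : ℕ) : B →L[𝕜] B :=
  if i = 1 ∨ j = 1 then (if i = j then ContinuousLinearMap.id 𝕜 B else 0)
  else M Sb T k (i - 1) (j - 1)

/-- The operator
`S̄_{n+1} = [W_{2n-1}^{2n}, …, W_n^{2n}](z_{n-1}, …, z_1) · (ᾱ^{2n-1}; M^{2n-1} Ā^{2n-1})
  + ((2n)!/(n!)²) G₀² z_n`, `n ≥ 1`, in terms of `S̄_v`, `v ≤ n`, and `S_i⁻¹ P_{R_i}`, `i < n`.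
For `n = 1` this is `2 G₀² z_1`. -/
def nextSb (G : B → B') (z : ℕ → B) (Sb : ℕ → B →L[𝕜] B') (T : ℕ → B' →L[𝕜] B) (n : ℕ) :
    B →L[𝕜] B' :=
  ∑ i ∈ Finset.Icc 1 n, W 𝕜 G z (2 * n) (n - 1) (2 * n - i) ∘L
      (if i = 1 then Q Sb T (2 * n - 1) 1 n
       else ∑ t ∈ Finset.Icc 1 (n - 1),
        M Sb T (n - 1) (i - 1) t ∘L Q Sb T (2 * n - 1) (t + 1) n)
    + (((2 * n).factorial : 𝕜) / ((n.factorial : 𝕜) ^ 2)) • fderiv 𝕜 (fderiv 𝕜 G) 0 (z n)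

open Classical in
/-- The continuous projection onto `p` along `q` (`0` if `p`, `q` are not topological
complements). -/
def projOnto {X : Type*} [NormedAddCommGroup X] [NormedSpace 𝕜 X] (p q : Submodule 𝕜 X) :
    X →L[𝕜] X :=
  if h : Submodule.IsTopCompl p q then p.projectionL q h else 0

open Classical in
/-- The continuous operator inverting `S` on the subspace `X` and vanishing on the complement `Y`
of `S(X)`. It is unique if `S(X) + Y` is the whole space; it is `0` if it does not exist. -/
def invOnto (S : B →L[𝕜] B') (X : Submodule 𝕜 B) (Y : Submodule 𝕜 B') : B' →L[𝕜] B :=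
  if h : ∃ T : B' →L[𝕜] B, (∀ x ∈ X, T (S x) = x) ∧ ∀ y ∈ Y, T y = 0 then h.choose else 0

end Operators

/-- The free choices `N_i^c`, `R_i^c`, `P_{k+1}` of a fine resolution, together with the operators
`S̄_i` (which are determined by these choices through the recursion in `IsFineResolution`). Only
the indices `1 ≤ i ≤ k + 1` (and `R_0^c`) matter. -/
structure Resolution (𝕜 B B' : Type*) [RCLike 𝕜] [NormedAddCommGroup B] [NormedSpace 𝕜 B]
    [NormedAddCommGroup B'] [NormedSpace 𝕜 B'] where
  /-- the complement `N_i^c` of `N_i` in `N_{i-1}` -/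
  Nc : ℕ → Submodule 𝕜 B
  /-- the complement `R_i^c` of `R_i` in `R_{i-1}^c` -/
  Rc : ℕ → Submodule 𝕜 B'
  /-- the complement `P_{k+1}` of the line spanned by `z̄_{l,k+1}` in `N_{k+1}` -/
  P : Submodule 𝕜 B
  /-- the operators `S̄_i` -/
  Sb : ℕ → B →L[𝕜] B'

namespace Resolution

variable {𝕜 B B' : Type*} [RCLike 𝕜] [NormedAddCommGroup B] [NormedSpace 𝕜 B]
  [NormedAddCommGroup B'] [NormedSpace 𝕜 B']

/-- The pair `(N_i, R_1 ⊕ … ⊕ R_i)`: `N_0 = B`, and with `S_{i+1} = P_{R_i^c} S̄_{i+1}` on `N_i`,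
`N_{i+1} = N[S_{i+1}]`, `R_{i+1} = R[S_{i+1}]`. -/
def stage (D : Resolution 𝕜 B B') : ℕ → Submodule 𝕜 B × Submodule 𝕜 B'
  | 0 => (⊤, ⊥)
  | i + 1 =>
    let S : B →L[𝕜] B' := projOnto (D.Rc i) (D.stage i).2 ∘L D.Sb (i + 1)
    ((D.stage i).1 ⊓ LinearMap.ker S.toLinearMap,
      (D.stage i).2 ⊔ Submodule.map S.toLinearMap (D.stage i).1)

/-- The kernel `N_i`. -/
def N (D : Resolution 𝕜 B B') (i : ℕ) : Submodule 𝕜 B := (D.stage i).1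

/-- The sum `R_1 ⊕ … ⊕ R_i`. -/
def Rsum (D : Resolution 𝕜 B B') (i : ℕ) : Submodule 𝕜 B' := (D.stage i).2

/-- `S_i = P_{R_{i-1}^c} S̄_i`, `i ≥ 1` (to be applied to elements of `N_{i-1}`), the projection
being taken with respect to `B̄ = R_1 ⊕ … ⊕ R_{i-1} ⊕ R_{i-1}^c`. -/
def S (D : Resolution 𝕜 B B') (i : ℕ) : B →L[𝕜] B' :=
  projOnto (D.Rc (i - 1)) (D.Rsum (i - 1)) ∘L D.Sb i

/-- The range `R_i` of `S_i` on `N_{i-1}`, `i ≥ 1`. -/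
def R (D : Resolution 𝕜 B B') (i : ℕ) : Submodule 𝕜 B' :=
  Submodule.map (D.S i).toLinearMap (D.N (i - 1))

/-- The operator `S_i⁻¹ P_{R_i}`, `i ≥ 1`, the inverse being that of `S_i : N_i^c → R_i` and the
projection being taken with respect to `B̄ = R_1 ⊕ … ⊕ R_i ⊕ R_i^c`. -/
def T (D : Resolution 𝕜 B B') (i : ℕ) : B' →L[𝕜] B :=
  invOnto (D.S i) (D.Nc i) (D.Rsum (i - 1) ⊔ D.Rc i)

/-- `N^c = N_1^c ⊕ … ⊕ N_{k+1}^c` as a subspace of `B`. -/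
def NcSum (D : Resolution 𝕜 B B') (k : ℕ) : Submodule 𝕜 B := ⨆ j : Fin (k + 1), D.Nc (j.val + 1)

/-- `N_1^c × ⋯ × N_{k+1}^c`; the component with index `j : Fin (k + 1)` belongs to
`N_{j+1}^c`. -/
abbrev NcProd (D : Resolution 𝕜 B B') (k : ℕ) : Type _ := (j : Fin (k + 1)) → D.Nc (j.val + 1)

/-- `D` is a fine resolution of order `k` for the map `G` and the leading coefficients
`z_1, …, z_k`, where `z_l` is the coefficient used to single out `P_{k+1}`. -/
structure IsFineResolution (D : Resolution 𝕜 B B') (G : B → B') (z : ℕ → B) (k l : ℕ) :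
    Prop where
  Rc_zero : D.Rc 0 = ⊤
  Sb_one : D.Sb 1 = fderiv 𝕜 G 0
  Sb_succ : ∀ n, 1 ≤ n → n ≤ k → D.Sb (n + 1) = nextSb G z D.Sb D.T n
  isClosed_Nc : ∀ i, 1 ≤ i → i ≤ k + 1 → IsClosed (D.Nc i : Set B)
  isClosed_R : ∀ i, 1 ≤ i → i ≤ k + 1 → IsClosed (D.R i : Set B')
  isClosed_Rc : ∀ i, 1 ≤ i → i ≤ k + 1 → IsClosed (D.Rc i : Set B')
  disjoint_N : ∀ i, 1 ≤ i → i ≤ k + 1 → Disjoint (D.Nc i) (D.N i)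
  sup_N : ∀ i, 1 ≤ i → i ≤ k + 1 → D.Nc i ⊔ D.N i = D.N (i - 1)
  disjoint_R : ∀ i, 1 ≤ i → i ≤ k + 1 → Disjoint (D.R i) (D.Rc i)
  sup_R : ∀ i, 1 ≤ i → i ≤ k + 1 → D.R i ⊔ D.Rc i = D.Rc (i - 1)
  notMem_Nc : z l ∉ D.NcSum k
  isClosed_P : IsClosed (D.P : Set B)
  /-- `w` is the projection `z̄_{l,k+1}` of `z_l` onto `N_{k+1}` along `N^c`. -/
  exists_line : ∃ w ∈ D.N (k + 1), z l - w ∈ D.NcSum k ∧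
    Disjoint D.P (Submodule.span 𝕜 {w}) ∧ D.P ⊔ Submodule.span 𝕜 {w} = D.N (k + 1)

/-- The cone is `k`-transversal: `R_1 ⊕ … ⊕ R_{k+1} = B̄`. -/
def IsTransversal (D : Resolution 𝕜 B B') (k : ℕ) : Prop :=
  ⨆ j : Fin (k + 1), D.R (j.val + 1) = ⊤

/-- The `i`-th component `A_ε^i`, `1 ≤ i ≤ k + 1`, of
`A_ε = [ε^{2k+1}/(2k+1)! ⋯ ε^{k+1}/(k+1)!] · M̂_{k+1}`. -/
def Acomp (D : Resolution 𝕜 B B') (k : ℕ) (ε : 𝕜) (i : ℕ) : B →L[𝕜] B :=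
  ∑ r ∈ Finset.Icc 1 (k + 1),
    (ε ^ (2 * k + 2 - r) / ((2 * k + 2 - r).factorial : 𝕜)) • Mhat D.Sb D.T k r i

/-- `A_ε` applied to an element of `N_1^c × ⋯ × N_{k+1}^c`. -/
def A (D : Resolution 𝕜 B B') (k : ℕ) (ε : 𝕜) (n : D.NcProd k) : B :=
  ∑ j : Fin (k + 1), D.Acomp k ε (j.val + 1) (n j)

/-- `L̂_{k+1} = (1/(2k+1)!) [S̄_1 | … | S̄_{k+1}] · C^{2k+1}` on `N_1^c × ⋯ × N_{k+1}^c`. -/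
def Lhat (D : Resolution 𝕜 B B') (k : ℕ) (n : D.NcProd k) : B' :=
  ∑ j : Fin (k + 1),
    (c 𝕜 (2 * k + 1) (j.val + 1) / ((2 * k + 1).factorial : 𝕜)) • D.Sb (j.val + 1) (n j)

/-- The cone map `Z_k(ε, n_1^c, …, n_{k+1}^c, p)`. -/
def Z (D : Resolution 𝕜 B B') (z₀ : 𝕜 → B) (k : ℕ) (ε : 𝕜) (n : D.NcProd k) (p : D.P) : B :=
  z₀ ε + D.A k ε n + D.Acomp k ε (k + 1) p

/-- The cone `C_k`, with parameter range `0 < |ε| < δ`. -/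
def cone (D : Resolution 𝕜 B B') (z₀ : 𝕜 → B) (k : ℕ)
    (U : (j : Fin (k + 1)) → Set (D.Nc (j.val + 1))) (Up : Set D.P) (δ : ℝ) : Set B :=
  {z | ∃ (ε : 𝕜) (n : D.NcProd k) (p : D.P), 0 < ‖ε‖ ∧ ‖ε‖ < δ ∧ (∀ j, n j ∈ U j) ∧ p ∈ Up ∧
    z = D.Z z₀ k ε n p}

/-- `ν(ε, p) = (n_1^c(ε, p), …, n_{k+1}^c(ε, p))`, defined for `|ε| < δ` and `p ∈ Up`, describes
all solutions of `G[z] = 0` in the cone through `z(ε, p) = Z_k(ε, ν(ε, p), p)`: it is of class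
`C^m`, all `z(ε, p)` are solutions, every solution in the cone is of this form, and `z(ε, p)` is a
regular parametrisation (an immersion with complemented tangent spaces) for `ε ≠ 0`. -/
structure IsSolutionFamily (D : Resolution 𝕜 B B') (G : B → B') (z₀ : 𝕜 → B) (k : ℕ)
    (U : (j : Fin (k + 1)) → Set (D.Nc (j.val + 1))) (Up : Set D.P) (m : ℕ∞) (δ : ℝ)
    (ν : 𝕜 → D.P → D.NcProd k) : Prop where
  pos : 0 < δ
  contDiffOn_ν : ContDiffOn 𝕜 m (fun x : 𝕜 × D.P => ν x.1 x.2) (Metric.ball 0 δ ×ˢ Up)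
  contDiffOn_z : ContDiffOn 𝕜 m (fun x : 𝕜 × D.P => D.Z z₀ k x.1 (ν x.1 x.2) x.2)
    (Metric.ball 0 δ ×ˢ Up)
  solution : ∀ (ε : 𝕜) (p : D.P), ‖ε‖ < δ → p ∈ Up → G (D.Z z₀ k ε (ν ε p) p) = 0
  unique : ∀ (ε : 𝕜) (n : D.NcProd k) (p : D.P), 0 < ‖ε‖ → ‖ε‖ < δ → (∀ j, n j ∈ U j) →
    p ∈ Up → G (D.Z z₀ k ε n p) = 0 → n = ν ε p
  regular : ∀ (ε : 𝕜) (p : D.P), 0 < ‖ε‖ → ‖ε‖ < δ → p ∈ Up → ∃ Λ : B →L[𝕜] 𝕜 × D.P,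
    Λ ∘L fderiv 𝕜 (fun x : 𝕜 × D.P => D.Z z₀ k x.1 (ν x.1 x.2) x.2) (ε, p) =
      ContinuousLinearMap.id 𝕜 (𝕜 × D.P)

/-- The characteristic number `χ = 1 · dim N_2^c + … + k · dim N_{k+1}^c`. -/
def chi (D : Resolution 𝕜 B B') (k : ℕ) : ℕ :=
  ∑ i ∈ Finset.Icc 1 k, i * Module.finrank 𝕜 (D.Nc (i + 1))

end Resolution

end

end KTransversal

open KTransversal

/-! The fine resolution produces directions along the curve `z₀` that G'(z₀(ε)) damps to a
prescribed order. Let g_m be the Taylor coefficients of G'(z₀(ε)). There are operator polynomials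
Φ_i(ε) = I + O(ε) (`chain`) with G'(z₀(ε)) Φ_i(ε) x = ε^{i-1} a_i S̄_i x + O(ε^i) for x in N_{i-1},
where a_i ≠ 0 is a number. Two facts make the lower powers cancel. By construction S̄_{n+1} is, up
to a factor, the coefficient of ε^n in G'(z₀(ε)) Φ_{n+1}(ε) (`nextSb_eq_sum_compCoeff`); and ∑ S̄_v
E_{v,j} x = 0 for x in N_j (`sum_Sb_E_eq_zero`), by a back substitution that removes the components
in R_j, R_{j-1}, … one after the other. They are combined in `sum_compCoeff_chainCoeff`. The scheme
c and the factorials only normalise: by `M_eq` the matrices M consist of the coefficients of the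
chains.

Up to a factor, A^i_ε is ε^{2k+2-i} Φ_i(ε), so all components arrive at the same order: G'(z₀(ε))
A_ε = ε^{2k+1} L̂ + O(ε^{2k+2}). Since A_ε = O(ε^{k+1}), the quadratic terms of G are O(ε^{2k+2}) as
well. Hence G = G[z₀(ε)] + ε^{2k+1} H(ε, n, p) in the cone, with H smooth after 2k+1 Hadamard
divisions and linear in (n, p) up to a Lipschitz error O(ε) (`exists_cone_expansion`). Under
transversality L̂ is an isomorphism, because S̄_i agrees with the bijection S_i : N_i^c → R_i modulo
R_1 ⊕ … ⊕ R_{i-1} (`exists_LhatEquiv`).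

The assertions follow from these facts. A zero in the cone means G[z₀(ε)] = -ε^{2k+1} H with H
bounded. Conversely, once ε^{2k+1} is divided out of G[z₀(ε)], the remaining equation is a small
perturbation of a linear one and is solved by contraction. Modulo N^c the solution is z₀(ε) +
ε^{k+1} p/(k+1)!, whence its regularity. Only derivatives of G at 0 of order at most k+1 enter the
recursion, so perturbations of order k+2 leave the resolution unchanged. Inverting the nearly linear
map n ↦ G gives the rectification. Dividing the i-th chain estimate by ε^{i-1} writes G' on N^c as
an invertible operator times Diag(1, ε, …, ε^k), which yields the determinant. -/

namespace KTransversal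

/-! ### Taylor estimates and symmetry of higher derivatives over ℝ or ℂ. -/

section Taylor

variable {𝕜 E F : Type*} [RCLike 𝕜] [NormedAddCommGroup E] [NormedSpace 𝕜 E]
  [NormedAddCommGroup F] [NormedSpace 𝕜 F]

/-- The derivative of the Taylor remainder of v 0, v 1, … is the remainder of the shifted chain v 1,
v 2, …; the mean value inequality on the ball of radius ‖t‖ then gains one factor ‖t‖ per step.
Bounding the oscillation of the top function, instead of one derivative more, is what later gives a
little-o remainder. -/
theorem norm_sub_taylor_le_of_hasDerivAt (n : ℕ) : ∀ (v : ℕ → 𝕜 → F) (C R : ℝ),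
    (∀ j < n, ∀ t, ‖t‖ ≤ R → HasDerivAt (v j) (v (j + 1) t) t) →
    (∀ t, ‖t‖ ≤ R → ‖v n t - v n 0‖ ≤ C) → ∀ t, ‖t‖ ≤ R →
      ‖v 0 t - ∑ j ∈ Finset.range (n + 1), (t ^ j / (j.factorial : 𝕜)) • v j 0‖ ≤ C * ‖t‖ ^ n := by
  induction n with
  | zero => intro v C R _ h t ht; simpa using h t ht
  | succ n ih =>
    intro v C R hd hb t ht
    have IH := ih (fun j => v (j + 1)) C R (fun j hj => hd (j + 1) (by omega)) hb
    set w : 𝕜 → F := fun s => v 0 s -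
      ∑ j ∈ Finset.range (n + 2), (s ^ j / (j.factorial : 𝕜)) • v j 0 with hw
    have hw0 : w 0 = 0 := by
      simp only [hw]
      rw [Finset.sum_eq_single 0] <;> simp +contextual
    have hC : 0 ≤ C := (norm_nonneg _).trans (hb t ht)
    have hder : ∀ s ∈ Metric.closedBall (0 : 𝕜) ‖t‖, HasDerivWithinAt w
        (v 1 s - ∑ j ∈ Finset.range (n + 1), (s ^ j / (j.factorial : 𝕜)) • v (j + 1) 0)
        (Metric.closedBall (0 : 𝕜) ‖t‖) s := by
      intro s hs
      have hs' : ‖s‖ ≤ R := (by simpa using hs : ‖s‖ ≤ ‖t‖).trans ht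
      apply HasDerivAt.hasDerivWithinAt
      simp only [hw]
      apply (hd 0 (by omega) s hs').sub
      simp only [Finset.sum_range_succ' _ (n + 1)]
      have : ∀ j ∈ Finset.range (n + 1), HasDerivAt
          (fun s : 𝕜 => (s ^ (j + 1) / ((j + 1).factorial : 𝕜)) • v (j + 1) 0)
          ((s ^ j / (j.factorial : 𝕜)) • v (j + 1) 0) s := by
        intro j _
        apply HasDerivAt.smul_const
        have := (hasDerivAt_pow (j + 1) s).div_const ((j + 1).factorial : 𝕜)
        convert this using 1
        rw [Nat.factorial_succ]
        have h1 : (j.factorial : 𝕜) ≠ 0 := by exact_mod_cast j.factorial_ne_zero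
        have h2 : ((j : 𝕜) + 1) ≠ 0 := by exact_mod_cast (Nat.succ_ne_zero j)
        push_cast
        field_simp
      have h3 := HasDerivAt.fun_sum this
      simpa using h3.add_const ((s ^ 0 / ((Nat.factorial 0 : ℕ) : 𝕜)) • v 0 0)
    have hbd : ∀ s ∈ Metric.closedBall (0 : 𝕜) ‖t‖,
        ‖v 1 s - ∑ j ∈ Finset.range (n + 1), (s ^ j / (j.factorial : 𝕜)) • v (j + 1) 0‖
          ≤ C * ‖t‖ ^ n := by
      intro s hs
      have hs' : ‖s‖ ≤ ‖t‖ := by simpa using hs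
      exact (IH s (hs'.trans ht)).trans (by gcongr)
    have := (convex_closedBall (0 : 𝕜) ‖t‖).norm_image_sub_le_of_norm_hasDerivWithin_le hder hbd
      (x := 0) (y := t) (by simp) (by simp)
    rw [hw0, sub_zero, sub_zero] at this
    calc _ ≤ _ := this
      _ = _ := by ring

/-- Along t ↦ t • x the derivatives are the diagonal values of the iterated derivatives at t • x.
Continuity of the n-th one at 0 bounds its oscillation by η ‖x‖^n, and the one-variable estimate is
taken at t = 1. -/
theorem taylor_isLittleO {f : E → F} {n : ℕ} (hf : ContDiffAt 𝕜 n f 0) :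
    (fun x => f x - ∑ j ∈ Finset.range (n + 1),
      ((j.factorial : 𝕜)⁻¹) • iteratedFDeriv 𝕜 j f 0 (fun _ => x)) =o[𝓝 0]
        (fun x => ‖x‖ ^ n) := by
  rw [isLittleO_iff]
  intro η hη
  have h1 : ∀ᶠ x in 𝓝 (0 : E), ContDiffAt 𝕜 n f x := hf.eventually (by simp)
  have h2 : ∀ᶠ x in 𝓝 (0 : E), ‖iteratedFDeriv 𝕜 n f x - iteratedFDeriv 𝕜 n f 0‖ < η := by
    have := (hf.iteratedFDeriv_right (m := 0) (i := n) (by simp)).continuousAt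
    simpa [dist_eq_norm] using (Metric.tendsto_nhds.1 this) η hη
  obtain ⟨R, hR, hball⟩ := Metric.eventually_nhds_iff_ball.1 (h1.and h2)
  filter_upwards [Metric.ball_mem_nhds 0 hR] with x hx
  have hx' : ∀ t : 𝕜, ‖t‖ ≤ 1 → t • x ∈ Metric.ball (0 : E) R := by
    intro t ht
    simp only [mem_ball_zero_iff, norm_smul] at hx ⊢
    nlinarith [norm_nonneg x]
  have key := norm_sub_taylor_le_of_hasDerivAt n
    (fun j (t : 𝕜) => iteratedFDeriv 𝕜 j f (t • x) (fun _ => x)) (η * ‖x‖ ^ n) 1 ?_ ?_ 1 (by simp)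
  · simpa using key
  · intro j hj t ht
    have hc := (hball _ (hx' t ht)).1
    have hc' : ContDiffAt 𝕜 (j + 1) f (0 + t • x) := by
      rw [zero_add]; exact hc.of_le (by exact_mod_cast hj)
    have := hc'.deriv_fderiv_add_smul
    simp only [zero_add] at this
    rw [← this]
    have hd : DifferentiableAt 𝕜 (iteratedFDeriv 𝕜 j f) (t • x) :=
      hc.differentiableAt_iteratedFDeriv (by exact_mod_cast hj)
    refine DifferentiableAt.hasDerivAt ?_
    fun_prop
  · intro t ht
    simp only [zero_smul]
    rw [← sub_apply]
    refine (ContinuousMultilinearMap.le_opNorm _ _).trans ?_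
    simp only [Finset.prod_const, Finset.card_univ, Fintype.card_fin]
    gcongr
    exact (hball _ (hx' t ht)).2.le

theorem taylor_isBigO {f : E → F} {n : ℕ} (hf : ContDiffAt 𝕜 (n + 1 : ℕ) f 0) :
    (fun x => f x - ∑ j ∈ Finset.range (n + 1),
      ((j.factorial : 𝕜)⁻¹) • iteratedFDeriv 𝕜 j f 0 (fun _ => x)) =O[𝓝 0]
        (fun x => ‖x‖ ^ (n + 1)) := by
  have h := (taylor_isLittleO hf).isBigO
  have h2 : (fun x : E => (((n + 1).factorial : 𝕜)⁻¹) •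
      iteratedFDeriv 𝕜 (n + 1) f 0 (fun _ => x)) =O[𝓝 0] (fun x => ‖x‖ ^ (n + 1)) := by
    apply IsBigO.const_smul_left
    refine IsBigO.of_bound ‖iteratedFDeriv 𝕜 (n + 1) f 0‖ (Eventually.of_forall fun x => ?_)
    refine (ContinuousMultilinearMap.le_opNorm _ _).trans ?_
    simp
  refine (h.add h2).congr_left fun x => ?_
  rw [Finset.sum_range_succ _ (n + 1)]
  abel

/-- The iterated derivative of a function of class `C^n` is symmetric. -/
theorem iteratedFDeriv_comp_perm_of_contDiffAt (n : ℕ) : ∀ {f : E → F} {x : E},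
    ContDiffAt 𝕜 n f x → ∀ (v : Fin n → E) (σ : Equiv.Perm (Fin n)),
      iteratedFDeriv 𝕜 n f x (v ∘ σ) = iteratedFDeriv 𝕜 n f x v := by
  induction n with
  | zero => intro f x _ v σ; congr 1; exact Subsingleton.elim _ _
  | succ n ih =>
    intro f x hf v σ
    have hdir : ∀ w : E, ContDiffAt 𝕜 n (fun y => fderiv 𝕜 f y w) x := fun w =>
      (hf.fderiv_right (m := n) (by norm_cast)).clm_apply contDiffAt_const
    have hlast : ∀ v : Fin (n + 1) → E, iteratedFDeriv 𝕜 (n + 1) f x v =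
        iteratedFDeriv 𝕜 n (fun y => fderiv 𝕜 f y (v (Fin.last n))) x (Fin.init v) := by
      intro v
      rw [iteratedFDeriv_succ_apply_right]
      have h1 : ContDiffAt 𝕜 n (fderiv 𝕜 f) x := hf.fderiv_right (by norm_cast)
      have := (ContinuousLinearMap.apply 𝕜 F (v (Fin.last n))).iteratedFDeriv_comp_left h1
        (i := n) le_rfl
      have h2 := congrArg (fun g => g (Fin.init v)) this
      simpa [Function.comp_def] using h2.symm
    -- Adjacent transpositions suffice, as they generate the symmetric group. One that avoids the
    -- last slot is handled by freezing that slot (`hlast`); one that involves it avoids the first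
    -- slot if n ≥ 2, and is then permuted inside the outermost derivative; n = 1 is the symmetry of
    -- the second derivative.
    have hswap : ∀ (v : Fin (n + 1) → E) (i : Fin n),
        iteratedFDeriv 𝕜 (n + 1) f x (v ∘ Equiv.swap i.castSucc i.succ) =
          iteratedFDeriv 𝕜 (n + 1) f x v := by
      intro v i
      by_cases hi : i.succ = Fin.last n
      · rcases Nat.lt_or_ge 1 n with hn | hn
        · -- the swap fixes the first index
          obtain ⟨m, rfl⟩ : ∃ m, n = m + 1 := ⟨n - 1, by omega⟩
          have hev : ∀ᶠ y in 𝓝 x, ContDiffAt 𝕜 (m + 1 : ℕ) f y :=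
            (hf.of_le (by exact_mod_cast Nat.le_succ _)).eventually (by simp)
          have hd : DifferentiableAt 𝕜 (iteratedFDeriv 𝕜 (m + 1) f) x :=
            hf.differentiableAt_iteratedFDeriv (by exact_mod_cast Nat.lt_succ_self _)
          have hi0 : i ≠ 0 := by
            rintro rfl
            simp [Fin.ext_iff] at hi
            omega
          obtain ⟨j, rfl⟩ := Fin.exists_succ_eq.2 hi0
          rw [iteratedFDeriv_succ_apply_left, iteratedFDeriv_succ_apply_left]
          have e0 : (v ∘ Equiv.swap (j.succ).castSucc (j.succ).succ) 0 = v 0 := by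
            simp only [Function.comp]
            rw [Equiv.swap_apply_of_ne_of_ne]
            · simp [Fin.ext_iff]
            · simp [Fin.ext_iff]
          have e1 : Fin.tail (v ∘ Equiv.swap (j.succ).castSucc (j.succ).succ) =
              Fin.tail v ∘ Equiv.swap j.castSucc j.succ := by
            ext a
            simp only [Fin.tail, Function.comp]
            congr 1
            have := (Fin.succ_injective (m + 1)).swap_apply j.castSucc j.succ a
            rw [← this]
            rfl
          rw [e0, e1]
          have : ∀ u : Fin (m + 1) → E, fderiv 𝕜 (iteratedFDeriv 𝕜 (m + 1) f) x (v 0) u =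
              fderiv 𝕜 (fun y => iteratedFDeriv 𝕜 (m + 1) f y u) x (v 0) := by
            intro u
            have h := ((ContinuousMultilinearMap.apply 𝕜 (fun _ : Fin (m + 1) => E) F u).hasFDerivAt.comp x
              hd.hasFDerivAt).fderiv
            have h' := congrArg (fun g => g (v 0)) h
            simpa [Function.comp_def] using h'.symm
          rw [this, this]
          congr 1
          apply Filter.EventuallyEq.fderiv_eq
          filter_upwards [hev] with y hy
          exact ih hy _ _
        · obtain rfl : n = 1 := by have := i.isLt; omega
          obtain rfl : i = 0 := Subsingleton.elim _ _
          have hs : IsSymmSndFDerivAt 𝕜 f x := by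
            apply ContDiffAt.isSymmSndFDerivAt (n := 2)
            · exact_mod_cast hf
            · simp
          have key : ∀ u : Fin (1 + 1) → E, iteratedFDeriv 𝕜 (1 + 1) f x u =
            fderiv 𝕜 (fderiv 𝕜 f) x (u 0) (u 1) := fun u => iteratedFDeriv_two_apply f x u
          rw [key, key]
          have e0 : (v ∘ Equiv.swap (Fin.castSucc (0 : Fin 1)) (Fin.succ 0)) 0 = v 1 := by simp
          have e1 : (v ∘ Equiv.swap (Fin.castSucc (0 : Fin 1)) (Fin.succ 0)) 1 = v 0 := by simp
          rw [e0, e1]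
          exact hs _ _
      · rw [hlast, hlast]
        have hlt : i.succ ≠ Fin.last n := hi
        obtain ⟨j, hj⟩ := Fin.exists_castSucc_eq.2 hlt
        have e0 : (v ∘ Equiv.swap i.castSucc i.succ) (Fin.last n) = v (Fin.last n) := by
          simp only [Function.comp]
          rw [Equiv.swap_apply_of_ne_of_ne (Fin.castSucc_lt_last i).ne' (Ne.symm hlt)]
        have e1 : Fin.init (v ∘ Equiv.swap i.castSucc i.succ) = Fin.init v ∘ Equiv.swap i j := by
          ext a
          simp only [Fin.init, Function.comp]
          congr 1
          have := (Fin.castSucc_injective n).swap_apply i j a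
          rw [← hj, ← this]
        rw [e0, e1]
        exact ih (hdir _) _ _
    have hmem : σ ∈ Submonoid.closure (Set.range fun i : Fin n => Equiv.swap i.castSucc i.succ) := by
      rw [Equiv.Perm.mclosure_swap_castSucc_succ]; trivial
    revert v
    induction hmem using Submonoid.closure_induction with
    | mem τ hτ => obtain ⟨i, rfl⟩ := hτ; exact fun v => hswap v i
    | one => intro v; rfl
    | mul a b _ _ ha hb =>
      intro v
      have : v ∘ (a * b : Equiv.Perm (Fin (n + 1))) = (v ∘ a) ∘ b := rfl
      rw [this, hb, ha]

/-- By strong induction only the j-th Taylor term is left, so this homogeneous polynomial of degree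
j is o(‖x‖^j) and vanishes along every line. Polarisation passes from the diagonal to all arguments.
-/
theorem iteratedFDeriv_eq_zero_of_isLittleO {f : E → F} {n : ℕ} (hf : ContDiffAt 𝕜 n f 0)
    (ho : f =o[𝓝 0] (fun x => ‖x‖ ^ n)) : ∀ j ≤ n, iteratedFDeriv 𝕜 j f 0 = 0 := by
  intro j
  induction j using Nat.strong_induction_on with
  | _ j ih =>
  intro hj
  have hfj : ContDiffAt 𝕜 j f 0 := hf.of_le (by exact_mod_cast hj)
  have hoj : f =o[𝓝 0] (fun x => ‖x‖ ^ j) := by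
    refine ho.trans_isBigO (IsBigO.of_bound 1 ?_)
    filter_upwards [Metric.ball_mem_nhds (0 : E) one_pos] with x hx
    have hx' : ‖x‖ ≤ 1 := by simpa using (mem_ball_zero_iff.1 hx).le
    simpa using pow_le_pow_of_le_one (norm_nonneg x) hx' hj
  have hT := taylor_isLittleO hfj
  have hdiag : ∀ y : E, iteratedFDeriv 𝕜 j f 0 (fun _ => y) = 0 := by
    have hsum : (fun x : E => ((j.factorial : 𝕜)⁻¹) • iteratedFDeriv 𝕜 j f 0 (fun _ => x))
        =o[𝓝 0] (fun x => ‖x‖ ^ j) := by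
      refine (hoj.sub hT).congr_left fun x => ?_
      rw [Finset.sum_range_succ, Finset.sum_eq_zero]
      · simp
      · intro i hi
        rw [ih i (Finset.mem_range.1 hi) (by have := Finset.mem_range.1 hi; omega)]
        simp
    have hfac : ((j.factorial : 𝕜)⁻¹) ≠ 0 := inv_ne_zero (by exact_mod_cast j.factorial_ne_zero)
    have hsum' := (isLittleO_const_smul_left hfac).1 hsum
    intro y
    by_contra hne
    have ht : Tendsto (fun t : 𝕜 => t • y) (𝓝 0) (𝓝 0) := by
      have : Continuous fun t : 𝕜 => t • y := by fun_prop
      simpa using this.tendsto 0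
    have h3 := hsum'.comp_tendsto ht
    have h4 : (fun t : 𝕜 => t ^ j • iteratedFDeriv 𝕜 j f 0 (fun _ => y)) =o[𝓝 0]
        (fun t : 𝕜 => (‖y‖ ^ j) * ‖t‖ ^ j) := by
      refine h3.congr (fun t => ?_) (fun t => ?_)
      · have := (iteratedFDeriv 𝕜 j f 0).map_smul_univ (fun _ => t) (fun _ => y)
        simpa using this
      · simp [norm_smul, mul_pow, mul_comm]
    have h5 : (fun t : 𝕜 => t ^ j • iteratedFDeriv 𝕜 j f 0 (fun _ => y)) =o[𝓝 0]
        (fun t : 𝕜 => t ^ j) :=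
      h4.trans_isBigO (IsBigO.of_bound (‖y‖ ^ j) (Eventually.of_forall fun t => by simp))
    have h6 := (isLittleO_iff.1 h5) (half_pos (norm_pos_iff.2 hne))
    have h7 : ∃ t : 𝕜, t ≠ 0 ∧ ‖t ^ j • iteratedFDeriv 𝕜 j f 0 (fun _ => y)‖ ≤
        ‖iteratedFDeriv 𝕜 j f 0 (fun _ => y)‖ / 2 * ‖t ^ j‖ := by
      have := (h6.filter_mono (nhdsWithin_le_nhds (s := {0}ᶜ))).and self_mem_nhdsWithin
      obtain ⟨t, h, h'⟩ := this.exists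
      exact ⟨t, h', h⟩
    obtain ⟨t, ht0, h⟩ := h7
    rw [norm_smul] at h
    have hp : 0 < ‖t ^ j‖ := norm_pos_iff.2 (pow_ne_zero _ ht0)
    have hp2 : 0 < ‖iteratedFDeriv 𝕜 j f 0 (fun _ => y)‖ := norm_pos_iff.2 hne
    nlinarith
  ext v
  -- Polarisation: the j-th derivative of x ↦ f^{(j)}(0)(x, …, x) is the sum over all permutations
  -- of the arguments, hence j! f^{(j)}(0) by symmetry.
  have h := (iteratedFDeriv 𝕜 j f 0).iteratedFDeriv_comp_diagonal 0 v
  have hz : (fun x : E => iteratedFDeriv 𝕜 j f 0 (fun _ => x)) = fun _ => 0 := funext hdiag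
  rw [hz] at h
  have h' : ∀ σ : Equiv.Perm (Fin j), iteratedFDeriv 𝕜 j f 0 (fun i => v (σ i)) =
      iteratedFDeriv 𝕜 j f 0 v := fun σ => iteratedFDeriv_comp_perm_of_contDiffAt j hfj v σ
  simp only [h', Finset.sum_const, Finset.card_univ, Fintype.card_perm, Fintype.card_fin] at h
  have h0 : iteratedFDeriv 𝕜 j (fun _ : E => (0 : F)) 0 v = 0 := by
    simp
  rw [h0, ← Nat.cast_smul_eq_nsmul 𝕜] at h
  have hfac : (j.factorial : 𝕜) ≠ 0 := by exact_mod_cast j.factorial_ne_zero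
  simpa [hfac] using h.symm

end Taylor

end KTransversal

namespace KTransversal

/-! ### Integrals over [0, 1] depending on a parameter in a normed space. -/

section ParametricIntegral

variable {𝕜 E F : Type*} [RCLike 𝕜] [NormedAddCommGroup E] [NormedSpace 𝕜 E]
  [NormedAddCommGroup F]

/-- Compactness of [0, 1] (tube lemma) gives one bound on a whole neighbourhood of x, although E
need not be locally compact. It serves as the dominating constant below. -/
theorem eventually_norm_le_of_continuousOn {f : E → ℝ → F} {Ω : Set E} (hΩ : IsOpen Ω)
    (hf : ContinuousOn (fun z : E × ℝ => f z.1 z.2) (Ω ×ˢ Set.Icc 0 1)) {x : E} (hx : x ∈ Ω) :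
    ∃ C : ℝ, ∀ᶠ y in 𝓝 x, y ∈ Ω ∧ ∀ t ∈ Set.Icc (0 : ℝ) 1, ‖f y t‖ ≤ C := by
  have hc : ContinuousOn (fun t : ℝ => f x t) (Set.Icc 0 1) :=
    hf.comp (f := fun t : ℝ => (x, t)) (by fun_prop) (fun t ht => ⟨hx, ht⟩)
  obtain ⟨C, hC⟩ := isCompact_Icc.exists_bound_of_continuousOn hc
  refine ⟨C + 1, ?_⟩
  have := (isCompact_Icc (a := (0 : ℝ)) (b := 1)).eventually_forall_of_forall_eventually
    (x₀ := x) (P := fun y t => y ∈ Ω → t ∈ Set.Icc (0 : ℝ) 1 → ‖f y t‖ ≤ C + 1) ?_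
  · filter_upwards [this, hΩ.mem_nhds hx] with y hy hyΩ using
      ⟨hyΩ, fun t ht => hy t ht hyΩ ht⟩
  · intro t ht
    have h1 := (hf (x, t) ⟨hx, ht⟩).norm
    have h2 : ∀ᶠ z in 𝓝[Ω ×ˢ Set.Icc 0 1] (x, t), ‖f z.1 z.2‖ < C + 1 :=
      h1.eventually_lt_const ((hC t ht).trans_lt (lt_add_one C))
    rw [eventually_nhdsWithin_iff] at h2
    filter_upwards [h2] with z hz hz1 hz2 using (hz ⟨hz1, hz2⟩).le

theorem intervalIntegrable_of_continuousOn_prod {f : E → ℝ → F} {Ω : Set E}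
    (hf : ContinuousOn (fun z : E × ℝ => f z.1 z.2) (Ω ×ˢ Set.Icc 0 1)) {x : E} (hx : x ∈ Ω) :
    IntervalIntegrable (f x) MeasureTheory.volume 0 1 := by
  apply ContinuousOn.intervalIntegrable
  rw [Set.uIcc_of_le zero_le_one]
  exact hf.comp (f := fun t : ℝ => (x, t)) (by fun_prop) (fun t ht => ⟨hx, ht⟩)

variable [NormedSpace ℝ F]

theorem continuousOn_intervalIntegral {f : E → ℝ → F} {Ω : Set E} (hΩ : IsOpen Ω)
    (hf : ContinuousOn (fun z : E × ℝ => f z.1 z.2) (Ω ×ˢ Set.Icc 0 1)) :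
    ContinuousOn (fun x => ∫ t in (0 : ℝ)..1, f x t) Ω := by
  intro x hx
  apply ContinuousAt.continuousWithinAt
  obtain ⟨C, hC⟩ := eventually_norm_le_of_continuousOn hΩ hf hx
  apply intervalIntegral.continuousAt_of_dominated_interval (bound := fun _ => C)
  · filter_upwards [hC] with y hy
    have := (intervalIntegrable_of_continuousOn_prod hf hy.1).aestronglyMeasurable
    rwa [Set.uIoc_of_le zero_le_one]
  · filter_upwards [hC] with y hy
    refine Eventually.of_forall fun t ht => hy.2 t ?_
    rw [Set.uIoc_of_le zero_le_one] at ht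
    exact ⟨ht.1.le, ht.2⟩
  · simp
  · refine Eventually.of_forall fun t ht => ?_
    rw [Set.uIoc_of_le zero_le_one] at ht
    have h1 : ContinuousOn (fun y => f y t) Ω :=
      hf.comp (f := fun y : E => (y, t)) (by fun_prop) (fun y hy => ⟨hy, ht.1.le, ht.2⟩)
    exact h1.continuousAt (hΩ.mem_nhds hx)

variable [NormedSpace 𝕜 F] [SMulCommClass 𝕜 ℝ F]

theorem hasFDerivAt_intervalIntegral {f : E → ℝ → F} {f' : E → ℝ → E →L[𝕜] F} {Ω : Set E}
    (hΩ : IsOpen Ω) (hf : ContinuousOn (fun z : E × ℝ => f z.1 z.2) (Ω ×ˢ Set.Icc 0 1))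
    (hf' : ContinuousOn (fun z : E × ℝ => f' z.1 z.2) (Ω ×ˢ Set.Icc 0 1))
    (hd : ∀ x ∈ Ω, ∀ t ∈ Set.Icc (0 : ℝ) 1, HasFDerivAt (fun y => f y t) (f' x t) x)
    {x : E} (hx : x ∈ Ω) :
    HasFDerivAt (fun x => ∫ t in (0 : ℝ)..1, f x t) (∫ t in (0 : ℝ)..1, f' x t) x := by
  obtain ⟨C, hC⟩ := eventually_norm_le_of_continuousOn hΩ hf' hx
  have hI : ∀ t : ℝ, t ∈ Set.uIoc (0 : ℝ) 1 → t ∈ Set.Icc (0 : ℝ) 1 := by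
    intro t ht
    rw [Set.uIoc_of_le zero_le_one] at ht
    exact ⟨ht.1.le, ht.2⟩
  have := intervalIntegral.hasFDerivAt_integral_of_dominated_of_fderiv_le (𝕜 := 𝕜)
    (μ := MeasureTheory.volume) (a := 0) (b := 1)
    (F := f) (F' := f') (x₀ := x) (bound := fun _ => C) hC ?_ ?_ ?_ ?_ ?_ ?_
  · exact this
  · filter_upwards [hC] with y hy
    have := (intervalIntegrable_of_continuousOn_prod hf hy.1).aestronglyMeasurable
    rwa [Set.uIoc_of_le zero_le_one]
  · exact intervalIntegrable_of_continuousOn_prod hf hx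
  · have := (intervalIntegrable_of_continuousOn_prod hf' hx).aestronglyMeasurable
    rwa [Set.uIoc_of_le zero_le_one]
  · exact Eventually.of_forall fun t ht y hy => hy.2 t (hI t ht)
  · simp
  · exact Eventually.of_forall fun t ht y hy => hd y hy.1 t (hI t ht)

end ParametricIntegral

/-! ### Division of smooth functions by powers of ε. -/

theorem isBigO_pow_of_smul {𝕜 F : Type*} [RCLike 𝕜] [NormedAddCommGroup F]
    [NormedSpace 𝕜 F] {g : 𝕜 → F} {m : ℕ} (hg : ContinuousAt g 0)
    (h : (fun ε : 𝕜 => ε • g ε) =O[𝓝 0] (fun ε : 𝕜 => ‖ε‖ ^ (m + 1))) :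
    g =O[𝓝 0] (fun ε : 𝕜 => ‖ε‖ ^ m) := by
  obtain ⟨C, hC⟩ := h.bound
  have h1 : ∀ᶠ ε in 𝓝[≠] (0 : 𝕜), ‖g ε‖ ≤ C * ‖ε‖ ^ m := by
    filter_upwards [hC.filter_mono nhdsWithin_le_nhds, self_mem_nhdsWithin] with ε hε hne
    have hpos : 0 < ‖ε‖ := norm_pos_iff.2 hne
    rw [norm_smul] at hε
    simp only [norm_pow, norm_norm] at hε
    rw [pow_succ] at hε
    nlinarith
  refine IsBigO.of_bound C ?_
  rw [eventually_nhdsWithin_iff] at h1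
  -- Division gives no information at ε = 0; there the bound is the limit of the bounds for ε ≠ 0.
  have h0 : ‖g 0‖ ≤ C * ‖(0 : 𝕜)‖ ^ m := by
    have hc : Tendsto (fun ε : 𝕜 => C * ‖ε‖ ^ m) (𝓝[≠] 0) (𝓝 (C * ‖(0 : 𝕜)‖ ^ m)) := by
      have : Continuous fun ε : 𝕜 => C * ‖ε‖ ^ m := by fun_prop
      exact (this.tendsto 0).mono_left nhdsWithin_le_nhds
    exact le_of_tendsto_of_tendsto (hg.norm.tendsto.mono_left nhdsWithin_le_nhds) hc
      (eventually_nhdsWithin_iff.2 h1)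
  filter_upwards [h1] with ε hε
  rw [norm_pow, norm_norm]
  by_cases hne : ε = 0
  · rw [hne]; exact h0
  · exact hε hne

theorem eq_zero_of_isBigO_pow {𝕜 F : Type*} [RCLike 𝕜] [NormedAddCommGroup F] {f : 𝕜 → F} {m : ℕ}
    (h : f =O[𝓝 0] (fun ε : 𝕜 => ‖ε‖ ^ (m + 1))) : f 0 = 0 := by
  obtain ⟨C, hC⟩ := h.bound
  simpa using hC.self_of_nhds

section Division

variable {𝕜 E F : Type*} [RCLike 𝕜] [NormedAddCommGroup E] [NormedSpace 𝕜 E]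
  [NormedAddCommGroup F] [NormedSpace 𝕜 F] [CompleteSpace F]

/-- The whole Taylor series is integrated at once. Since τ t is linear, the series of g ∘ τ t is
that of g composed with τ t, so each term is jointly continuous in (x, t) and may be differentiated
under the integral. -/
theorem contDiffOn_intervalIntegral_comp [NormedSpace ℝ F] [SMulCommClass 𝕜 ℝ F]
    {n : ℕ} {g : E → F} {Ω : Set E} (hΩ : IsOpen Ω)
    (hg : ContDiffOn 𝕜 n g Ω) (τ : ℝ → E →L[𝕜] E) (hτ : Continuous τ)
    (hτΩ : ∀ t ∈ Set.Icc (0 : ℝ) 1, ∀ x ∈ Ω, τ t x ∈ Ω) :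
    ContDiffOn 𝕜 n (fun x => ∫ t in (0 : ℝ)..1, g (τ t x)) Ω := by
  set p : E → ℝ → FormalMultilinearSeries 𝕜 E F := fun x t k =>
    (ftaylorSeriesWithin 𝕜 g Ω (τ t x) k).compContinuousLinearMap (fun _ => τ t) with hp
  have hts := hg.ftaylorSeriesWithin hΩ.uniqueDiffOn
  have hpt : ∀ t ∈ Set.Icc (0 : ℝ) 1,
      HasFTaylorSeriesUpToOn n (fun x => g (τ t x)) (fun x => p x t) Ω := fun t ht =>
    (hts.compContinuousLinearMap (τ t)).mono (fun x hx => hτΩ t ht x hx)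
  have hτc : Continuous fun z : E × ℝ => τ z.2 z.1 := by fun_prop
  have hpc : ∀ m : ℕ, m ≤ n → ContinuousOn (fun z : E × ℝ => p z.1 z.2 m) (Ω ×ˢ Set.Icc 0 1) := by
    intro m hm
    have h1 : ContinuousOn (fun z : E × ℝ => ftaylorSeriesWithin 𝕜 g Ω (τ z.2 z.1) m)
        (Ω ×ˢ Set.Icc 0 1) :=
      (hts.cont m (by exact_mod_cast hm)).comp hτc.continuousOn (fun z hz => hτΩ z.2 hz.2 z.1 hz.1)
    have h2 : Continuous fun z : E × ℝ =>
        ContinuousMultilinearMap.compContinuousLinearMapContinuousMultilinear 𝕜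
          (fun _ : Fin m => E) (fun _ : Fin m => E) F (fun _ => τ z.2) := by
      fun_prop
    exact h2.continuousOn.clm_apply h1
  refine (HasFTaylorSeriesUpToOn.contDiffOn (n := (n : ℕ∞)) (f' := fun x m =>
    ∫ t in (0 : ℝ)..1, p x t m) ⟨?_, ?_, ?_⟩)
  · intro x hx
    have hint := intervalIntegrable_of_continuousOn_prod (f := fun x t => p x t 0) (hpc 0 (Nat.zero_le _)) hx
    have := ContinuousLinearMap.intervalIntegral_comp_comm
      (continuousMultilinearCurryFin0 𝕜 E F).toContinuousLinearEquiv.toContinuousLinearMap hint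
    change (continuousMultilinearCurryFin0 𝕜 E F).toContinuousLinearEquiv.toContinuousLinearMap
      (∫ t in (0 : ℝ)..1, p x t 0) = _
    rw [← this]
    rfl
  · intro m hm x hx
    have hm' : m + 1 ≤ n := by exact_mod_cast hm
    have hint := intervalIntegrable_of_continuousOn_prod (f := fun x t => p x t (m + 1)) (hpc (m + 1) hm') hx
    let curry : (E [×(m + 1)]→L[𝕜] F) →L[𝕜] (E →L[𝕜] (E [×m]→L[𝕜] F)) :=
      (continuousMultilinearCurryLeftEquiv 𝕜
        (fun _ : Fin (m + 1) => E) F).toContinuousLinearEquiv.toContinuousLinearMap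
    have := ContinuousLinearMap.intervalIntegral_comp_comm (𝕜 := 𝕜)
      (E := E [×(m + 1)]→L[𝕜] F) (F := E →L[𝕜] (E [×m]→L[𝕜] F)) curry hint
    apply HasFDerivAt.hasFDerivWithinAt
    change HasFDerivAt _ (curry (∫ t in (0 : ℝ)..1, p x t (m + 1))) x
    rw [← this]
    refine hasFDerivAt_intervalIntegral (f := fun y t => p y t m)
      (f' := fun y t => (p y t (m + 1)).curryLeft) hΩ (hpc m (by omega)) ?_ ?_ hx
    · exact (continuousMultilinearCurryLeftEquiv 𝕜
        (fun _ : Fin (m + 1) => E) F).continuous.comp_continuousOn (hpc (m + 1) hm')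
    · intro y hy t ht
      exact ((hpt t ht).fderivWithin m hm y hy).hasFDerivAt (hΩ.mem_nhds hy)
  · intro m hm
    exact continuousOn_intervalIntegral hΩ (hpc m (by exact_mod_cast hm))

variable {Y : Type*} [NormedAddCommGroup Y] [NormedSpace 𝕜 Y]

/-- Hadamard's lemma: g(ε, y) = ∫₀¹ ∂_ε f(tε, y) dt, at the cost of one derivative. Real t suffices
also for 𝕜 = ℂ, since the segment from 0 to ε stays in the ball. -/
theorem exists_contDiffOn_smul_of_eq_zero {q : ℕ∞} (hq : 1 ≤ q) {f : 𝕜 × Y → F} {r : ℝ}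
    (hf : ContDiffOn 𝕜 q f (Metric.ball 0 r ×ˢ Set.univ)) (hf0 : ∀ y, f (0, y) = 0) :
    ∃ g : 𝕜 × Y → F, ContDiffOn 𝕜 (q - 1 : ℕ∞) g (Metric.ball 0 r ×ˢ Set.univ) ∧
      ∀ x ∈ Metric.ball (0 : 𝕜) r ×ˢ (Set.univ : Set Y), f x = x.1 • g x := by
  -- The integral over real t needs a real structure on F compatible with the one over 𝕜.
  let _ : NormedSpace ℝ F := NormedSpace.restrictScalars ℝ 𝕜 F
  have hst : IsScalarTower ℝ 𝕜 F := ⟨fun a b c => by rw [Algebra.smul_def, mul_smul]; rfl⟩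
  have hsc : SMulCommClass ℝ 𝕜 F := IsScalarTower.to_smulCommClass
  have hsc' : SMulCommClass 𝕜 ℝ F := IsScalarTower.to_smulCommClass'
  set Ω : Set (𝕜 × Y) := Metric.ball 0 r ×ˢ Set.univ with hΩdef
  have hΩ : IsOpen Ω := Metric.isOpen_ball.prod isOpen_univ
  set τ : ℝ → (𝕜 × Y) →L[𝕜] (𝕜 × Y) := fun t =>
    (t : 𝕜) • (ContinuousLinearMap.inl 𝕜 𝕜 Y ∘L ContinuousLinearMap.fst 𝕜 𝕜 Y) +
      ContinuousLinearMap.inr 𝕜 𝕜 Y ∘L ContinuousLinearMap.snd 𝕜 𝕜 Y with hτdef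
  have hτ : Continuous τ := by
    simp only [hτdef]
    fun_prop
  have hτΩ : ∀ t ∈ Set.Icc (0 : ℝ) 1, ∀ x ∈ Ω, τ t x ∈ Ω := by
    intro t ht x hx
    refine ⟨?_, trivial⟩
    have h1 : ‖x.1‖ < r := by simpa using hx.1
    simp only [hτdef, mem_ball_zero_iff]
    simp
    rw [abs_of_nonneg ht.1]
    nlinarith [ht.2, norm_nonneg x.1]
  set d : 𝕜 × Y → F := fun x => fderiv 𝕜 f x (1, 0)
  have hdn : ∀ n : ℕ, ((n + 1 : ℕ) : ℕ∞) ≤ q → ContDiffOn 𝕜 n d Ω := fun n hn =>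
    (hf.fderiv_of_isOpen hΩ (m := n) (by exact_mod_cast hn)).clm_apply contDiffOn_const
  refine ⟨fun x => ∫ t in (0 : ℝ)..1, d (τ t x), ?_, ?_⟩
  -- As q may be infinite, smoothness is checked at each finite order.
  · have hn : ∀ n : ℕ, (n : ℕ∞) ≤ q - 1 → ContDiffOn 𝕜 n
        (fun x => ∫ t in (0 : ℝ)..1, d (τ t x)) Ω := by
      intro n hn
      refine contDiffOn_intervalIntegral_comp hΩ (hdn n ?_) τ hτ hτΩ
      have := add_le_add_left hn 1
      rw [tsub_add_cancel_of_le hq] at this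
      exact_mod_cast this
    rw [contDiffOn_iff_forall_nat_le]
    intro m hm
    exact hn m (by exact_mod_cast hm)
  · intro x hx
    have hdc : ContinuousOn d Ω := (hdn 0 (by simpa using hq)).continuousOn
    have hder : ∀ t ∈ Set.uIcc (0 : ℝ) 1, HasDerivAt (fun t : ℝ => f (τ t x)) (x.1 • d (τ t x)) t := by
      intro t ht
      rw [Set.uIcc_of_le zero_le_one] at ht
      have hfd : HasFDerivAt f (fderiv 𝕜 f (τ t x)) (τ t x) :=
        ((hf.contDiffAt (hΩ.mem_nhds (hτΩ t ht x hx))).differentiableAt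
          (by exact_mod_cast (zero_lt_one.trans_le hq).ne')).hasFDerivAt
      have hline : HasDerivAt (fun s : 𝕜 => ((s * x.1, x.2) : 𝕜 × Y)) (x.1, 0) (t : 𝕜) := by
        have h1 : HasDerivAt (fun s : 𝕜 => s * x.1) x.1 (t : 𝕜) := by
          simpa using (hasDerivAt_id (t : 𝕜)).mul_const x.1
        exact h1.prodMk (hasDerivAt_const _ _)
      have hτx : ∀ s : ℝ, τ s x = ((s : 𝕜) * x.1, x.2) := fun s => by simp [hτdef]
      rw [hτx] at hfd
      have h2 : HasDerivAt (fun s : 𝕜 => f (s * x.1, x.2)) (fderiv 𝕜 f ((t : 𝕜) * x.1, x.2) (x.1, 0))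
        (t : 𝕜) := hfd.comp_hasDerivAt (t : 𝕜) hline
      have h3 : HasDerivAt (fun s : ℝ => (s : 𝕜)) 1 t := by
        simpa using (RCLike.ofRealCLM (K := 𝕜)).hasDerivAt (x := t)
      have h4 := h2.scomp t h3
      simp only [hτx]
      have h5 : x.1 • d ((t : 𝕜) * x.1, x.2) = fderiv 𝕜 f ((t : 𝕜) * x.1, x.2) (x.1, 0) := by
        simp only [d]
        rw [← map_smul]
        simp
      rw [h5]
      simpa [Function.comp_def] using h4
    have hint : IntervalIntegrable (fun t => x.1 • d (τ t x)) MeasureTheory.volume 0 1 := by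
      apply ContinuousOn.intervalIntegrable
      rw [Set.uIcc_of_le zero_le_one]
      apply ContinuousOn.const_smul
      exact hdc.comp (by fun_prop) (fun t ht => hτΩ t ht x hx)
    have := intervalIntegral.integral_eq_sub_of_hasDerivAt hder hint
    have h0 : τ 0 x = (0, x.2) := by simp [hτdef]
    have h1 : τ 1 x = x := by simp [hτdef]
    rw [h0, h1, hf0, sub_zero] at this
    rw [← this, intervalIntegral.integral_smul]

/-- Hadamard division iterated m times. The order of vanishing is needed only for each y separately,
because every step uses nothing but the value of the current quotient at ε = 0. -/
theorem exists_contDiffOn_pow_smul {r : ℝ} (hr : 0 < r) (m : ℕ) : ∀ {q : ℕ∞} {f : 𝕜 × Y → F},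
    (m : ℕ∞) ≤ q → ContDiffOn 𝕜 q f (Metric.ball 0 r ×ˢ Set.univ) →
    (∀ y, (fun ε : 𝕜 => f (ε, y)) =O[𝓝 0] (fun ε : 𝕜 => ‖ε‖ ^ m)) →
    ∃ g : 𝕜 × Y → F, ContDiffOn 𝕜 (q - m : ℕ∞) g (Metric.ball 0 r ×ˢ Set.univ) ∧
      ∀ x ∈ Metric.ball (0 : 𝕜) r ×ˢ (Set.univ : Set Y), f x = x.1 ^ m • g x := by
  induction m with
  | zero => intro q f _ hf _; exact ⟨f, by simpa using hf, by simp⟩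
  | succ m ih =>
    intro q f hq hf hO
    have hq1 : 1 ≤ q := le_trans (by exact_mod_cast Nat.le_add_left 1 m) hq
    have hqm : (m : ℕ∞) ≤ q - 1 := by
      apply ENat.le_sub_of_add_le_right (by simp)
      exact_mod_cast hq
    obtain ⟨g, hg, hfg⟩ := exists_contDiffOn_smul_of_eq_zero hq1 hf
      (fun y => eq_zero_of_isBigO_pow (hO y))
    have hgO : ∀ y, (fun ε : 𝕜 => g (ε, y)) =O[𝓝 0] (fun ε : 𝕜 => ‖ε‖ ^ m) := by
      intro y
      apply isBigO_pow_of_smul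
      · have hΩ : IsOpen (Metric.ball (0 : 𝕜) r ×ˢ (Set.univ : Set Y)) :=
          Metric.isOpen_ball.prod isOpen_univ
        have hc : ContinuousAt g (0, y) :=
          hg.continuousOn.continuousAt (hΩ.mem_nhds ⟨Metric.mem_ball_self hr, trivial⟩)
        exact hc.comp (f := fun ε : 𝕜 => (ε, y)) (by fun_prop)
      · refine (hO y).congr' ?_ EventuallyEq.rfl
        filter_upwards [Metric.ball_mem_nhds (0 : 𝕜) hr] with ε hε
        exact hfg (ε, y) ⟨hε, trivial⟩
    obtain ⟨g', hg', hgg'⟩ := ih hqm hg hgO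
    refine ⟨g', ?_, fun x hx => ?_⟩
    · have : (q - (m + 1 : ℕ) : ℕ∞) = q - 1 - m := by
        rw [tsub_tsub, add_comm]; norm_cast
      rwa [this]
    · rw [hfg x hx, hgg' x hx, smul_smul, pow_succ']

theorem exists_contDiffOn_pow_smul_of_one_variable {r : ℝ} (hr : 0 < r) (m : ℕ) {q : ℕ∞} {f : 𝕜 → F}
    (hq : (m : ℕ∞) ≤ q) (hf : ContDiffOn 𝕜 q f (Metric.ball 0 r))
    (hO : f =O[𝓝 0] (fun ε : 𝕜 => ‖ε‖ ^ m)) :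
    ∃ g : 𝕜 → F, ContDiffOn 𝕜 (q - m : ℕ∞) g (Metric.ball 0 r) ∧
      ∀ ε ∈ Metric.ball (0 : 𝕜) r, f ε = ε ^ m • g ε := by
  obtain ⟨g, hg, hfg⟩ := exists_contDiffOn_pow_smul (Y := 𝕜) hr m (f := fun x => f x.1) hq
    (hf.comp (f := fun x : 𝕜 × 𝕜 => x.1) contDiff_fst.contDiffOn (fun x hx => hx.1)) (fun _ => hO)
  refine ⟨fun ε => g (ε, 0), ?_, fun ε hε => hfg (ε, 0) ⟨hε, trivial⟩⟩
  exact hg.comp (f := fun ε : 𝕜 => (ε, (0 : 𝕜))) (by fun_prop) (fun ε hε => ⟨hε, trivial⟩)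

/-- A function of class `C^m` is `O(|ε|^m)`, or it has an exact order smaller than `m`. -/
theorem isBigO_pow_or_exists_le {r : ℝ} (hr : 0 < r) {q : ℕ∞} {f : 𝕜 → F}
    (hf : ContDiffOn 𝕜 q f (Metric.ball 0 r)) (m : ℕ) (hq : (m : ℕ∞) ≤ q) :
    f =O[𝓝 0] (fun ε : 𝕜 => ‖ε‖ ^ m) ∨
      ∃ j < m, ∃ b > 0, ∀ᶠ ε in 𝓝 (0 : 𝕜), b * ‖ε‖ ^ j ≤ ‖f ε‖ := by
  induction m with
  | zero =>
    left
    have : ContinuousAt f 0 := hf.continuousOn.continuousAt (Metric.ball_mem_nhds 0 hr)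
    simpa using this.tendsto.isBigO_one ℝ
  | succ m ih =>
    rcases ih (le_trans (by exact_mod_cast Nat.le_succ m) hq) with h | ⟨j, hj, b, hb, h⟩
    · obtain ⟨g, hg, hfg⟩ := exists_contDiffOn_pow_smul_of_one_variable hr m
        (le_trans (by exact_mod_cast Nat.le_succ m) hq) hf h
      have hev : ∀ᶠ ε in 𝓝 (0 : 𝕜), f ε = ε ^ m • g ε := by
        filter_upwards [Metric.ball_mem_nhds (0 : 𝕜) hr] with ε hε using hfg ε hε
      have hgd : DifferentiableAt 𝕜 g 0 := by
        refine (hg.contDiffAt (Metric.ball_mem_nhds 0 hr)).differentiableAt ?_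
        have : 1 ≤ q - m := by
          apply ENat.le_sub_of_add_le_right (by simp)
          rw [add_comm]; exact_mod_cast hq
        exact_mod_cast (zero_lt_one.trans_le this).ne'
      -- Here f = ε^m g. If g vanishes at 0, differentiability gives one more order; otherwise the
      -- order of f is exactly m.
      by_cases h0 : g 0 = 0
      · left
        have h1 : g =O[𝓝 0] (fun ε : 𝕜 => ‖ε‖) := by
          have := hgd.hasFDerivAt.isBigO_sub
          simp only [h0, sub_zero] at this
          exact this.norm_right
        have h2 : (fun ε : 𝕜 => ε ^ m) =O[𝓝 0] (fun ε : 𝕜 => ‖ε‖ ^ m) :=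
          IsBigO.of_bound 1 (Eventually.of_forall fun ε => by simp)
        refine (h2.smul h1).congr' ?_ ?_
        · filter_upwards [hev] with ε hε using hε.symm
        · exact Eventually.of_forall fun ε => by simp [pow_succ]
      · right
        refine ⟨m, Nat.lt_succ_self m, ‖g 0‖ / 2, by positivity, ?_⟩
        have h1 : ∀ᶠ ε in 𝓝 (0 : 𝕜), ‖g 0‖ / 2 < ‖g ε‖ :=
          hgd.continuousAt.norm.eventually_const_lt (by have := norm_pos_iff.2 h0; simp only; linarith)
        filter_upwards [hev, h1] with ε hε h
        rw [hε, norm_smul, norm_pow, mul_comm]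
        gcongr
    · exact Or.inr ⟨j, by omega, b, hb, h⟩

end Division

end KTransversal

namespace KTransversal

/-! ### Expansion of G along displacements of size ε^{k+1}. -/

section Expansion

variable {𝕜 B B' Y : Type*} [RCLike 𝕜] [NormedAddCommGroup B] [NormedSpace 𝕜 B]
  [NormedAddCommGroup B'] [NormedSpace 𝕜 B'] [NormedAddCommGroup Y] [NormedSpace 𝕜 Y]

/-- The displacement a ε y is O(ε^{k+1}), so by the local Lipschitz property of G' it changes G' by
O(ε^{k+1}). Composition with a ε contributes the same power again, and the total order 2k+2 exceeds
that of the leading term. -/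
theorem fderiv_comp_sub_bound {k : ℕ} {G : B → B'} (hG : ContDiff 𝕜 2 G) {z₀ : 𝕜 → B}
    (hz₀ : ContinuousAt z₀ 0) (hz₀0 : z₀ 0 = 0) {a : 𝕜 → Y →L[𝕜] B} {Λ : Y →L[𝕜] B'} {Ca : ℝ}
    (haO : ∀ᶠ ε in 𝓝 (0 : 𝕜), ‖a ε‖ ≤ Ca * ‖ε‖ ^ (k + 1))
    (hΛ : ∀ᶠ ε in 𝓝 (0 : 𝕜),
      ‖fderiv 𝕜 G (z₀ ε) ∘L a ε - ε ^ (2 * k + 1) • Λ‖ ≤ Ca * ‖ε‖ ^ (2 * k + 2))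
    {ρ : ℝ} (hρ : 0 ≤ ρ) :
    ∃ C > 0, ∀ᶠ ε in 𝓝 (0 : 𝕜), ∀ y, ‖y‖ ≤ ρ →
      ‖fderiv 𝕜 G (z₀ ε + a ε y) ∘L a ε - ε ^ (2 * k + 1) • Λ‖ ≤ C * ‖ε‖ ^ (2 * k + 2) := by
  have hG' : ContDiffAt 𝕜 1 (fderiv 𝕜 G) 0 := (hG.fderiv_right (m := 1) (by norm_num)).contDiffAt
  obtain ⟨K, s, hs, hK⟩ := hG'.exists_lipschitzOnWith
  obtain ⟨R, hR, hRs⟩ := Metric.mem_nhds_iff.1 hs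
  have hz : ∀ᶠ ε in 𝓝 (0 : 𝕜), ‖z₀ ε‖ < R / 2 := by
    have := hz₀.norm
    rw [ContinuousAt, hz₀0, norm_zero] at this
    exact this.eventually_lt_const (half_pos hR)
  have hsmall : ∀ᶠ ε in 𝓝 (0 : 𝕜), |Ca| * ‖ε‖ ^ (k + 1) * ρ < R / 2 := by
    have : Continuous fun ε : 𝕜 => |Ca| * ‖ε‖ ^ (k + 1) * ρ := by fun_prop
    have h := this.tendsto 0
    simp only [norm_zero, ne_eq, Nat.add_eq_zero_iff, one_ne_zero, and_false, not_false_eq_true,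
      zero_pow, mul_zero, zero_mul] at h
    exact h.eventually_lt_const (half_pos hR)
  refine ⟨|Ca| + K * |Ca| ^ 2 * ρ + 1, by positivity, ?_⟩
  filter_upwards [haO, hΛ, hz, hsmall] with ε h1 h2 h3 h4 y hy
  have ha : ‖a ε‖ ≤ |Ca| * ‖ε‖ ^ (k + 1) := h1.trans (by gcongr; exact le_abs_self Ca)
  have hay : ‖a ε y‖ ≤ |Ca| * ‖ε‖ ^ (k + 1) * ρ :=
    ((a ε).le_opNorm y).trans (mul_le_mul ha hy (norm_nonneg _) (by positivity))
  have hm0 : z₀ ε ∈ s := hRs (by simp only [mem_ball_zero_iff]; linarith)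
  have hm1 : z₀ ε + a ε y ∈ s := hRs (by
    simp only [mem_ball_zero_iff]
    exact (norm_add_le _ _).trans_lt (by linarith))
  have hl : ‖fderiv 𝕜 G (z₀ ε + a ε y) - fderiv 𝕜 G (z₀ ε)‖ ≤ K * (|Ca| * ‖ε‖ ^ (k + 1) * ρ) := by
    have := hK.norm_sub_le hm1 hm0
    rw [add_sub_cancel_left] at this
    exact this.trans (by gcongr)
  have hsplit : fderiv 𝕜 G (z₀ ε + a ε y) ∘L a ε - ε ^ (2 * k + 1) • Λ =
      (fderiv 𝕜 G (z₀ ε + a ε y) - fderiv 𝕜 G (z₀ ε)) ∘L a ε +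
      (fderiv 𝕜 G (z₀ ε) ∘L a ε - ε ^ (2 * k + 1) • Λ) := by
    rw [ContinuousLinearMap.sub_comp]; abel
  rw [hsplit]
  refine (norm_add_le _ _).trans ?_
  have h5 : ‖(fderiv 𝕜 G (z₀ ε + a ε y) - fderiv 𝕜 G (z₀ ε)) ∘L a ε‖ ≤
      K * (|Ca| * ‖ε‖ ^ (k + 1) * ρ) * (|Ca| * ‖ε‖ ^ (k + 1)) :=
    (ContinuousLinearMap.opNorm_comp_le _ _).trans
      (mul_le_mul hl ha (norm_nonneg _) (by positivity))
  have h6 : ‖fderiv 𝕜 G (z₀ ε) ∘L a ε - ε ^ (2 * k + 1) • Λ‖ ≤ |Ca| * ‖ε‖ ^ (2 * k + 2) :=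
    h2.trans (by gcongr; exact le_abs_self Ca)
  have h7 : K * (|Ca| * ‖ε‖ ^ (k + 1) * ρ) * (|Ca| * ‖ε‖ ^ (k + 1)) =
      K * |Ca| ^ 2 * ρ * ‖ε‖ ^ (2 * k + 2) := by ring
  have h8 : 0 ≤ ‖ε‖ ^ (2 * k + 2) := by positivity
  rw [h7] at h5
  nlinarith

theorem norm_map_sub_map_sub_le {k : ℕ} {G : B → B'} (hG : Differentiable 𝕜 G) {z : B}
    {ε : 𝕜} {a : Y →L[𝕜] B} {Λ : Y →L[𝕜] B'} {C ρ : ℝ}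
    (h : ∀ y, ‖y‖ ≤ ρ → ‖fderiv 𝕜 G (z + a y) ∘L a - ε ^ (2 * k + 1) • Λ‖ ≤ C * ‖ε‖ ^ (2 * k + 2))
    {y y' : Y} (hy : ‖y‖ ≤ ρ) (hy' : ‖y'‖ ≤ ρ) :
    ‖G (z + a y) - G (z + a y') - ε ^ (2 * k + 1) • Λ (y - y')‖ ≤
      C * ‖ε‖ ^ (2 * k + 2) * ‖y - y'‖ := by
  let _ : NormedSpace ℝ Y := NormedSpace.restrictScalars ℝ 𝕜 Y
  have hconv : Convex ℝ (Metric.closedBall (0 : Y) ρ) := convex_closedBall 0 ρ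
  have hd : ∀ x ∈ Metric.closedBall (0 : Y) ρ, HasFDerivWithinAt
      (fun x => G (z + a x) - ε ^ (2 * k + 1) • Λ x)
      (fderiv 𝕜 G (z + a x) ∘L a - ε ^ (2 * k + 1) • Λ) (Metric.closedBall (0 : Y) ρ) x := by
    intro x _
    apply HasFDerivAt.hasFDerivWithinAt
    have h1 : HasFDerivAt (fun x => z + a x) a x := a.hasFDerivAt.const_add z
    exact ((hG (z + a x)).hasFDerivAt.comp x h1).sub (Λ.hasFDerivAt.const_smul _)
  have := hconv.norm_image_sub_le_of_norm_hasFDerivWithin_le hd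
    (fun x hx => h x (by simpa using hx)) (x := y') (y := y) (by simpa using hy') (by simpa using hy)
  convert this using 2
  rw [map_sub, smul_sub]
  abel

/-- The mean value inequality turns the derivative bound into a Lipschitz bound for G(z₀ + a y) -
ε^{2k+1} Λ y. It shows that the difference G(z₀ + a y) - G(z₀) vanishes to order 2k+1, so it may be
divided; after division H(ε, ·) - Λ has Lipschitz constant O(ε) on bounded sets. -/
theorem exists_expansion [CompleteSpace B'] {k : ℕ} {q : ℕ∞} (hq : ((2 * k + 2 : ℕ) : ℕ∞) ≤ q)
    {G : B → B'} (hG : ContDiff 𝕜 q G) {z₀ : 𝕜 → B} {r : ℝ} (hr : 0 < r)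
    (hz₀ : ContDiffOn 𝕜 q z₀ (Metric.ball 0 r)) (hz₀0 : z₀ 0 = 0)
    {a : 𝕜 → Y →L[𝕜] B} (ha : ContDiff 𝕜 q a) {Λ : Y →L[𝕜] B'} {Ca : ℝ}
    (haO : ∀ᶠ ε in 𝓝 (0 : 𝕜), ‖a ε‖ ≤ Ca * ‖ε‖ ^ (k + 1))
    (hΛ : ∀ᶠ ε in 𝓝 (0 : 𝕜),
      ‖fderiv 𝕜 G (z₀ ε) ∘L a ε - ε ^ (2 * k + 1) • Λ‖ ≤ Ca * ‖ε‖ ^ (2 * k + 2)) :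
    ∃ H : 𝕜 × Y → B',
      ContDiffOn 𝕜 (q - (2 * k + 1 : ℕ) : ℕ∞) H (Metric.ball 0 r ×ˢ Set.univ) ∧
      (∀ ε y, ‖ε‖ < r → G (z₀ ε + a ε y) = G (z₀ ε) + ε ^ (2 * k + 1) • H (ε, y)) ∧
      (∀ᶠ ε in 𝓝 (0 : 𝕜), H (ε, 0) = 0) ∧
      (∀ y, H (0, y) = Λ y) ∧
      ∀ ρ, 0 ≤ ρ → ∃ C > 0, ∀ᶠ ε in 𝓝 (0 : 𝕜), ∀ y y', ‖y‖ ≤ ρ → ‖y'‖ ≤ ρ →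
        ‖H (ε, y) - H (ε, y') - Λ (y - y')‖ ≤ C * ‖ε‖ * ‖y - y'‖ := by
  have hG2 : ContDiff 𝕜 2 G := hG.of_le (by
    have : ((2 : ℕ) : ℕ∞) ≤ q := le_trans (by exact_mod_cast (by omega)) hq
    exact WithTop.coe_le_coe.2 this)
  have hGd : Differentiable 𝕜 G := hG2.differentiable (by norm_num)
  have hzc : ContinuousAt z₀ 0 := hz₀.continuousOn.continuousAt (Metric.ball_mem_nhds 0 hr)
  have hball := Metric.ball_mem_nhds (0 : 𝕜) hr
  set f : 𝕜 × Y → B' := fun x => G (z₀ x.1 + a x.1 x.2) - G (z₀ x.1) with hf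
  have hfq : ContDiffOn 𝕜 q f (Metric.ball 0 r ×ˢ Set.univ) := by
    have hz : ContDiffOn 𝕜 q (fun x : 𝕜 × Y => z₀ x.1) (Metric.ball 0 r ×ˢ Set.univ) :=
      hz₀.comp contDiff_fst.contDiffOn (fun x hx => hx.1)
    have ha' : ContDiff 𝕜 q (fun x : 𝕜 × Y => a x.1 x.2) :=
      (ha.comp contDiff_fst).clm_apply contDiff_snd
    exact (hG.comp_contDiffOn (hz.add ha'.contDiffOn)).sub (hG.comp_contDiffOn hz)
  have hLip : ∀ ρ, 0 ≤ ρ → ∃ C > 0, ∀ᶠ ε in 𝓝 (0 : 𝕜), ∀ y y', ‖y‖ ≤ ρ → ‖y'‖ ≤ ρ →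
      ‖f (ε, y) - f (ε, y') - ε ^ (2 * k + 1) • Λ (y - y')‖ ≤
        C * ‖ε‖ ^ (2 * k + 2) * ‖y - y'‖ := by
    intro ρ hρ
    obtain ⟨C, hC, h⟩ := fderiv_comp_sub_bound hG2 hzc hz₀0 haO hΛ hρ
    refine ⟨C, hC, ?_⟩
    filter_upwards [h] with ε hε y y' hy hy'
    have := norm_map_sub_map_sub_le hGd hε hy hy'
    convert this using 3
    simp [hf]
  have hf0 : ∀ ε, f (ε, 0) = 0 := fun ε => by simp [hf]
  have hO : ∀ y, (fun ε : 𝕜 => f (ε, y)) =O[𝓝 0] (fun ε : 𝕜 => ‖ε‖ ^ (2 * k + 1)) := by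
    intro y
    obtain ⟨C, hC, h⟩ := hLip ‖y‖ (norm_nonneg y)
    refine IsBigO.of_bound (C * ‖y‖ + ‖Λ y‖) ?_
    filter_upwards [h, Metric.ball_mem_nhds (0 : 𝕜) one_pos] with ε hε h1
    have h1' : ‖ε‖ ≤ 1 := by simpa using (mem_ball_zero_iff.1 h1).le
    have := hε y 0 le_rfl (by simp)
    rw [hf0, sub_zero, sub_zero] at this
    have h2 : ‖f (ε, y)‖ ≤ C * ‖ε‖ ^ (2 * k + 2) * ‖y‖ + ‖ε‖ ^ (2 * k + 1) * ‖Λ y‖ := by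
      calc ‖f (ε, y)‖ = ‖(f (ε, y) - ε ^ (2 * k + 1) • Λ y) + ε ^ (2 * k + 1) • Λ y‖ := by
            rw [sub_add_cancel]
        _ ≤ _ := (norm_add_le _ _).trans (by rw [norm_smul, norm_pow]; gcongr)
    have h3 : ‖ε‖ ^ (2 * k + 2) ≤ ‖ε‖ ^ (2 * k + 1) :=
      pow_le_pow_of_le_one (norm_nonneg _) h1' (by omega)
    rw [norm_pow, norm_norm]
    have h4 : C * ‖ε‖ ^ (2 * k + 2) * ‖y‖ ≤ C * ‖ε‖ ^ (2 * k + 1) * ‖y‖ := by gcongr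
    linarith
  obtain ⟨H, hH, hfH⟩ := exists_contDiffOn_pow_smul hr (2 * k + 1) (f := f)
    (le_trans (by exact_mod_cast (by omega)) hq) hfq hO
  have hHeq : ∀ ε y, ‖ε‖ < r → f (ε, y) = ε ^ (2 * k + 1) • H (ε, y) := fun ε y hε =>
    hfH (ε, y) ⟨by simpa using hε, trivial⟩
  have hcont : ∀ y, ContinuousAt (fun ε : 𝕜 => H (ε, y)) 0 := by
    intro y
    have hΩ : IsOpen (Metric.ball (0 : 𝕜) r ×ˢ (Set.univ : Set Y)) :=
      Metric.isOpen_ball.prod isOpen_univ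
    have hc : ContinuousAt H (0, y) :=
      hH.continuousOn.continuousAt (hΩ.mem_nhds ⟨Metric.mem_ball_self hr, trivial⟩)
    exact hc.comp (f := fun ε : 𝕜 => (ε, y)) (by fun_prop)
  have hne : ∀ ρ, 0 ≤ ρ → ∃ C > 0, ∀ᶠ ε in 𝓝 (0 : 𝕜), ε ≠ 0 → ∀ y y', ‖y‖ ≤ ρ → ‖y'‖ ≤ ρ →
        ‖H (ε, y) - H (ε, y') - Λ (y - y')‖ ≤ C * ‖ε‖ * ‖y - y'‖ := by
    intro ρ hρ
    obtain ⟨C, hC, h⟩ := hLip ρ hρ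
    refine ⟨C, hC, ?_⟩
    filter_upwards [h, hball] with ε hε hr' hne y y' hy hy'
    have h1 := hε y y' hy hy'
    have hr'' : ‖ε‖ < r := by simpa using hr'
    rw [hHeq ε y hr'', hHeq ε y' hr'', ← smul_sub, ← smul_sub, norm_smul, norm_pow] at h1
    have hp : 0 < ‖ε‖ ^ (2 * k + 1) := pow_pos (norm_pos_iff.2 hne) _
    have h2 : C * ‖ε‖ ^ (2 * k + 2) * ‖y - y'‖ =
      ‖ε‖ ^ (2 * k + 1) * (C * ‖ε‖ * ‖y - y'‖) := by ring
    rw [h2] at h1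
    exact le_of_mul_le_mul_left h1 hp
  have hHne : ∀ ε, ‖ε‖ < r → ε ≠ 0 → H (ε, 0) = 0 := by
    intro ε hε hne
    have := hHeq ε 0 hε
    rw [hf0] at this
    exact (smul_eq_zero.1 this.symm).resolve_left (pow_ne_zero _ hne)
  -- The division determines H only for ε ≠ 0; the value at ε = 0 is identified through continuity.
  have hH0 : ∀ y, H (0, y) = Λ y := by
    intro y
    obtain ⟨C, hC, h⟩ := hne ‖y‖ (norm_nonneg y)
    have h1 : Tendsto (fun ε : 𝕜 => H (ε, y)) (𝓝[≠] 0) (𝓝 (H (0, y))) :=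
      (hcont y).tendsto.mono_left nhdsWithin_le_nhds
    have h2 : Tendsto (fun ε : 𝕜 => H (ε, y)) (𝓝[≠] 0) (𝓝 (Λ y)) := by
      rw [tendsto_iff_norm_sub_tendsto_zero]
      have h3 : Tendsto (fun ε : 𝕜 => C * ‖ε‖ * ‖y‖) (𝓝[≠] 0) (𝓝 0) := by
        have : Continuous fun ε : 𝕜 => C * ‖ε‖ * ‖y‖ := by fun_prop
        have := (this.tendsto 0).mono_left (nhdsWithin_le_nhds (s := {0}ᶜ))
        simpa using this
      refine tendsto_of_tendsto_of_tendsto_of_le_of_le' tendsto_const_nhds h3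
        (Eventually.of_forall fun _ => norm_nonneg _) ?_
      filter_upwards [h.filter_mono nhdsWithin_le_nhds, self_mem_nhdsWithin,
        mem_nhdsWithin_of_mem_nhds hball] with ε hε hne' hr'
      have := hε hne' y 0 le_rfl (by simp)
      rwa [hHne ε (by simpa using hr') hne', sub_zero, sub_zero] at this
    exact tendsto_nhds_unique h1 h2
  refine ⟨H, hH, ?_, ?_, hH0, ?_⟩
  · intro ε y hε
    rw [← hHeq ε y hε]
    simp [hf]
  · filter_upwards [hball] with ε hε
    by_cases h : ε = 0
    · rw [h, hH0, map_zero]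
    · exact hHne ε (by simpa using hε) h
  · intro ρ hρ
    obtain ⟨C, hC, h⟩ := hne ρ hρ
    refine ⟨C, hC, ?_⟩
    filter_upwards [h] with ε hε y y' hy hy'
    by_cases h0 : ε = 0
    · rw [h0, hH0, hH0, map_sub, sub_self, norm_zero]
      simp
    · exact hε h0 y y' hy hy'

end Expansion

end KTransversal

/-! ### Solving and inverting maps that are Lipschitz-close to a linear isomorphism. -/

namespace KTransversal

/-- Turns a Lipschitz bound for f - M on a ball into closeness of derivatives inside it, which is
what invertibility of the derivative requires. -/
theorem norm_fderiv_sub_le_of_lip {𝕜 X B' : Type*} [RCLike 𝕜] [NormedAddCommGroup X]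
    [NormedSpace 𝕜 X] [NormedAddCommGroup B'] [NormedSpace 𝕜 B'] {f : X → B'} {D M : X →L[𝕜] B'} {x : X} {R c : ℝ} (hc : 0 ≤ c)
    (hf : HasFDerivAt f D x) (hx : ‖x‖ < R)
    (h : ∀ y y', ‖y‖ ≤ R → ‖y'‖ ≤ R → ‖f y - f y' - M (y - y')‖ ≤ c * ‖y - y'‖) :
    ‖D - M‖ ≤ c := by
  refine (hf.sub M.hasFDerivAt).le_of_lip' hc ?_
  filter_upwards [Metric.isOpen_ball.mem_nhds (mem_ball_zero_iff.2 hx)] with y hy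
  have := h y x (by simpa using (mem_ball_zero_iff.1 hy).le) hx.le
  convert this using 2
  simp only [Pi.sub_apply, map_sub]
  abel

section Inverse

variable {𝕜 X B' : Type*} [RCLike 𝕜] [NormedAddCommGroup X] [NormedSpace 𝕜 X] [CompleteSpace X]
  [NormedAddCommGroup B'] [NormedSpace 𝕜 B']

/-- Neumann series: D = L (1 - t) with t = L⁻¹ (L - D) and ‖t‖ ≤ 1/2. The factor 2 comes from x =
L⁻¹ y + t x when D x = y. -/
theorem exists_equiv_of_norm_sub_le (L : X ≃L[𝕜] B') {D : X →L[𝕜] B'} {η : ℝ}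
    (hD : ‖D - L‖ ≤ η) (hη : η * ‖(L.symm : B' →L[𝕜] X)‖ ≤ 1 / 2) :
    ∃ e : X ≃L[𝕜] B', (e : X →L[𝕜] B') = D ∧
      ‖(e.symm : B' →L[𝕜] X)‖ ≤ 2 * ‖(L.symm : B' →L[𝕜] X)‖ := by
  set t : X →L[𝕜] X := (L.symm : B' →L[𝕜] X) ∘L ((L : X →L[𝕜] B') - D) with ht
  have htn : ‖t‖ ≤ 1 / 2 := by
    refine (ContinuousLinearMap.opNorm_comp_le _ _).trans ?_
    rw [norm_sub_rev, mul_comm]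
    exact (mul_le_mul_of_nonneg_right hD (norm_nonneg _)).trans hη
  set u := Units.oneSub t (htn.trans_lt (by norm_num)) with hu
  set e := (ContinuousLinearEquiv.unitsEquiv 𝕜 X u).trans L with he
  have heD : ∀ x, e x = D x := by
    intro x
    have : e x = L ((1 - t : X →L[𝕜] X) x) := rfl
    rw [this]
    simp [ht]
  refine ⟨e, by ext x; exact heD x, ?_⟩
  refine ContinuousLinearMap.opNorm_le_bound _ (by positivity) fun y => ?_
  set x := e.symm y with hx
  have hy : D x = y := by rw [← heD]; simp [hx]
  have h1 : x = L.symm y + t x := by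
    simp [ht, hy]
  have h2 : ‖x‖ ≤ ‖(L.symm : B' →L[𝕜] X)‖ * ‖y‖ + 1 / 2 * ‖x‖ := by
    calc ‖x‖ = ‖L.symm y + t x‖ := by rw [← h1]
      _ ≤ ‖L.symm y‖ + ‖t x‖ := norm_add_le _ _
      _ ≤ _ := add_le_add ((L.symm : B' →L[𝕜] X).le_opNorm y)
        ((t.le_opNorm x).trans (by gcongr))
  change ‖x‖ ≤ _
  linarith

/-- Solutions of `Φ(w, x) = 0` for a family of maps that are close to a fixed linear
isomorphism. -/
theorem exists_contDiffOn_solution [CompleteSpace B'] {V : Type*} [NormedAddCommGroup V]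
    [NormedSpace 𝕜 V] [CompleteSpace V] {m : ℕ∞} (hm : 1 ≤ m) {Φ : V × X → B'} {s : Set V}
    (hs : IsOpen s) (hΦ : ContDiffOn 𝕜 m Φ (s ×ˢ Set.univ)) (L : X ≃L[𝕜] B') {R η : ℝ} (hR : 0 < R)
    (hη0 : 0 ≤ η) (hη : η * ‖(L.symm : B' →L[𝕜] X)‖ ≤ 1 / 2)
    (hLip : ∀ w ∈ s, ∀ x x', ‖x‖ ≤ R → ‖x'‖ ≤ R →
      ‖Φ (w, x) - Φ (w, x') - L (x - x')‖ ≤ η * ‖x - x'‖)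
    (h0 : ∀ w ∈ s, ‖(L.symm : B' →L[𝕜] X)‖ * ‖Φ (w, 0)‖ ≤ R / 4) :
    ∃ ν : V → X, ContDiffOn 𝕜 m ν s ∧ ∀ w ∈ s, ‖ν w‖ < R ∧ Φ (w, ν w) = 0 ∧
      ∀ x, ‖x‖ ≤ R → Φ (w, x) = 0 → x = ν w := by
  set Li : B' →L[𝕜] X := (L.symm : B' →L[𝕜] X) with hLi
  -- The Newton map with frozen derivative, x ↦ x - L⁻¹ Φ(w, x), contracts by 1/2.
  have hcontr : ∀ w ∈ s, ∀ x x', ‖x‖ ≤ R → ‖x'‖ ≤ R →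
      ‖(x - Li (Φ (w, x))) - (x' - Li (Φ (w, x')))‖ ≤ 1 / 2 * ‖x - x'‖ := by
    intro w hw x x' hx hx'
    have h1 : (x - Li (Φ (w, x))) - (x' - Li (Φ (w, x'))) =
        - Li (Φ (w, x) - Φ (w, x') - L (x - x')) := by
      simp only [map_sub, hLi, ContinuousLinearEquiv.coe_coe, ContinuousLinearEquiv.symm_apply_apply]
      abel
    rw [h1, norm_neg]
    calc _ ≤ ‖Li‖ * (η * ‖x - x'‖) := (Li.le_opNorm _).trans
          (by gcongr; exact hLip w hw x x' hx hx')
      _ = η * ‖Li‖ * ‖x - x'‖ := by ring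
      _ ≤ _ := by gcongr
  have huniq : ∀ w ∈ s, ∀ x x', ‖x‖ ≤ R → ‖x'‖ ≤ R → Φ (w, x) = 0 → Φ (w, x') = 0 → x = x' := by
    intro w hw x x' hx hx' e e'
    have := hcontr w hw x x' hx hx'
    rw [e, e', map_zero, sub_zero, sub_zero] at this
    have h2 : ‖x - x'‖ = 0 := by linarith [norm_nonneg (x - x')]
    exact sub_eq_zero.1 (norm_eq_zero.1 h2)
  have hex : ∀ w ∈ s, ∃ x, ‖x‖ < R ∧ Φ (w, x) = 0 := by
    intro w hw
    set T : X → X := fun x => x - Li (Φ (w, x)) with hT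
    -- R/2 from the contraction and R/4 from the value at 0. The bound 3R/4 < R puts the fixed point
    -- inside the open ball, which the smoothness argument needs.
    have hbound : ∀ x, ‖x‖ ≤ R → ‖T x‖ ≤ 3 / 4 * R := by
      intro x hx
      have h1 := hcontr w hw x 0 hx (by simpa using hR.le)
      have h2 : ‖T 0‖ ≤ R / 4 := by
        simp only [hT, zero_sub, norm_neg]
        exact (Li.le_opNorm _).trans (h0 w hw)
      rw [sub_zero] at h1
      have h3 : T x = (T x - T 0) + T 0 := by abel
      rw [h3]
      refine (norm_add_le _ _).trans ?_
      have h4 : ‖T x - T 0‖ ≤ 1 / 2 * ‖x‖ := h1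
      linarith
    have hmaps : Set.MapsTo T (Metric.closedBall 0 R) (Metric.closedBall 0 R) := by
      intro x hx
      have := hbound x (by simpa using hx)
      simp only [mem_closedBall_zero_iff]
      linarith
    have hcw : ContractingWith (1 / 2) (hmaps.restrict T _ _) := by
      refine ⟨by rw [← NNReal.coe_lt_coe]; norm_num, ?_⟩
      refine LipschitzWith.of_dist_le_mul fun x y => ?_
      have := hcontr w hw x y (mem_closedBall_zero_iff.1 x.2)
        (mem_closedBall_zero_iff.1 y.2)
      simpa [Subtype.dist_eq, dist_eq_norm] using this
    obtain ⟨x, hx, hfix, -⟩ := hcw.exists_fixedPoint' (Metric.isClosed_closedBall.isComplete)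
      hmaps (x := 0) (by simpa using hR.le) (edist_ne_top _ _)
    have hfix' : T x = x := hfix
    refine ⟨x, ?_, ?_⟩
    · have := hbound x (by simpa using hx)
      rw [hfix'] at this
      linarith
    · have h5 : Li (Φ (w, x)) = 0 := by simpa [hT] using hfix'
      simpa [hLi] using h5
  choose! ν hνR hν0 using hex
  refine ⟨ν, ?_, fun w hw => ⟨hνR w hw, hν0 w hw, fun x hx hx0 =>
    huniq w hw x (ν w) hx (hνR w hw).le hx0 (hν0 w hw)⟩⟩
  intro w hw
  apply ContDiffAt.contDiffWithinAt
  have hopen : IsOpen (s ×ˢ (Set.univ : Set X)) := hs.prod isOpen_univ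
  have hcd : ContDiffAt 𝕜 m Φ (w, ν w) := hΦ.contDiffAt (hopen.mem_nhds ⟨hw, trivial⟩)
  have hm0 : (m : WithTop ℕ∞) ≠ 0 := by exact_mod_cast (zero_lt_one.trans_le hm).ne'
  have hdiff : HasFDerivAt (fun x => Φ (w, x))
      (fderiv 𝕜 Φ (w, ν w) ∘L ContinuousLinearMap.inr 𝕜 V X) (ν w) :=
    (hcd.differentiableAt hm0).hasFDerivAt.comp (ν w) (hasFDerivAt_prodMk_right w (ν w))
  have hclose := norm_fderiv_sub_le_of_lip (M := (L : X →L[𝕜] B')) hη0 hdiff (hνR w hw) (hLip w hw)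
  obtain ⟨e, he, -⟩ := exists_equiv_of_norm_sub_le L hclose hη
  have hinv : (fderiv 𝕜 Φ (w, ν w) ∘L ContinuousLinearMap.inr 𝕜 V X).IsInvertible := ⟨e, he⟩
  have hψ := hcd.contDiffAt_implicitFunction hm0 hinv
  have hself := hcd.implicitFunction_apply_self hm0 hinv
  have hsol := hcd.eventually_apply_implicitFunction hm0 hinv
  -- ν comes from a choice at each point; near w it coincides with the smooth implicit function by
  -- uniqueness in the ball.
  refine hψ.congr_of_eventuallyEq ?_
  have hnorm : ∀ᶠ w' in 𝓝 w, ‖hcd.implicitFunction hm0 hinv w'‖ < R := by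
    apply hψ.continuousAt.norm.eventually_lt_const
    simp only at hself ⊢
    rw [hself]
    exact hνR w hw
  filter_upwards [hsol, hnorm, hs.mem_nhds hw] with w' h1 h2 h3
  refine huniq w' h3 _ _ (hνR w' h3).le h2.le (hν0 w' h3) ?_
  rw [h1, hν0 w hw]

/-- A map that is close to `s • L` on a ball is inverted on the image of an open subset. -/
theorem exists_contDiffOn_rectification {q : ℕ∞} (hq : 1 ≤ q) {f : X → B'} (hf : ContDiff 𝕜 q f)
    (L : X ≃L[𝕜] B') {s : 𝕜} (hs : s ≠ 0) {R η : ℝ} (hη0 : 0 ≤ η)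
    (hη : η * ‖(L.symm : B' →L[𝕜] X)‖ ≤ 1 / 2)
    (hLip : ∀ x x', ‖x‖ ≤ R → ‖x'‖ ≤ R → ‖f x - f x' - s • L (x - x')‖ ≤ ‖s‖ * η * ‖x - x'‖)
    {U : Set X} (hU : IsOpen U) (hUR : ∀ x ∈ U, ‖x‖ < R) :
    IsOpen (f '' U) ∧ ∃ J : B' → B', ContDiffOn 𝕜 q J (f '' U) ∧
      (∀ x ∈ U, J (f x) = s • L x) ∧
      ∀ b ∈ f '' U, ‖fderiv 𝕜 J b - ContinuousLinearMap.id 𝕜 B'‖ ≤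
        2 * η * ‖(L.symm : B' →L[𝕜] X)‖ := by
  have hs' : 0 < ‖s‖ := norm_pos_iff.2 hs
  have hq0 : (q : WithTop ℕ∞) ≠ 0 := by exact_mod_cast (zero_lt_one.trans_le hq).ne'
  -- Absorbing the scalar in the isomorphism: since ‖s‖ ‖(sL)⁻¹‖ ≤ ‖L⁻¹‖, all later bounds are
  -- independent of s. In the application s = ε^{2k+1} tends to 0.
  set sL : X ≃L[𝕜] B' := (ContinuousLinearEquiv.smulLeft (Units.mk0 s hs) : X ≃L[𝕜] X).trans L with hsL
  have hsLx : ∀ x, sL x = s • L x := fun x => by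
    have : sL x = L (s • x) := rfl
    rw [this, map_smul]
  have hsymm : ‖s‖ * ‖(sL.symm : B' →L[𝕜] X)‖ ≤ ‖(L.symm : B' →L[𝕜] X)‖ := by
    have h1 : s • (sL.symm : B' →L[𝕜] X) = (L.symm : B' →L[𝕜] X) := by
      ext y
      apply L.injective
      have := hsLx (sL.symm y)
      simp only [ContinuousLinearEquiv.apply_symm_apply] at this
      simp [← this]
    rw [← norm_smul, h1]
  have hsη : ‖s‖ * η * ‖(sL.symm : B' →L[𝕜] X)‖ ≤ 1 / 2 := by
    calc _ = η * (‖s‖ * ‖(sL.symm : B' →L[𝕜] X)‖) := by ring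
      _ ≤ η * ‖(L.symm : B' →L[𝕜] X)‖ := by gcongr
      _ ≤ _ := hη
  have hLip' : ∀ x x', ‖x‖ ≤ R → ‖x'‖ ≤ R →
      ‖f x - f x' - (sL : X →L[𝕜] B') (x - x')‖ ≤ ‖s‖ * η * ‖x - x'‖ := by
    intro x x' hx hx'
    have := hLip x x' hx hx'
    rwa [← hsLx] at this
  have hder : ∀ x ∈ U, ∃ e : X ≃L[𝕜] B', HasFDerivAt f (e : X →L[𝕜] B') x ∧
      ‖(e : X →L[𝕜] B') - sL‖ ≤ ‖s‖ * η ∧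
      ‖(e.symm : B' →L[𝕜] X)‖ ≤ 2 * ‖(sL.symm : B' →L[𝕜] X)‖ := by
    intro x hx
    have hd : HasFDerivAt f (fderiv 𝕜 f x) x := (hf.differentiable hq0 x).hasFDerivAt
    have hcl := norm_fderiv_sub_le_of_lip (by positivity) hd (hUR x hx) hLip'
    obtain ⟨e, he, hen⟩ := exists_equiv_of_norm_sub_le sL hcl hsη
    rw [← he] at hd hcl
    exact ⟨e, hd, hcl, hen⟩
  have hinj : Set.InjOn f U := by
    intro x hx x' hx' hxx'
    have h1 := hLip' x x' (hUR x hx).le (hUR x' hx').le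
    rw [hxx', sub_self, zero_sub, norm_neg] at h1
    have h2 : ‖x - x'‖ ≤ ‖(sL.symm : B' →L[𝕜] X)‖ * ‖(sL : X →L[𝕜] B') (x - x')‖ := by
      have := (sL.symm : B' →L[𝕜] X).le_opNorm (sL (x - x'))
      simpa using this
    have h3 : ‖(sL.symm : B' →L[𝕜] X)‖ * ‖(sL : X →L[𝕜] B') (x - x')‖ ≤ 1 / 2 * ‖x - x'‖ := by
      calc _ ≤ ‖(sL.symm : B' →L[𝕜] X)‖ * (‖s‖ * η * ‖x - x'‖) := by gcongr
        _ = (‖s‖ * η * ‖(sL.symm : B' →L[𝕜] X)‖) * ‖x - x'‖ := by ring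
        _ ≤ _ := by gcongr
    have h4 : ‖x - x'‖ = 0 := by linarith [norm_nonneg (x - x')]
    exact sub_eq_zero.1 (norm_eq_zero.1 h4)
  have hopen : IsOpen (f '' U) := by
    rw [isOpen_iff_mem_nhds]
    rintro _ ⟨x, hx, rfl⟩
    obtain ⟨e, he, -⟩ := hder x hx
    have hst := (hf.contDiffAt (x := x)).hasStrictFDerivAt' he hq0
    rw [← hst.map_nhds_eq_of_equiv]
    exact image_mem_map (hU.mem_nhds hx)
  -- J is s L composed with the inverse of f on U; off f(U) its values are irrelevant.
  set J : B' → B' := fun b => s • L (Function.invFunOn f U b) with hJ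
  have hJf : ∀ x ∈ U, J (f x) = s • L x := by
    intro x hx
    simp only [hJ]
    rw [hinj.leftInvOn_invFunOn hx]
  have hJc : ContDiffOn 𝕜 q J (f '' U) := by
    rintro _ ⟨x, hx, rfl⟩
    apply ContDiffAt.contDiffWithinAt
    obtain ⟨e, he, -⟩ := hder x hx
    have hcd := hf.contDiffAt (x := x)
    have hg := hcd.to_localInverse he hq0
    have hst := hcd.hasStrictFDerivAt' he hq0
    have hright : ∀ᶠ y in 𝓝 (f x), f (hcd.localInverse he hq0 y) = y :=
      hst.eventually_right_inverse
    have hgx : hcd.localInverse he hq0 (f x) = x := hst.localInverse_apply_image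
    have hmem : ∀ᶠ y in 𝓝 (f x), hcd.localInverse he hq0 y ∈ U := by
      apply hg.continuousAt.eventually_mem
      rw [hgx]
      exact hU.mem_nhds hx
    have hsmooth : ContDiffAt 𝕜 q (fun b => s • L (hcd.localInverse he hq0 b)) (f x) :=
      (L.contDiff.contDiffAt.comp (f x) hg).const_smul s
    refine hsmooth.congr_of_eventuallyEq ?_
    filter_upwards [hright, hmem] with y h1 h2
    have := hJf _ h2
    rwa [h1] at this
  refine ⟨hopen, J, hJc, hJf, ?_⟩
  rintro _ ⟨x, hx, rfl⟩
  obtain ⟨e, he, hcl, hen⟩ := hder x hx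
  have hJd : HasFDerivAt J (fderiv 𝕜 J (f x)) (f x) :=
    ((hJc.contDiffAt (hopen.mem_nhds ⟨x, hx, rfl⟩)).differentiableAt hq0).hasFDerivAt
  have hcomp : HasFDerivAt (fun x => J (f x)) (fderiv 𝕜 J (f x) ∘L (e : X →L[𝕜] B')) x :=
    hJd.comp x he
  have hcomp' : HasFDerivAt (fun x => J (f x)) (sL : X →L[𝕜] B') x := by
    refine (sL : X →L[𝕜] B').hasFDerivAt.congr_of_eventuallyEq ?_
    filter_upwards [hU.mem_nhds hx] with y hy
    rw [hJf y hy, ← hsLx]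
    rfl
  have heq := hcomp.unique hcomp'
  -- J' f' = s L gives J' - I = (s L - f') f'⁻¹, a product of ‖s‖ η and 2 ‖(sL)⁻¹‖.
  have : fderiv 𝕜 J (f x) - ContinuousLinearMap.id 𝕜 B' =
      ((sL : X →L[𝕜] B') - (e : X →L[𝕜] B')) ∘L (e.symm : B' →L[𝕜] X) := by
    ext y
    have := congrArg (fun g => g (e.symm y)) heq
    simp only [ContinuousLinearMap.comp_apply, ContinuousLinearEquiv.coe_coe,
      ContinuousLinearEquiv.apply_symm_apply] at this
    simp [this]
  rw [this]
  refine (ContinuousLinearMap.opNorm_comp_le _ _).trans ?_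
  rw [norm_sub_rev]
  calc _ ≤ (‖s‖ * η) * (2 * ‖(sL.symm : B' →L[𝕜] X)‖) := by gcongr
    _ = 2 * η * (‖s‖ * ‖(sL.symm : B' →L[𝕜] X)‖) := by ring
    _ ≤ _ := by gcongr

end Inverse

end KTransversal

namespace KTransversal

noncomputable section

/-! ### The matrices Q, M and M̂ in terms of the coefficients of the chains. -/

section Chains

variable {𝕜 B B' : Type*} [RCLike 𝕜] [NormedAddCommGroup B] [NormedSpace 𝕜 B]
  [NormedAddCommGroup B'] [NormedSpace 𝕜 B']

variable (𝕜) in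
/-- The normalising factor `(j-1)!/(2j-2)!`. -/
def normFactor (j : ℕ) : 𝕜 := ((j - 1).factorial : 𝕜) / ((2 * (j - 1)).factorial : 𝕜)

theorem natCast_factorial_ne_zero (n : ℕ) : (n.factorial : 𝕜) ≠ 0 := by
  exact_mod_cast n.factorial_ne_zero

theorem normFactor_ne_zero (j : ℕ) : normFactor 𝕜 j ≠ 0 :=
  div_ne_zero (natCast_factorial_ne_zero _) (natCast_factorial_ne_zero _)

/-- The scheme splits into m!/(m+1-i)! and a factor independent of m. In `Q` the m! cancels, so the
m-dependence is a quotient of factorials that telescopes in products of successive `Q`. -/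
theorem c_eq {m i : ℕ} (hi : 1 ≤ i) (him : i ≤ m + 1) :
    c 𝕜 m i = (m.factorial : 𝕜) / ((m + 1 - i).factorial : 𝕜) * normFactor 𝕜 i := by
  obtain ⟨p, rfl⟩ : ∃ p, i = p + 1 := ⟨i - 1, by omega⟩
  have hp : p ≤ m := by omega
  simp only [c, normFactor, Nat.add_sub_cancel, Nat.add_sub_add_right]
  rw [Nat.cast_choose 𝕜 hp, Nat.cast_choose 𝕜 (show p ≤ 2 * p by omega)]
  have e : 2 * p - p = p := by omega
  rw [e]
  have h1 := natCast_factorial_ne_zero (𝕜 := 𝕜) p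
  have h2 := natCast_factorial_ne_zero (𝕜 := 𝕜) (m - p)
  have h3 := natCast_factorial_ne_zero (𝕜 := 𝕜) (2 * p)
  field_simp

theorem E_of_lt (Sb : ℕ → B →L[𝕜] B') (T : ℕ → B' →L[𝕜] B) {i j : ℕ} (h : j < i) :
    E Sb T i j = 0 := by
  rw [E]; simp [h]

theorem E_self (Sb : ℕ → B →L[𝕜] B') (T : ℕ → B' →L[𝕜] B) (i : ℕ) :
    E Sb T i i = ContinuousLinearMap.id 𝕜 B := by
  rw [E]; simp

theorem E_of_gt (Sb : ℕ → B →L[𝕜] B') (T : ℕ → B' →L[𝕜] B) {i j : ℕ} (h : i < j) :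
    E Sb T i j = - (T i ∘L ∑ v ∈ Finset.Icc (i + 1) j, Sb v ∘L E Sb T v j) := by
  rw [E, if_neg (by omega), if_neg (by omega)]
  congr 2
  rw [Fin.sum_univ_eq_sum_range (fun v => Sb (i + 1 + v) ∘L E Sb T (i + 1 + v) j) (j - i),
    ← Finset.Ico_add_one_right_eq_Icc, Finset.sum_Ico_eq_sum_range]
  congr 2
  omega

theorem Q_eq (Sb : ℕ → B →L[𝕜] B') (T : ℕ → B' →L[𝕜] B) {m i j : ℕ} (hi : 1 ≤ i)
    (hj1 : 1 ≤ j) (hj : j ≤ m + 1) :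
    Q Sb T m i j = (((m + 1 - i).factorial : 𝕜) / ((m + 1 - j).factorial : 𝕜) *
      (normFactor 𝕜 j / normFactor 𝕜 i)) • E Sb T i j := by
  rcases lt_or_ge j i with h | h
  · simp [Q, E_of_lt Sb T h]
  · rw [Q, c_eq hi (by omega), c_eq hj1 hj]
    congr 1
    have h1 := natCast_factorial_ne_zero (𝕜 := 𝕜) m
    have h2 := natCast_factorial_ne_zero (𝕜 := 𝕜) (m + 1 - i)
    have h3 := natCast_factorial_ne_zero (𝕜 := 𝕜) (m + 1 - j)
    have h4 := normFactor_ne_zero (𝕜 := 𝕜) i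
    field_simp

/-- The coefficients of the operator polynomials `Φ_i(ε) = ∑_{r ≤ i} ε^{i-r} Ψ_{r,i}`, which
satisfy `Φ_{j+1}(ε) = ∑_{v ≤ j} ε^{j-v} Φ_v(ε) a_{v,j} E_{v,j}` with `a_{v,j}` the quotient of the
normalising factors. -/
def chainCoeff (Sb : ℕ → B →L[𝕜] B') (T : ℕ → B' →L[𝕜] B) : ℕ → ℕ → (B →L[𝕜] B)
  | 0, _ => 0
  | 1, i => if i = 1 then ContinuousLinearMap.id 𝕜 B else 0
  | r + 2, i => ∑ v ∈ Finset.Icc 1 (i - 1), (normFactor 𝕜 (i - 1) / normFactor 𝕜 v) •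
      (chainCoeff Sb T (r + 1) v ∘L E Sb T v (i - 1))

variable (Sb : ℕ → B →L[𝕜] B') (T : ℕ → B' →L[𝕜] B)

theorem chainCoeff_succ_one {r : ℕ} (hr : 2 ≤ r) : chainCoeff Sb T r 1 = 0 := by
  obtain ⟨r, rfl⟩ : ∃ s, r = s + 2 := ⟨r - 2, by omega⟩
  simp [chainCoeff]

theorem chainCoeff_one {i : ℕ} (hi : i ≠ 1) : chainCoeff Sb T 1 i = 0 := by
  simp [chainCoeff, hi]

theorem chainCoeff_succ_succ {r j N : ℕ} (hr : 1 ≤ r) (hN : j ≤ N) :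
    chainCoeff Sb T (r + 1) (j + 1) = ∑ v ∈ Finset.Icc 1 N,
      (normFactor 𝕜 j / normFactor 𝕜 v) • (chainCoeff Sb T r v ∘L E Sb T v j) := by
  obtain ⟨r, rfl⟩ : ∃ s, r = s + 1 := ⟨r - 1, by omega⟩
  simp only [chainCoeff, Nat.add_sub_cancel]
  refine Finset.sum_subset (Finset.Icc_subset_Icc_right hN) fun v _ hv => ?_
  have : j < v := by
    simp only [Finset.mem_Icc, not_and, not_le] at *
    omega
  simp [E_of_lt Sb T this]

theorem chainCoeff_of_lt : ∀ {r i : ℕ}, i < r → 1 ≤ i → chainCoeff Sb T r i = 0 := by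
  intro r
  induction r with
  | zero => intro i h; omega
  | succ r ih =>
    intro i h hi
    rcases Nat.eq_zero_or_pos r with rfl | hr
    · omega
    · rcases Nat.eq_or_lt_of_le hi with rfl | hi'
      · exact chainCoeff_succ_one Sb T (by omega)
      · obtain ⟨j, rfl⟩ : ∃ j, i = j + 1 := ⟨i - 1, by omega⟩
        rw [chainCoeff_succ_succ Sb T hr le_rfl]
        refine Finset.sum_eq_zero fun v hv => ?_
        rw [Finset.mem_Icc] at hv
        rw [ih (by omega) hv.1]
        simp

theorem chainCoeff_self : ∀ {i : ℕ}, 1 ≤ i →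
    chainCoeff Sb T i i = ContinuousLinearMap.id 𝕜 B := by
  intro i hi
  induction i, hi using Nat.le_induction with
  | base => simp [chainCoeff]
  | succ i hi ih =>
    rw [chainCoeff_succ_succ Sb T hi le_rfl, Finset.sum_eq_single i]
    · rw [ih, E_self, div_self (normFactor_ne_zero i)]
      ext; simp
    · intro v hv hvi
      rw [Finset.mem_Icc] at hv
      rw [chainCoeff_of_lt Sb T (by omega) hv.1]
      simp
    · intro h
      simp [hi] at h

theorem chainCoeff_two {j : ℕ} (hj : 1 ≤ j) :
    chainCoeff Sb T 2 (j + 1) = (normFactor 𝕜 j / normFactor 𝕜 1) • E Sb T 1 j := by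
  rw [chainCoeff_succ_succ Sb T le_rfl le_rfl, Finset.sum_eq_single 1]
  · simp [chainCoeff]
  · intro v _ hv
    rw [chainCoeff_one Sb T hv]
    simp
  · intro h
    simp [hj] at h

/-- The recursion for M is the recursion of the chains in disguise: passing from M^{2n-1} to
M^{2n+1} applies the chain recursion twice, through Q^{2n-1} and Q^{2n}, and the factorials
telescope. Indices shift by one because the chains also contain the trivial first row and column. -/
theorem M_eq : ∀ {n i j : ℕ}, 1 ≤ i → i ≤ n → 1 ≤ j → j ≤ n →
    M Sb T n i j = (((2 * n + 1 - i).factorial : 𝕜) / ((2 * n + 1 - j).factorial : 𝕜)) •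
      chainCoeff Sb T (i + 1) (j + 1) := by
  intro n
  induction n with
  | zero => intro i j h1 h2; omega
  | succ n ih =>
    intro i j hi hin hj hjn
    have hfac := fun m => natCast_factorial_ne_zero (𝕜 := 𝕜) m
    -- The chain recursion sums from v = 1, where the coefficients vanish; dropping that term gives
    -- the shifted sums in the definition of `M`.
    have hshift : ∀ {f : ℕ → (B →L[𝕜] B)}, f 1 = 0 →
        ∑ v ∈ Finset.Icc 1 (n + 1), f v = ∑ s ∈ Finset.Icc 1 n, f (s + 1) := by
      intro f hf
      rw [← Finset.Ico_add_one_right_eq_Icc, ← Finset.Ico_add_one_right_eq_Icc,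
        Finset.sum_Ico_add' f 1 (n + 1) 1, Finset.sum_eq_sum_Ico_succ_bot (by omega), hf, zero_add]
    rw [M]
    split_ifs with h1 h2
    · subst h1
      rw [Q_eq Sb T le_rfl hj (by omega), chainCoeff_two Sb T hj, smul_smul]
    · subst h2
      rw [chainCoeff_succ_succ Sb T (by omega) hjn,
        hshift (by rw [chainCoeff_succ_one Sb T le_rfl]; simp), Finset.smul_sum]
      refine Finset.sum_congr rfl fun s hs => ?_
      rw [Finset.mem_Icc] at hs
      rw [Q_eq Sb T le_rfl hs.1 (by omega), Q_eq Sb T (by omega) hj (by omega),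
        chainCoeff_two Sb T hs.1]
      simp only [ContinuousLinearMap.smul_comp, ContinuousLinearMap.comp_smul, smul_smul]
      congr 1
      have e1 : 2 * n + 1 + 1 - s = 2 * (n + 1) + 1 - (s + 1) := by omega
      have e2 : 2 * (n + 1) + 1 - 2 = 2 * n + 1 + 1 - 1 := by omega
      rw [e1, e2]
      have := hfac (2 * (n + 1) + 1 - (s + 1))
      have := hfac (2 * (n + 1) + 1 - j)
      have := normFactor_ne_zero (𝕜 := 𝕜) 1
      have := normFactor_ne_zero (𝕜 := 𝕜) (s + 1)
      field_simp
    · have hi3 : 3 ≤ i := by omega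
      obtain ⟨p, rfl⟩ : ∃ p, i = p + 2 := ⟨i - 2, by omega⟩
      rw [chainCoeff_succ_succ Sb T (by omega) hjn,
        hshift (by rw [chainCoeff_succ_one Sb T (by omega)]; simp), Finset.smul_sum,
        Finset.sum_comm]
      refine Finset.sum_congr rfl fun s hs => ?_
      rw [Finset.mem_Icc] at hs
      have hsn : s ≤ n + 1 := by omega
      rw [chainCoeff_succ_succ Sb T (by omega) hsn,
        hshift (by rw [chainCoeff_succ_one Sb T (by omega)]; simp)]
      have hcomp : ∀ (f : ℕ → (B →L[𝕜] B)) (g : B →L[𝕜] B),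
          (∑ t ∈ Finset.Icc 1 n, f t) ∘L g = ∑ t ∈ Finset.Icc 1 n, f t ∘L g := by
        intro f g
        ext x
        simp
      rw [hcomp, Finset.smul_sum, Finset.smul_sum]
      refine Finset.sum_congr rfl fun t ht => ?_
      rw [Finset.mem_Icc] at ht
      rw [Nat.add_sub_cancel, ih (by omega) (by omega) ht.1 ht.2,
        Q_eq Sb T (by omega) hs.1 (by omega), Q_eq Sb T (by omega) hj (by omega)]
      simp only [ContinuousLinearMap.smul_comp, ContinuousLinearMap.comp_smul, smul_smul,
        ContinuousLinearMap.comp_assoc]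
      congr 1
      have e1 : 2 * n + 1 + 1 - s = 2 * (n + 1) + 1 - (s + 1) := by omega
      have e2 : 2 * (n + 1) + 1 - (p + 2) = 2 * n + 1 - p := by omega
      have e3 : 2 * n + 1 + 1 - (t + 1) = 2 * n + 1 - t := by omega
      rw [e1, e2, e3]
      have := hfac (2 * (n + 1) + 1 - (s + 1))
      have := hfac (2 * (n + 1) + 1 - j)
      have := hfac (2 * n + 1 - t)
      have := normFactor_ne_zero (𝕜 := 𝕜) (t + 1)
      have := normFactor_ne_zero (𝕜 := 𝕜) (s + 1)
      field_simp

theorem Mhat_eq {k r i : ℕ} (hr : 1 ≤ r) (hrk : r ≤ k + 1) (hi : 1 ≤ i) (hik : i ≤ k + 1) :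
    Mhat Sb T k r i = (((2 * k + 2 - r).factorial : 𝕜) / ((2 * k + 2 - i).factorial : 𝕜)) •
      chainCoeff Sb T r i := by
  have hfac := natCast_factorial_ne_zero (𝕜 := 𝕜) (2 * k + 2 - r)
  rw [Mhat]
  split_ifs with h1 h2
  · subst h2
    rw [chainCoeff_self Sb T hr, div_self hfac, one_smul]
  · rcases h1 with rfl | rfl
    · rw [chainCoeff_one Sb T (Ne.symm h2), smul_zero]
    · rw [chainCoeff_succ_one Sb T (by omega), smul_zero]
  · obtain ⟨r, rfl⟩ : ∃ s, r = s + 1 := ⟨r - 1, by omega⟩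
    obtain ⟨i, rfl⟩ : ∃ s, i = s + 1 := ⟨i - 1, by omega⟩
    rw [M_eq Sb T (by omega) (by omega) (by omega) (by omega)]
    congr 3 <;> congr 1 <;> omega

/-- The operator polynomial `Φ_i(ε) = I + O(ε)`. -/
def chain (i : ℕ) (ε : 𝕜) : B →L[𝕜] B :=
  ∑ r ∈ Finset.Icc 1 i, ε ^ (i - r) • chainCoeff Sb T r i

/-- The columns multiplying the W's in `nextSb` are chain coefficients by one more step of the chain
recursion, again up to factorials. -/
theorem nextSb_eq {G : B → B'} {z : ℕ → B} {n : ℕ} (hn : 1 ≤ n) :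
    nextSb G z Sb T n = ∑ i ∈ Finset.Icc 1 n, (((2 * n - i).factorial : 𝕜) / (n.factorial : 𝕜)) •
      (W 𝕜 G z (2 * n) (n - 1) (2 * n - i) ∘L chainCoeff Sb T (i + 1) (n + 1)) +
      (((2 * n).factorial : 𝕜) / ((n.factorial : 𝕜) ^ 2)) • fderiv 𝕜 (fderiv 𝕜 G) 0 (z n) := by
  rw [nextSb]
  congr 1
  refine Finset.sum_congr rfl fun i hi => ?_
  rw [Finset.mem_Icc] at hi
  rw [← ContinuousLinearMap.comp_smul]
  congr 1
  have hfac := fun m => natCast_factorial_ne_zero (𝕜 := 𝕜) m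
  split_ifs with h1
  · subst h1
    rw [Q_eq Sb T le_rfl hn (by omega), chainCoeff_two Sb T hn, smul_smul]
    have e1 : 2 * n - 1 + 1 - n = n := by omega
    have e2 : 2 * n - 1 + 1 - 1 = 2 * n - 1 := by omega
    rw [e1, e2]
  · have hshift : ∀ {f : ℕ → (B →L[𝕜] B)}, f 1 = 0 →
        ∑ v ∈ Finset.Icc 1 n, f v = ∑ s ∈ Finset.Icc 1 (n - 1), f (s + 1) := by
      intro f hf
      obtain ⟨p, rfl⟩ : ∃ p, n = p + 1 := ⟨n - 1, by omega⟩
      rw [Nat.add_sub_cancel, ← Finset.Ico_add_one_right_eq_Icc, ← Finset.Ico_add_one_right_eq_Icc,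
        Finset.sum_Ico_add' f 1 (p + 1) 1, Finset.sum_eq_sum_Ico_succ_bot (by omega), hf, zero_add]
    rw [chainCoeff_succ_succ Sb T (by omega) le_rfl,
      hshift (by rw [chainCoeff_succ_one Sb T (by omega)]; simp), Finset.smul_sum]
    refine Finset.sum_congr rfl fun t ht => ?_
    rw [Finset.mem_Icc] at ht
    rw [M_eq Sb T (by omega) (by omega) ht.1 ht.2, Q_eq Sb T (by omega) hn (by omega)]
    simp only [ContinuousLinearMap.smul_comp, ContinuousLinearMap.comp_smul, smul_smul]
    have e0 : i - 1 + 1 = i := by omega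
    rw [e0]
    congr 1
    have e1 : 2 * n - 1 + 1 - n = n := by omega
    have e2 : 2 * (n - 1) + 1 - (i - 1) = 2 * n - i := by omega
    have e3 : 2 * n - 1 + 1 - (t + 1) = 2 * (n - 1) + 1 - t := by omega
    rw [e1, e2, e3]
    have := hfac (2 * (n - 1) + 1 - t)
    have := normFactor_ne_zero (𝕜 := 𝕜) (t + 1)
    field_simp

end Chains

end

end KTransversal

namespace KTransversal

set_option linter.unusedSectionVars false

noncomputable section

/-! ### Topological complements and triangular sums. -/

section Complements

variable {𝕜 X : Type*} [RCLike 𝕜] [NormedAddCommGroup X] [NormedSpace 𝕜 X]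

/-- A sum of closed subspaces need not be closed; here A ⊔ D is the preimage of D under the
continuous projection onto C along A. -/
theorem isClosed_sup_of_isTopCompl {C A D : Submodule 𝕜 X} (h : Submodule.IsTopCompl C A)
    (hDC : D ≤ C) (hD : IsClosed (D : Set X)) : IsClosed ((A ⊔ D : Submodule 𝕜 X) : Set X) := by
  have : ((A ⊔ D : Submodule 𝕜 X) : Set X) = (C.projectionL A h) ⁻¹' (D : Set X) := by
    ext x
    simp only [SetLike.mem_coe, Set.mem_preimage]
    constructor
    · intro hx
      obtain ⟨a, ha, d, hd, rfl⟩ := Submodule.mem_sup.1 hx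
      rw [map_add, (Submodule.projectionL_apply_eq_zero_iff h).2 ha, zero_add,
        (Submodule.projectionL_eq_self_iff h d).2 (hDC hd)]
      exact hd
    · intro hx
      refine Submodule.mem_sup.2 ⟨x - C.projectionL A h x, ?_, _, hx, by abel⟩
      rw [← Submodule.projectionL_apply_eq_zero_iff h, map_sub,
        (Submodule.projectionL_eq_self_iff h _).2 (Submodule.projectionL_apply_mem h x), sub_self]
  rw [this]
  exact hD.preimage (C.projectionL A h).continuous

/-- The induction step for both filtrations: in X = C ⊕ A the summand C is split further and one
piece is moved to the other side. Closedness of the two sums makes the projection continuous, X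
being complete. -/
theorem isTopCompl_sup [CompleteSpace X] {C A D D' : Submodule 𝕜 X}
    (h : Submodule.IsTopCompl C A) (hDD' : D ⊔ D' = C) (hdisj : Disjoint D D')
    (hD : IsClosed (D : Set X)) (hD' : IsClosed (D' : Set X)) :
    Submodule.IsTopCompl D' (A ⊔ D) := by
  refine Submodule.IsCompl.isTopCompl_of_isClosed ⟨?_, ?_⟩ hD'
    (isClosed_sup_of_isTopCompl h (hDD' ▸ le_sup_left) hD)
  · rw [sup_comm]
    refine Disjoint.disjoint_sup_right_of_disjoint_sup_left hdisj.symm ?_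
    rw [sup_comm, hDD']
    exact h.isCompl.disjoint
  · rw [codisjoint_iff, sup_comm A D, ← sup_assoc, sup_comm D' D, hDD']
    exact codisjoint_iff.1 h.isCompl.codisjoint

theorem iSup_fin_eq {f g : ℕ → Submodule 𝕜 X} (h0 : g 0 = ⊥)
    (hs : ∀ i, g (i + 1) = g i ⊔ f (i + 1)) (n : ℕ) : g n = ⨆ j : Fin n, f (j.val + 1) := by
  induction n with
  | zero => rw [h0, iSup_of_empty]
  | succ n ih =>
    rw [hs, ih]
    apply le_antisymm
    · refine sup_le (iSup_le fun j => ?_) ?_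
      · exact le_iSup (fun j : Fin (n + 1) => f (j.val + 1)) j.castSucc
      · exact le_iSup (fun j : Fin (n + 1) => f (j.val + 1)) (Fin.last n)
    · refine iSup_le fun j => ?_
      rcases Fin.eq_castSucc_or_eq_last j with ⟨i, rfl⟩ | rfl
      · exact le_sup_of_le_left (le_iSup (fun j : Fin n => f (j.val + 1)) i)
      · exact le_sup_right

theorem projOnto_eq {p q : Submodule 𝕜 X} (h : Submodule.IsTopCompl p q) :
    projOnto p q = p.projectionL q h := by
  simp [projOnto, h]

/-- A triangular family of maps adds up to a bijection onto the top of the filtration. -/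
theorem injective_sum_of_triangular {m : ℕ} {V : Fin m → Type*} [∀ j, AddCommGroup (V j)]
    [∀ j, Module 𝕜 (V j)] {F : ℕ → Submodule 𝕜 X} (hF : Monotone F)
    {t : ∀ j, V j →ₗ[𝕜] X} (h1 : ∀ (j : Fin m) v, t j v ∈ F (j + 1))
    (h2 : ∀ (j : Fin m) v, t j v ∈ F j → v = 0) {n : ∀ j, V j} (hn : ∑ j, t j (n j) = 0) : n = 0 := by
  by_contra hne
  obtain ⟨j, hj⟩ := Function.ne_iff.1 hne
  classical
  set s := Finset.univ.filter fun j => n j ≠ 0 with hs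
  have hsn : s.Nonempty := ⟨j, by simp [hs]; exact hj⟩
  -- At the largest index with a non-zero component, all other terms lie in F i, so t i (n i) does
  -- too.
  obtain ⟨i, hi, hmax⟩ := s.exists_max_image id hsn
  have hin : n i ≠ 0 := by simpa [hs] using hi
  apply hin
  apply h2
  have hsplit : t i (n i) = - ∑ j ∈ Finset.univ.erase i, t j (n j) := by
    rw [← Finset.add_sum_erase _ _ (Finset.mem_univ i)] at hn
    exact eq_neg_of_add_eq_zero_left hn
  rw [hsplit]
  refine Submodule.neg_mem _ (Submodule.sum_mem _ fun j hj => ?_)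
  have hji : j ≠ i := Finset.ne_of_mem_erase hj
  by_cases hnj : n j = 0
  · rw [hnj, map_zero]; exact Submodule.zero_mem _
  · have : j ≤ i := hmax j (by simpa [hs] using hnj)
    have hlt : j.val < i.val := lt_of_le_of_ne this (fun h => hji (Fin.ext h))
    exact hF hlt (h1 j (n j))

theorem exists_sum_eq_of_triangular {m : ℕ} {V : Fin m → Type*} [∀ j, AddCommGroup (V j)]
    [∀ j, Module 𝕜 (V j)] {F : ℕ → Submodule 𝕜 X} (hF0 : F 0 = ⊥)
    {t : ∀ j, V j →ₗ[𝕜] X} (h3 : ∀ j : Fin m, F (j + 1) ≤ F j ⊔ LinearMap.range (t j))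
    {x : X} (hx : x ∈ F m) : ∃ n : ∀ j, V j, ∑ j, t j (n j) = x := by
  classical
  set tot : (∀ j, V j) →ₗ[𝕜] X := ∑ j, t j ∘ₗ LinearMap.proj j with htot
  have htn : ∀ n, tot n = ∑ j, t j (n j) := fun n => by simp [htot]
  have key : ∀ i ≤ m, F i ≤ LinearMap.range tot := by
    intro i
    induction i with
    | zero => intro _; rw [hF0]; exact bot_le
    | succ i ih =>
      intro hi
      refine (h3 ⟨i, hi⟩).trans (sup_le (ih (by omega)) ?_)
      rintro _ ⟨v, rfl⟩
      refine ⟨Pi.single ⟨i, hi⟩ v, ?_⟩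
      rw [htn, Finset.sum_eq_single ⟨i, hi⟩]
      · simp
      · intro j _ hj
        rw [Pi.single_eq_of_ne hj, map_zero]
      · simp
  obtain ⟨n, hn⟩ := key m le_rfl hx
  exact ⟨n, by rw [← htn, hn]⟩

end Complements

/-! ### Algebra of the fine resolution: decompositions, the inverses of S_i and the back
substitution. -/

namespace Resolution

variable {𝕜 B B' : Type*} [RCLike 𝕜] [NormedAddCommGroup B] [NormedSpace 𝕜 B]
  [NormedAddCommGroup B'] [NormedSpace 𝕜 B']

theorem N_zero (D : Resolution 𝕜 B B') : D.N 0 = ⊤ := rfl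

theorem Rsum_zero (D : Resolution 𝕜 B B') : D.Rsum 0 = ⊥ := rfl

theorem N_succ (D : Resolution 𝕜 B B') (i : ℕ) :
    D.N (i + 1) = D.N i ⊓ LinearMap.ker (D.S (i + 1)).toLinearMap := rfl

theorem Rsum_succ (D : Resolution 𝕜 B B') (i : ℕ) :
    D.Rsum (i + 1) = D.Rsum i ⊔ D.R (i + 1) := rfl

theorem Rsum_mono (D : Resolution 𝕜 B B') : Monotone D.Rsum :=
  monotone_nat_of_le_succ fun i => by rw [Rsum_succ]; exact le_sup_left

theorem N_anti (D : Resolution 𝕜 B B') : Antitone D.N :=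
  antitone_nat_of_succ_le fun i => by rw [N_succ]; exact inf_le_left

theorem isTransversal_iff (D : Resolution 𝕜 B B') (k : ℕ) :
    D.IsTransversal k ↔ D.Rsum (k + 1) = ⊤ := by
  rw [iSup_fin_eq (f := D.R) D.Rsum_zero D.Rsum_succ (k + 1)]
  rfl

/-- `N_1^c ⊕ … ⊕ N_i^c`. -/
def NcPartial (D : Resolution 𝕜 B B') : ℕ → Submodule 𝕜 B
  | 0 => ⊥
  | i + 1 => D.NcPartial i ⊔ D.Nc (i + 1)

theorem NcPartial_mono (D : Resolution 𝕜 B B') : Monotone D.NcPartial :=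
  monotone_nat_of_le_succ fun _ => le_sup_left

theorem NcSum_eq (D : Resolution 𝕜 B B') (k : ℕ) : D.NcSum k = D.NcPartial (k + 1) :=
  (iSup_fin_eq (f := D.Nc) rfl (fun _ => rfl) (k + 1)).symm

theorem Nc_le_NcPartial (D : Resolution 𝕜 B B') {i j : ℕ} (hi : 1 ≤ i) (hij : i ≤ j) :
    D.Nc i ≤ D.NcPartial j := by
  obtain ⟨i, rfl⟩ : ∃ s, i = s + 1 := ⟨i - 1, by omega⟩
  exact le_trans le_sup_right (D.NcPartial_mono hij)

theorem isClosed_N (D : Resolution 𝕜 B B') (i : ℕ) : IsClosed (D.N i : Set B) := by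
  induction i with
  | zero => rw [N_zero]; exact isClosed_univ
  | succ i ih =>
    rw [N_succ]
    exact ih.inter (D.S (i + 1)).isClosed_ker

theorem S_mem_R (D : Resolution 𝕜 B B') {i : ℕ} {x : B} (hx : x ∈ D.N i) : D.S (i + 1) x ∈ D.R (i + 1) :=
  ⟨x, hx, rfl⟩

variable [CompleteSpace B] [CompleteSpace B'] {D : Resolution 𝕜 B B'} {G : B → B'} {z : ℕ → B}
  {k l : ℕ}

namespace IsFineResolution

variable (hD : D.IsFineResolution G z k l)
include hD

/-- Guarantees that the projection occurring in `S` is the genuine one and not the default value 0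
of `projOnto`. -/
theorem isTopCompl_Rc {i : ℕ} (hi : i ≤ k + 1) : Submodule.IsTopCompl (D.Rc i) (D.Rsum i) := by
  induction i with
  | zero => rw [hD.Rc_zero, Rsum_zero]; exact Submodule.isTopCompl_top_bot
  | succ i ih =>
    rw [Rsum_succ]
    exact isTopCompl_sup (ih (by omega)) (hD.sup_R (i + 1) (by omega) hi)
      (hD.disjoint_R (i + 1) (by omega) hi) (hD.isClosed_R (i + 1) (by omega) hi)
      (hD.isClosed_Rc (i + 1) (by omega) hi)

theorem isTopCompl_N {i : ℕ} (hi : i ≤ k + 1) : Submodule.IsTopCompl (D.N i) (D.NcPartial i) := by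
  induction i with
  | zero => exact Submodule.isTopCompl_top_bot
  | succ i ih =>
    exact isTopCompl_sup (ih (by omega)) (hD.sup_N (i + 1) (by omega) hi)
      (hD.disjoint_N (i + 1) (by omega) hi) (hD.isClosed_Nc (i + 1) (by omega) hi) (D.isClosed_N _)

theorem Nc_le {i : ℕ} (hi : i + 1 ≤ k + 1) : D.Nc (i + 1) ≤ D.N i := by
  have := hD.sup_N (i + 1) (by omega) hi
  rw [Nat.add_sub_cancel] at this
  rw [← this]
  exact le_sup_left

theorem S_apply {i : ℕ} (hi : i ≤ k + 1) (x : B) :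
    D.S (i + 1) x = (D.Rc i).projectionL (D.Rsum i) (hD.isTopCompl_Rc hi) (D.Sb (i + 1) x) := by
  rw [S, Nat.add_sub_cancel, projOnto_eq (hD.isTopCompl_Rc hi)]
  rfl

theorem S_mem_Rc {i : ℕ} (hi : i ≤ k + 1) (x : B) : D.S (i + 1) x ∈ D.Rc i := by
  rw [hD.S_apply hi]
  exact Submodule.projectionL_apply_mem _ _

theorem Sb_sub_S_mem {i : ℕ} (hi : i ≤ k + 1) (x : B) :
    D.Sb (i + 1) x - D.S (i + 1) x ∈ D.Rsum i := by
  rw [hD.S_apply hi, ← Submodule.projectionL_apply_eq_zero_iff (hD.isTopCompl_Rc hi), map_sub,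
    (Submodule.projectionL_eq_self_iff _ _).2 (Submodule.projectionL_apply_mem _ _), sub_self]

theorem exists_S_eq {i : ℕ} (hi : i + 1 ≤ k + 1) {y : B'} (hy : y ∈ D.R (i + 1)) :
    ∃ x ∈ D.Nc (i + 1), D.S (i + 1) x = y := by
  obtain ⟨x, hx, rfl⟩ := hy
  have hx' : x ∈ D.N i := hx
  have hsup := hD.sup_N (i + 1) (by omega) hi
  rw [Nat.add_sub_cancel] at hsup
  rw [← hsup] at hx'
  obtain ⟨n, hn, n', hn', rfl⟩ := Submodule.mem_sup.1 hx'
  refine ⟨n, hn, ?_⟩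
  have : D.S (i + 1) n' = 0 := (Submodule.mem_inf.1 (N_succ D i ▸ hn')).2
  simp [this]

theorem eq_zero_of_S_eq_zero {i : ℕ} (hi : i + 1 ≤ k + 1) {x : B} (hx : x ∈ D.Nc (i + 1))
    (h : D.S (i + 1) x = 0) : x = 0 := by
  have : x ∈ D.N (i + 1) := by
    rw [N_succ]
    exact ⟨hD.Nc_le hi hx, h⟩
  exact (Submodule.disjoint_def.1 (hD.disjoint_N (i + 1) (by omega) hi)) x hx this

theorem isTopCompl_R {i : ℕ} (hi : i + 1 ≤ k + 1) :
    Submodule.IsTopCompl (D.R (i + 1)) (D.Rsum i ⊔ D.Rc (i + 1)) := by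
  have h1 := hD.sup_R (i + 1) (by omega) hi
  rw [sup_comm] at h1
  exact isTopCompl_sup (hD.isTopCompl_Rc (show i ≤ k + 1 by omega)) h1
    (hD.disjoint_R (i + 1) (by omega) hi).symm (hD.isClosed_Rc (i + 1) (by omega) hi)
    (hD.isClosed_R (i + 1) (by omega) hi)

/-- S_i : N_i^c → R_i is a continuous bijection of Banach spaces, so the open mapping theorem
inverts it; composing with the projection onto R_i gives T. Hence the default value in `invOnto`
does not occur. -/
theorem exists_inverse {i : ℕ} (hi : i + 1 ≤ k + 1) :
    ∃ T : B' →L[𝕜] B, (∀ x ∈ D.Nc (i + 1), T (D.S (i + 1) x) = x) ∧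
      ∀ y ∈ D.Rsum i ⊔ D.Rc (i + 1), T y = 0 := by
  have hc := hD.isTopCompl_R hi
  have : CompleteSpace (D.Nc (i + 1)) := (hD.isClosed_Nc (i + 1) (by omega) hi).completeSpace_coe
  have : CompleteSpace (D.R (i + 1)) := (hD.isClosed_R (i + 1) (by omega) hi).completeSpace_coe
  set f : D.Nc (i + 1) →L[𝕜] D.R (i + 1) :=
    (D.S (i + 1) ∘L (D.Nc (i + 1)).subtypeL).codRestrict (D.R (i + 1))
      (fun x => D.S_mem_R (hD.Nc_le hi x.2)) with hf
  have hinj : LinearMap.ker (f : D.Nc (i + 1) →ₗ[𝕜] D.R (i + 1)) = ⊥ := by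
    rw [LinearMap.ker_eq_bot']
    intro x hx
    have : D.S (i + 1) x = 0 := congrArg Subtype.val hx
    exact Subtype.ext (hD.eq_zero_of_S_eq_zero hi x.2 this)
  have hsurj : LinearMap.range (f : D.Nc (i + 1) →ₗ[𝕜] D.R (i + 1)) = ⊤ := by
    rw [LinearMap.range_eq_top]
    intro y
    obtain ⟨x, hx, hxy⟩ := hD.exists_S_eq hi y.2
    exact ⟨⟨x, hx⟩, Subtype.ext hxy⟩
  set e := ContinuousLinearEquiv.ofBijective f hinj hsurj with he
  refine ⟨(D.Nc (i + 1)).subtypeL ∘L (e.symm : D.R (i + 1) →L[𝕜] D.Nc (i + 1)) ∘L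
    (D.R (i + 1)).projectionOntoL _ hc, fun x hx => ?_, fun y hy => ?_⟩
  · have h1 : (D.R (i + 1)).projectionOntoL _ hc (D.S (i + 1) x) = f ⟨x, hx⟩ :=
      Submodule.projectionOntoL_apply_left hc (f ⟨x, hx⟩)
    simp only [ContinuousLinearMap.comp_apply, h1]
    have h2 : e.symm (f ⟨x, hx⟩) = ⟨x, hx⟩ := e.symm_apply_apply ⟨x, hx⟩
    simp [h2]
  · have h1 : (D.R (i + 1)).projectionOntoL _ hc y = 0 :=
      (Submodule.projectionOntoL_apply_eq_zero_iff hc).2 hy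
    simp [h1]

theorem T_spec {i : ℕ} (hi : i + 1 ≤ k + 1) :
    (∀ x ∈ D.Nc (i + 1), D.T (i + 1) (D.S (i + 1) x) = x) ∧
      ∀ y ∈ D.Rsum i ⊔ D.Rc (i + 1), D.T (i + 1) y = 0 := by
  have h := hD.exists_inverse hi
  have : D.T (i + 1) = h.choose := by
    rw [T, invOnto]
    exact dif_pos h
  rw [this]
  exact h.choose_spec

theorem T_mem_Nc {i : ℕ} (hi : i + 1 ≤ k + 1) (y : B') : D.T (i + 1) y ∈ D.Nc (i + 1) := by
  have htop : y ∈ D.R (i + 1) ⊔ (D.Rsum i ⊔ D.Rc (i + 1)) := by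
    rw [codisjoint_iff.1 (hD.isTopCompl_R hi).isCompl.codisjoint]; trivial
  obtain ⟨a, ha, b, hb, rfl⟩ := Submodule.mem_sup.1 htop
  obtain ⟨x, hx, rfl⟩ := hD.exists_S_eq hi ha
  rw [map_add, (hD.T_spec hi).1 x hx, (hD.T_spec hi).2 b hb, add_zero]
  exact hx

theorem E_mem_Nc {v j : ℕ} (hv : 1 ≤ v) (hvj : v < j) (hj : j ≤ k + 1) (x : B) :
    E D.Sb D.T v j x ∈ D.Nc v := by
  obtain ⟨v, rfl⟩ : ∃ s, v = s + 1 := ⟨v - 1, by omega⟩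
  rw [E_of_gt _ _ hvj]
  exact Submodule.neg_mem _ (hD.T_mem_Nc (by omega) _)

theorem E_mem_N {v j : ℕ} (hv : 1 ≤ v) (hvj : v ≤ j) (hj : j ≤ k + 1) {x : B} (hx : x ∈ D.N j) :
    E D.Sb D.T v j x ∈ D.N (v - 1) := by
  rcases Nat.eq_or_lt_of_le hvj with rfl | h
  · rw [E_self]
    exact D.N_anti (Nat.sub_le v 1) hx
  · obtain ⟨v, rfl⟩ : ∃ s, v = s + 1 := ⟨v - 1, by omega⟩
    exact hD.Nc_le (by omega) (hD.E_mem_Nc hv h hj x)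

/-- Back substitution from v = j downwards. Adding the next term cancels the component of the
partial sum in R_v, which is exactly how E_{v,j} is defined, and the error S̄_v - S_v lies in R_1 ⊕
… ⊕ R_{v-1}. When v = 1 is reached nothing is left. -/
theorem sum_Sb_E_mem {j : ℕ} (hj : j ≤ k + 1) {x : B} (hx : x ∈ D.N j) :
    ∀ d < j, ∑ v ∈ Finset.Icc (j - d) j, D.Sb v (E D.Sb D.T v j x) ∈ D.Rsum (j - d - 1) := by
  intro d
  induction d with
  | zero =>
    intro h0
    obtain ⟨i, rfl⟩ : ∃ s, j = s + 1 := ⟨j - 1, by omega⟩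
    simp only [Nat.sub_zero, Finset.Icc_self, Finset.sum_singleton, E_self,
      ContinuousLinearMap.id_apply, Nat.add_sub_cancel]
    have h1 := hD.Sb_sub_S_mem (show i ≤ k + 1 by omega) x
    have h2 : D.S (i + 1) x = 0 := (Submodule.mem_inf.1 (N_succ D i ▸ hx)).2
    rwa [h2, sub_zero] at h1
  | succ d ih =>
    intro hd
    have IH := ih (by omega)
    obtain ⟨i, hi⟩ : ∃ i, j - (d + 1) = i + 1 := ⟨j - (d + 1) - 1, by omega⟩
    have e1 : j - d = i + 2 := by omega
    have e2 : j - d - 1 = i + 1 := by omega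
    rw [e1] at IH
    rw [hi, Nat.add_sub_cancel, ← Finset.add_sum_Ioc_eq_sum_Icc (by omega : i + 1 ≤ j),
      ← Finset.Icc_add_one_left_eq_Ioc, E_of_gt _ _ (show i + 1 < j by omega)]
    have e3 : i + 2 - 1 = i + 1 := by omega
    rw [e3, Rsum_succ] at IH
    have esum : (∑ v ∈ Finset.Icc (i + 1 + 1) j, D.Sb v ∘L E D.Sb D.T v j) x =
        ∑ v ∈ Finset.Icc (i + 1 + 1) j, D.Sb v (E D.Sb D.T v j x) := by simp
    set s := ∑ v ∈ Finset.Icc (i + 1 + 1) j, D.Sb v (E D.Sb D.T v j x) with hs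
    rw [neg_apply, ContinuousLinearMap.comp_apply, esum]
    obtain ⟨a, ha, b, hb, hab⟩ := Submodule.mem_sup.1 IH
    obtain ⟨n, hn, hnb⟩ := hD.exists_S_eq (show i + 1 ≤ k + 1 by omega) hb
    have hT : D.T (i + 1) s = n := by
      rw [← hab, ← hnb, map_add, (hD.T_spec (by omega)).1 n hn,
        (hD.T_spec (by omega)).2 a (Submodule.mem_sup_left ha), zero_add]
    rw [hT, ← hab, ← hnb, map_neg]
    have h1 := hD.Sb_sub_S_mem (show i ≤ k + 1 by omega) n
    have : -(D.Sb (i + 1)) n + (a + (D.S (i + 1)) n) = a - (D.Sb (i + 1) n - D.S (i + 1) n) := by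
      abel
    rw [this]
    exact Submodule.sub_mem _ ha h1

theorem sum_Sb_E_eq_zero {j : ℕ} (hj1 : 1 ≤ j) (hj : j ≤ k + 1) {x : B} (hx : x ∈ D.N j) :
    ∑ v ∈ Finset.Icc 1 j, D.Sb v (E D.Sb D.T v j x) = 0 := by
  have h := hD.sum_Sb_E_mem hj hx (j - 1) (by omega)
  have e1 : j - (j - 1) = 1 := by omega
  rw [e1, Nat.sub_self, Rsum_zero] at h
  exact (Submodule.mem_bot 𝕜).1 h

/-- E_{v,j} maps all of B into N_v^c for v < j. Hence Φ_i is the identity modulo N_1^c ⊕ … ⊕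
N_{i-1}^c, the triangular structure behind the invertibility of A_ε. -/
theorem chainCoeff_mem {r : ℕ} : ∀ {i : ℕ}, r < i → i ≤ k + 1 → ∀ x : B,
    chainCoeff D.Sb D.T r i x ∈ D.NcPartial (i - 1) := by
  induction r with
  | zero => intro i _ _ x; exact Submodule.zero_mem _
  | succ r ih =>
    intro i hri hi x
    rcases Nat.eq_zero_or_pos r with rfl | hr
    · rw [chainCoeff_one _ _ (by omega)]
      exact Submodule.zero_mem _
    · obtain ⟨j, rfl⟩ : ∃ s, i = s + 1 := ⟨i - 1, by omega⟩
      rw [chainCoeff_succ_succ _ _ hr le_rfl, sum_apply, Nat.add_sub_cancel]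
      refine Submodule.sum_mem _ fun v hv => ?_
      rw [Finset.mem_Icc] at hv
      refine Submodule.smul_mem _ _ ?_
      change chainCoeff D.Sb D.T r v (E D.Sb D.T v j x) ∈ D.NcPartial j
      rcases lt_trichotomy v r with h | rfl | h
      · rw [chainCoeff_of_lt _ _ h hv.1]
        exact Submodule.zero_mem _
      · rw [chainCoeff_self _ _ hv.1]
        exact D.Nc_le_NcPartial hv.1 hv.2 (hD.E_mem_Nc hv.1 (by omega) (by omega) x)
      · exact D.NcPartial_mono (by omega) (ih h (by omega) _)

end IsFineResolution

end Resolution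

end

end KTransversal

namespace KTransversal

noncomputable section

/-! ### Taylor expansion of a composition f ∘ γ with remainder. -/

section CompositionExpansion

variable {𝕜 E F : Type*} [RCLike 𝕜] [NormedAddCommGroup E] [NormedSpace 𝕜 E]
  [NormedAddCommGroup F] [NormedSpace 𝕜 F]

/-- The formal multilinear series of the Taylor polynomial of degree `k`. -/
def taylorSeries (f : E → F) (k : ℕ) : FormalMultilinearSeries 𝕜 E F := fun j =>
  if j ≤ k then ((j.factorial : 𝕜)⁻¹) • iteratedFDeriv 𝕜 j f 0 else 0

theorem taylorSeries_of_le (f : E → F) {k j : ℕ} (h : j ≤ k) :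
    taylorSeries f k j = ((j.factorial : 𝕜)⁻¹) • iteratedFDeriv 𝕜 j f 0 := if_pos h

theorem taylorSeries_add (f : E → F) (k j : ℕ) :
    taylorSeries (𝕜 := 𝕜) f k (j + (k + 1)) = 0 := if_neg (by omega)

theorem hasFPowerSeriesAt_taylorSeries (f : E → F) (k : ℕ) :
    HasFPowerSeriesAt (fun x => ∑ j ∈ Finset.range (k + 1),
      ((j.factorial : 𝕜)⁻¹) • iteratedFDeriv 𝕜 j f 0 (fun _ => x)) (taylorSeries (𝕜 := 𝕜) f k) 0 := by
  have hr := FormalMultilinearSeries.radius_eq_top_of_forall_image_add_eq_zero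
    (taylorSeries (𝕜 := 𝕜) f k) (k + 1) (taylorSeries_add f k)
  have hs : ∀ y : E, HasSum (fun j => taylorSeries (𝕜 := 𝕜) f k j fun _ => y)
      (∑ j ∈ Finset.range (k + 1), ((j.factorial : 𝕜)⁻¹) • iteratedFDeriv 𝕜 j f 0 (fun _ => y)) := by
    intro y
    have : ∑ j ∈ Finset.range (k + 1), ((j.factorial : 𝕜)⁻¹) • iteratedFDeriv 𝕜 j f 0 (fun _ => y)
        = ∑ j ∈ Finset.range (k + 1), taylorSeries (𝕜 := 𝕜) f k j fun _ => y := by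
      refine Finset.sum_congr rfl fun j hj => ?_
      rw [taylorSeries_of_le f (by rw [Finset.mem_range] at hj; omega)]
      rfl
    rw [this]
    refine hasSum_sum_of_ne_finset_zero fun j hj => ?_
    rw [Finset.mem_range, not_lt] at hj
    obtain ⟨i, rfl⟩ := Nat.exists_eq_add_of_le' hj
    rw [taylorSeries_add]
    rfl
  refine HasFPowerSeriesOnBall.hasFPowerSeriesAt (r := ⊤)
    ⟨by rw [hr], ENNReal.zero_lt_top, fun {y} _ => ?_⟩
  rw [zero_add]
  exact hs y

theorem iteratedFDeriv_const_eq_pow_smul (γ : 𝕜 → E) (j : ℕ) (ε : 𝕜) :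
    iteratedFDeriv 𝕜 j γ 0 (fun _ => ε) = ε ^ j • iteratedDeriv j γ 0 := by
  rw [iteratedFDeriv_apply_eq_iteratedDeriv_mul_prod]
  simp

/-- The coefficients of the Taylor expansion of `f ∘ γ` for a curve `γ` with derivatives `z i`. -/
def compCoeff (f : E → F) (z : ℕ → E) (m : ℕ) : F :=
  ∑ c : Composition m, ((c.length.factorial : 𝕜)⁻¹) • iteratedFDeriv 𝕜 c.length f 0
    (fun i => ((c.blocksFun i).factorial : 𝕜)⁻¹ • z (c.blocksFun i))

theorem comp_taylorSeries_apply (f : E → F) (γ : 𝕜 → E) {k m : ℕ} (hm : m ≤ k) (ε : 𝕜) :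
    ((taylorSeries (𝕜 := 𝕜) f k).comp (taylorSeries (𝕜 := 𝕜) γ k)) m (fun _ => ε) =
      ε ^ m • compCoeff (𝕜 := 𝕜) f (fun i => iteratedDeriv i γ 0) m := by
  rw [FormalMultilinearSeries.comp, sum_apply, compCoeff,
    Finset.smul_sum]
  refine Finset.sum_congr rfl fun c _ => ?_
  rw [FormalMultilinearSeries.compAlongComposition_apply,
    taylorSeries_of_le f (c.length_le.trans hm)]
  have : (taylorSeries (𝕜 := 𝕜) γ k).applyComposition c (fun _ => ε) = fun i =>
      (ε ^ c.blocksFun i) • (((c.blocksFun i).factorial : 𝕜)⁻¹ •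
        iteratedDeriv (c.blocksFun i) γ 0) := by
    funext i
    rw [FormalMultilinearSeries.applyComposition,
      taylorSeries_of_le γ ((c.blocksFun_le i).trans hm), smul_comm,
      ← iteratedFDeriv_const_eq_pow_smul]
    rfl
  rw [this, smul_apply, ContinuousMultilinearMap.map_smul_univ,
    Finset.prod_pow_eq_pow_sum, c.sum_blocksFun, smul_comm]

/-- f and γ are replaced by their Taylor polynomials P and Γ. For these the composition of formal
power series applies, and it supplies the sum over compositions defining `compCoeff`. -/
theorem comp_taylor_isBigO {f : E → F} {γ : 𝕜 → E} {k : ℕ} (hf : ContDiffAt 𝕜 (k + 1 : ℕ) f 0)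
    (hγ : ContDiffAt 𝕜 (k + 1 : ℕ) γ 0) (hγ0 : γ 0 = 0) :
    (fun ε => f (γ ε) - ∑ m ∈ Finset.range (k + 1),
      ε ^ m • compCoeff (𝕜 := 𝕜) f (fun i => iteratedDeriv i γ 0) m)
      =O[𝓝 0] fun ε : 𝕜 => ‖ε‖ ^ (k + 1) := by
  set P : E → F := fun x => ∑ j ∈ Finset.range (k + 1),
      ((j.factorial : 𝕜)⁻¹) • iteratedFDeriv 𝕜 j f 0 (fun _ => x) with hP
  set Γ : 𝕜 → E := fun x => ∑ j ∈ Finset.range (k + 1),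
      ((j.factorial : 𝕜)⁻¹) • iteratedFDeriv 𝕜 j γ 0 (fun _ => x) with hΓ
  have hp := hasFPowerSeriesAt_taylorSeries (𝕜 := 𝕜) f k
  have hg := hasFPowerSeriesAt_taylorSeries (𝕜 := 𝕜) γ k
  have hΓ0 : Γ 0 = 0 := by
    refine (hg.coeff_zero (fun _ => 0)).symm.trans ?_
    rw [taylorSeries_of_le γ (Nat.zero_le k)]
    simp [hγ0]
  have hγc : Tendsto γ (𝓝 0) (𝓝 0) := by
    have := hγ.continuousAt.tendsto
    rwa [hγ0] at this
  have hΓc : Tendsto Γ (𝓝 0) (𝓝 0) := by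
    have : Tendsto Γ (𝓝 0) (𝓝 (Γ 0)) := hg.continuousAt.tendsto
    rwa [hΓ0] at this
  have hγO : γ =O[𝓝 0] fun ε : 𝕜 => ‖ε‖ := by
    have := (hγ.differentiableAt (by simp)).isBigO_sub
    simpa [hγ0] using this.norm_right
  have h1 : (fun ε => f (γ ε) - P (γ ε)) =O[𝓝 0] fun ε : 𝕜 => ‖ε‖ ^ (k + 1) :=
    ((taylor_isBigO hf).comp_tendsto hγc).trans (hγO.norm_left.pow (k + 1))
  -- P is strictly differentiable, hence Lipschitz near 0, so replacing γ by Γ costs no order.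
  have h2 : (fun ε => P (γ ε) - P (Γ ε)) =O[𝓝 0] fun ε : 𝕜 => ‖ε‖ ^ (k + 1) := by
    have hs : HasStrictFDerivAt P _ 0 := hp.hasStrictFDerivAt
    have ht : Tendsto (fun ε => (γ ε, Γ ε)) (𝓝 0) (𝓝 ((0 : E), (0 : E))) := by
      rw [nhds_prod_eq]
      exact hγc.prodMk hΓc
    exact (hs.isBigO_sub.comp_tendsto ht).trans (taylor_isBigO hγ)
  have h3 : (fun ε => P (Γ ε) - ∑ m ∈ Finset.range (k + 1),
      ε ^ m • compCoeff (𝕜 := 𝕜) f (fun i => iteratedDeriv i γ 0) m)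
      =O[𝓝 0] fun ε : 𝕜 => ‖ε‖ ^ (k + 1) := by
    have hp' : HasFPowerSeriesAt P (taylorSeries (𝕜 := 𝕜) f k) (Γ 0) := by rw [hΓ0]; exact hp
    have := (hp'.comp (f := Γ) hg).isBigO_sub_partialSum_pow (k + 1)
    refine this.congr_left fun ε => ?_
    rw [zero_add, FormalMultilinearSeries.partialSum]
    refine congrArg _ (Finset.sum_congr rfl fun m hm => ?_)
    rw [comp_taylorSeries_apply f γ (by rw [Finset.mem_range] at hm; omega)]
  refine ((h1.add h2).add h3).congr_left fun ε => ?_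
  abel

end CompositionExpansion

/-! ### S̄_{n+1} in terms of the expansion of G'(z₀(ε)). -/

section Recursion

variable {𝕜 B B' : Type*} [RCLike 𝕜] [NormedAddCommGroup B] [NormedSpace 𝕜 B]
  [NormedAddCommGroup B'] [NormedSpace 𝕜 B']

theorem compCoeff_zero (f : B → B') (z : ℕ → B) : compCoeff (𝕜 := 𝕜) f z 0 = f 0 := by
  rw [compCoeff, Fintype.sum_eq_single (Composition.ones 0)]
  · have : ∀ c : Composition 0, ((c.length.factorial : 𝕜)⁻¹) • iteratedFDeriv 𝕜 c.length f 0
        (fun i => ((c.blocksFun i).factorial : 𝕜)⁻¹ • z (c.blocksFun i)) = f 0 := by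
      intro c
      have h : c.length = 0 := Nat.le_zero.mp c.length_le
      revert h
      generalize c.blocksFun = g
      generalize c.length = n at g
      intro h
      subst h
      simp
    exact this _
  · intro c hc
    have : Subsingleton (Composition 0) := Fintype.card_le_one_iff_subsingleton.mp
      (by rw [composition_card]; norm_num)
    exact absurd (Subsingleton.elim _ _) hc

/-- For i < n the bound n-1 on the blocks of a composition of i is automatic, so W is a full Taylor
coefficient of G'(z₀(ε)) up to factorials. -/
theorem W_eq_of_lt (G : B → B') (z : ℕ → B) {n i : ℕ} (hi : i < n) :
    W 𝕜 G z (2 * n) (n - 1) (2 * n - i) =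
      (((2 * n).factorial : 𝕜) / ((2 * n - i).factorial : 𝕜)) •
        compCoeff (𝕜 := 𝕜) (fderiv 𝕜 G) z i := by
  have e : 2 * n - (2 * n - i) = i := by omega
  rw [W, e]
  congr 1
  refine Finset.sum_congr rfl fun c _ => ?_
  rw [if_pos]
  intro j
  have := c.blocksFun_le j
  omega

/-- For i = n the bound n-1 excludes exactly the composition with the single block n. The missing
term involves G₀² z_n; it is the one that `nextSb` adds separately. -/
theorem W_eq_self (G : B → B') (z : ℕ → B) {n : ℕ} (hn : 1 ≤ n) :
    W 𝕜 G z (2 * n) (n - 1) n = (((2 * n).factorial : 𝕜) / (n.factorial : 𝕜)) •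
        (compCoeff (𝕜 := 𝕜) (fderiv 𝕜 G) z n -
          (n.factorial : 𝕜)⁻¹ • fderiv 𝕜 (fderiv 𝕜 G) 0 (z n)) := by
  have e : 2 * n - n = n := by omega
  rw [W, e]
  congr 1
  rw [compCoeff, ← Finset.add_sum_erase _ _ (Finset.mem_univ (Composition.single n hn)),
    ← Finset.add_sum_erase _ _ (Finset.mem_univ (Composition.single n hn)), if_neg, zero_add]
  · have h1 : ((Composition.single n hn).length.factorial : 𝕜)⁻¹ •
        iteratedFDeriv 𝕜 (Composition.single n hn).length (fderiv 𝕜 G) 0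
        (fun i => (((Composition.single n hn).blocksFun i).factorial : 𝕜)⁻¹ •
          z ((Composition.single n hn).blocksFun i)) =
        (n.factorial : 𝕜)⁻¹ • fderiv 𝕜 (fderiv 𝕜 G) 0 (z n) := by
      have : (fun i => (((Composition.single n hn).blocksFun i).factorial : 𝕜)⁻¹ •
          z ((Composition.single n hn).blocksFun i)) = fun _ : Fin 1 =>
          (n.factorial : 𝕜)⁻¹ • z n := by
        funext i
        rw [Composition.single_blocksFun]
      have h2 := iteratedFDeriv_one_apply (𝕜 := 𝕜) (f := fderiv 𝕜 G) (x := 0) (fun _ : Fin 1 =>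
          (n.factorial : 𝕜)⁻¹ • z n)
      rw [map_smul] at h2
      rw [← h2, ← this]
      change ((Nat.factorial 1 : ℕ) : 𝕜)⁻¹ • _ = _
      rw [Nat.factorial_one, Nat.cast_one, inv_one, one_smul]
      rfl
    rw [h1, add_sub_cancel_left]
    refine Finset.sum_congr rfl fun c hc => ?_
    rw [if_pos]
    intro j
    have h1 := c.blocksFun_le j
    have h2 : c ≠ Composition.single n hn := (Finset.mem_erase.mp hc).1
    rw [Ne, Composition.eq_single_iff_length] at h2
    by_contra h3
    have h4 : c.blocksFun j = n := by omega
    apply h2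
    have h5 := c.sum_blocksFun
    rw [← Finset.add_sum_erase _ _ (Finset.mem_univ j), h4] at h5
    have h6 : ∑ i ∈ Finset.univ.erase j, c.blocksFun i = 0 := by omega
    have h7 : (Finset.univ.erase j : Finset (Fin c.length)) = ∅ := by
      by_contra h8
      obtain ⟨i, hi⟩ := Finset.nonempty_iff_ne_empty.mpr h8
      have := (Finset.sum_eq_zero_iff.mp h6) i hi
      have h9 := c.one_le_blocksFun i
      omega
    have h8 := congrArg Finset.card h7
    rw [Finset.card_erase_of_mem (Finset.mem_univ _), Finset.card_univ, Fintype.card_fin] at h8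
    have := j.2
    simp at h8
    omega
  · intro h
    have := h ⟨0, by simp⟩
    rw [Composition.single_blocksFun] at this
    omega

theorem normFactor_succ (n : ℕ) :
    normFactor 𝕜 (n + 1) = (n.factorial : 𝕜) / ((2 * n).factorial : 𝕜) := by
  simp [normFactor]

/-- `S̄_{n+1}` is a multiple of `∑_{1 ≤ i ≤ n} g_i Ψ_{i+1,n+1}`, where `∑ ε^i g_i` is the expansion
of `G'(z₀(ε))`. -/
theorem nextSb_eq_sum_compCoeff (G : B → B') (z : ℕ → B) (Sb : ℕ → B →L[𝕜] B')
    (T : ℕ → B' →L[𝕜] B) {n : ℕ} (hn : 1 ≤ n) :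
    normFactor 𝕜 (n + 1) • nextSb G z Sb T n = ∑ i ∈ Finset.Icc 1 n,
      compCoeff (𝕜 := 𝕜) (fderiv 𝕜 G) z i ∘L chainCoeff Sb T (i + 1) (n + 1) := by
  have hfac := fun m => natCast_factorial_ne_zero (𝕜 := 𝕜) m
  rw [nextSb_eq Sb T hn, normFactor_succ, ← Finset.Ico_add_one_right_eq_Icc,
    Finset.sum_Ico_succ_top hn, Finset.sum_Ico_succ_top hn, smul_add, smul_add, add_assoc]
  congr 1
  · rw [Finset.smul_sum]
    refine Finset.sum_congr rfl fun i hi => ?_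
    rw [Finset.mem_Ico] at hi
    rw [W_eq_of_lt G z hi.2, ContinuousLinearMap.smul_comp, smul_smul, smul_smul]
    have h1 := hfac n
    have h2 := hfac (2 * n)
    have h3 := hfac (2 * n - i)
    rw [show ((n.factorial : 𝕜) / ((2 * n).factorial : 𝕜)) * (((2 * n - i).factorial : 𝕜) /
      (n.factorial : 𝕜)) * (((2 * n).factorial : 𝕜) / ((2 * n - i).factorial : 𝕜)) = 1 by
        field_simp, one_smul]
  · have e : 2 * n - n = n := by omega
    rw [e, W_eq_self G z hn, chainCoeff_self Sb T (by omega), ContinuousLinearMap.comp_id,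
      ContinuousLinearMap.comp_id]
    have h1 := hfac n
    have h2 := hfac (2 * n)
    rw [div_self h1, one_smul, smul_smul, smul_smul,
      show ((n.factorial : 𝕜) / ((2 * n).factorial : 𝕜)) * (((2 * n).factorial : 𝕜) /
        (n.factorial : 𝕜)) = 1 by field_simp,
      show ((n.factorial : 𝕜) / ((2 * n).factorial : 𝕜)) * (((2 * n).factorial : 𝕜) /
        (n.factorial : 𝕜) ^ 2) = (n.factorial : 𝕜)⁻¹ by field_simp, one_smul]
    abel

end Recursion

end

end KTransversal

/-! ### Cancellation of the lower powers of ε along the chains. -/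

namespace KTransversal

noncomputable section

/-- The substitution r = s + m, which collects the products of ε^m g_m and ε^{j-r} Ψ_{r,j} by their
common power ε^{j-s}. -/
theorem sum_Icc_ite_lt_eq {M : Type*} [AddCommMonoid M] {j m : ℕ} {f : ℕ → M}
    (hf : ∀ r, j < r → f r = 0) :
    ∑ r ∈ Finset.Icc 1 j, (if m < r then f r else 0) = ∑ s ∈ Finset.Icc 1 j, f (s + m) := by
  have h1 : ∑ s ∈ Finset.Icc 1 j, f (s + m) = ∑ r ∈ Finset.Icc (1 + m) (j + m), f r := by
    rw [← Finset.Ico_add_one_right_eq_Icc, ← Finset.Ico_add_one_right_eq_Icc,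
      Finset.sum_Ico_add' f 1 (j + 1) m]
    congr 2
    omega
  rw [h1, ← Finset.sum_filter]
  refine Finset.sum_subset (fun r hr => ?_) fun r hr hr' => ?_
  · simp only [Finset.mem_filter, Finset.mem_Icc] at *
    omega
  · refine hf r ?_
    simp only [Finset.mem_filter, Finset.mem_Icc, not_and, not_lt] at *
    by_contra h
    have := hr' ⟨by omega, by omega⟩
    omega

section ChainEstimates

variable {𝕜 B B' : Type*} [RCLike 𝕜] [NormedAddCommGroup B] [NormedSpace 𝕜 B]
  [NormedAddCommGroup B'] [NormedSpace 𝕜 B']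

theorem norm_chain_le (Sb : ℕ → B →L[𝕜] B') (T : ℕ → B' →L[𝕜] B) (i : ℕ) :
    ∃ C, 0 < C ∧ ∀ ε : 𝕜, ‖ε‖ ≤ 1 → ‖chain Sb T i ε‖ ≤ C := by
  refine ⟨∑ r ∈ Finset.Icc 1 i, ‖chainCoeff Sb T r i‖ + 1, by positivity, fun ε hε => ?_⟩
  refine (norm_sum_le _ _).trans ((Finset.sum_le_sum fun r _ => ?_).trans
    (le_add_of_nonneg_right zero_le_one))
  rw [norm_smul, norm_pow]
  exact mul_le_of_le_one_left (norm_nonneg _) (pow_le_one₀ (norm_nonneg _) hε)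

namespace Resolution.IsFineResolution

variable [CompleteSpace B] [CompleteSpace B'] {D : Resolution 𝕜 B B'} {G : B → B'} {z : ℕ → B} {k l : ℕ}

/-- The left side is the coefficient of ε^{j-s} in G'(z₀(ε)) Φ_j(ε) x, s ≥ 1, so all powers below
j-1 cancel. Truncation at m ≤ k is harmless because Ψ_{s+m,j} = 0 for s + m > j. The chain recursion
lowers both s and j, and E_{v,j} x lies in N_{v-1}, where the induction hypothesis applies. -/
theorem sum_compCoeff_chainCoeff (hD : D.IsFineResolution G z k l) : ∀ {j : ℕ}, 1 ≤ j →
    j ≤ k + 1 → ∀ x ∈ D.N (j - 1), ∀ s, 1 ≤ s →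
    ∑ m ∈ Finset.range (k + 1), compCoeff (𝕜 := 𝕜) (fderiv 𝕜 G) z m
      (chainCoeff D.Sb D.T (s + m) j x) = if s = 1 then normFactor 𝕜 j • D.Sb j x else 0 := by
  intro j
  induction j using Nat.strong_induction_on with
  | _ j ih =>
    intro hj hjk x hx s hs
    rcases Nat.eq_or_lt_of_le hj with rfl | hj2
    · rw [Finset.sum_range_succ']
      have : ∀ m, chainCoeff D.Sb D.T (s + (m + 1)) 1 = 0 := fun m =>
        chainCoeff_succ_one _ _ (by omega)
      simp only [this, zero_apply, map_zero, Finset.sum_const_zero, zero_add,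
        add_zero]
      split_ifs with h
      · subst h
        rw [chainCoeff_self _ _ le_rfl, compCoeff_zero, hD.Sb_one]
        simp [normFactor]
      · rw [chainCoeff_succ_one _ _ (by omega)]
        simp
    · obtain ⟨j, rfl⟩ : ∃ i, j = i + 1 := ⟨j - 1, by omega⟩
      rw [Nat.add_sub_cancel] at hx
      split_ifs with h
      -- s = 1 is the definition of S̄_{j+1}: the term m = 0 vanishes because Ψ_{1,j+1} = 0, and
      -- terms with m > j vanish by triangularity.
      · subst h
        rw [hD.Sb_succ j (by omega) (by omega)]
        have := DFunLike.congr_fun (nextSb_eq_sum_compCoeff G z D.Sb D.T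
          (show 1 ≤ j by omega)) x
        rw [smul_apply, sum_apply] at this
        rw [this]
        symm
        refine (Finset.sum_subset (s₂ := Finset.range (k + 1)) (fun i hi => ?_)
          fun i hi hi' => ?_).trans (Finset.sum_congr rfl fun m _ => ?_)
        · rw [Finset.mem_Icc] at hi
          rw [Finset.mem_range]
          omega
        · rw [Finset.mem_Icc] at hi'
          rcases Nat.eq_zero_or_pos i with rfl | hi0
          · rw [chainCoeff_one _ _ (by omega)]
            simp
          · rw [chainCoeff_of_lt _ _ (by omega) (by omega)]
            simp
        · rw [add_comm]
          rfl
      -- s ≥ 2: one step of the chain recursion reduces to s - 1 for the vectors E_{v,j} x.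
      · obtain ⟨s, rfl⟩ : ∃ t, s = t + 1 := ⟨s - 1, by omega⟩
        have h1 : ∀ m, compCoeff (𝕜 := 𝕜) (fderiv 𝕜 G) z m
            (chainCoeff D.Sb D.T (s + 1 + m) (j + 1) x) = ∑ v ∈ Finset.Icc 1 j,
            (normFactor 𝕜 j / normFactor 𝕜 v) • compCoeff (𝕜 := 𝕜) (fderiv 𝕜 G) z m
            (chainCoeff D.Sb D.T (s + m) v (E D.Sb D.T v j x)) := by
          intro m
          rw [add_right_comm, chainCoeff_succ_succ _ _ (by omega) le_rfl, sum_apply, map_sum]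
          refine Finset.sum_congr rfl fun v _ => ?_
          rw [smul_apply, map_smul]
          rfl
        simp only [h1]
        rw [Finset.sum_comm]
        have h2 : ∀ v ∈ Finset.Icc 1 j, ∑ m ∈ Finset.range (k + 1),
            (normFactor 𝕜 j / normFactor 𝕜 v) • compCoeff (𝕜 := 𝕜) (fderiv 𝕜 G) z m
            (chainCoeff D.Sb D.T (s + m) v (E D.Sb D.T v j x)) =
            if s = 1 then normFactor 𝕜 j • D.Sb v (E D.Sb D.T v j x) else 0 := by
          intro v hv
          rw [Finset.mem_Icc] at hv
          rw [← Finset.smul_sum, ih v (by omega) hv.1 (by omega) _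
            (hD.E_mem_N hv.1 hv.2 (by omega) hx) s (by omega)]
          split_ifs with h3
          · rw [smul_smul, div_mul_cancel₀ _ (normFactor_ne_zero v)]
          · rw [smul_zero]
        rw [Finset.sum_congr rfl h2]
        split_ifs with h3
        -- For s - 1 = 1 the contributions S̄_v E_{v,j} x are non-zero individually in general, but
        -- add up to 0 since x lies in N_j.
        · rw [← Finset.smul_sum, hD.sum_Sb_E_eq_zero (by omega) (by omega) hx, smul_zero]
        · simp

/-- Terms with r > m are those of the cancellation lemma and leave only the power ε^{j-1}; those
with r ≤ m have exponent m + j - r ≥ j and form the remainder. -/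
theorem sum_pow_smul_compCoeff_chain (hD : D.IsFineResolution G z k l) {j : ℕ} (hj : 1 ≤ j)
    (hjk : j ≤ k + 1) {x : B} (hx : x ∈ D.N (j - 1)) (ε : 𝕜) :
    ∑ m ∈ Finset.range (k + 1), ε ^ m • compCoeff (𝕜 := 𝕜) (fderiv 𝕜 G) z m
      (chain D.Sb D.T j ε x) = ε ^ (j - 1) • normFactor 𝕜 j • D.Sb j x +
      ∑ m ∈ Finset.range (k + 1), ∑ r ∈ Finset.Icc 1 j, if m < r then 0 else
        ε ^ (m + j - r) • compCoeff (𝕜 := 𝕜) (fderiv 𝕜 G) z m (chainCoeff D.Sb D.T r j x) := by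
  have h1 : ∀ m, ε ^ m • compCoeff (𝕜 := 𝕜) (fderiv 𝕜 G) z m (chain D.Sb D.T j ε x) =
      ∑ s ∈ Finset.Icc 1 j, ε ^ (j - s) • compCoeff (𝕜 := 𝕜) (fderiv 𝕜 G) z m
        (chainCoeff D.Sb D.T (s + m) j x) +
      ∑ r ∈ Finset.Icc 1 j, if m < r then 0 else
        ε ^ (m + j - r) • compCoeff (𝕜 := 𝕜) (fderiv 𝕜 G) z m (chainCoeff D.Sb D.T r j x) := by
    intro m
    have h2 := sum_Icc_ite_lt_eq (j := j) (m := m) (f := fun r => ε ^ (j - (r - m)) •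
      compCoeff (𝕜 := 𝕜) (fderiv 𝕜 G) z m (chainCoeff D.Sb D.T r j x)) (fun r hr => by
        rw [chainCoeff_of_lt _ _ hr hj]; simp)
    simp only [Nat.add_sub_cancel] at h2
    rw [← h2, ← Finset.sum_add_distrib, chain, sum_apply, map_sum, Finset.smul_sum]
    refine Finset.sum_congr rfl fun r hr => ?_
    rw [Finset.mem_Icc] at hr
    rw [smul_apply, map_smul, smul_smul, ← pow_add]
    split_ifs with h
    · rw [add_zero]
      congr 2
      omega
    · rw [zero_add]
      congr 2
      omega
  rw [Finset.sum_congr rfl fun m _ => h1 m, Finset.sum_add_distrib, Finset.sum_comm]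
  congr 1
  have h3 : ∀ s ∈ Finset.Icc 1 j, ∑ m ∈ Finset.range (k + 1), ε ^ (j - s) •
      compCoeff (𝕜 := 𝕜) (fderiv 𝕜 G) z m (chainCoeff D.Sb D.T (s + m) j x) =
      if s = 1 then ε ^ (j - 1) • normFactor 𝕜 j • D.Sb j x else 0 := by
    intro s hs
    rw [← Finset.smul_sum, hD.sum_compCoeff_chainCoeff hj hjk x hx s (Finset.mem_Icc.mp hs).1]
    split_ifs with h
    · rw [h]
    · rw [smul_zero]
  rw [Finset.sum_congr rfl h3, Finset.sum_ite_eq' , if_pos (Finset.mem_Icc.mpr ⟨le_rfl, hj⟩)]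

end Resolution.IsFineResolution

variable [CompleteSpace B] [CompleteSpace B'] {D : Resolution 𝕜 B B'} {G : B → B'}
  {z₀ : 𝕜 → B} {k l : ℕ}

/-- Along the curve `z₀`, the derivative of `G` maps the `j`-th chain to `ε^{j-1} S̄_j` up to a
factor and terms of order `j`. -/
theorem Resolution.IsFineResolution.norm_fderiv_chain_sub_le
    (hD : D.IsFineResolution G (coeff z₀) k l)
    (hG : ContDiffAt 𝕜 (k + 2 : ℕ) G 0) (hz : ContDiffAt 𝕜 (k + 1 : ℕ) z₀ 0) (hz0 : z₀ 0 = 0)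
    {j : ℕ} (hj : 1 ≤ j) (hjk : j ≤ k + 1) :
    ∃ C, 0 < C ∧ ∀ᶠ ε in 𝓝 (0 : 𝕜), ∀ x ∈ D.N (j - 1),
      ‖fderiv 𝕜 G (z₀ ε) (chain D.Sb D.T j ε x) - ε ^ (j - 1) • normFactor 𝕜 j • D.Sb j x‖ ≤
        C * ‖ε‖ ^ j * ‖x‖ := by
  obtain ⟨C₁, hC₁, h₁⟩ := (comp_taylor_isBigO (hG.fderiv_right (m := (k + 1 : ℕ)) (by
    norm_cast)) hz hz0).exists_pos
  obtain ⟨C₂, hC₂, h₂⟩ := norm_chain_le D.Sb D.T j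
  set C₃ : ℝ := ∑ m ∈ Finset.range (k + 1), ∑ r ∈ Finset.Icc 1 j,
    ‖compCoeff (𝕜 := 𝕜) (fderiv 𝕜 G) (coeff z₀) m‖ * ‖chainCoeff D.Sb D.T r j‖ with hC₃
  have hC₃0 : 0 ≤ C₃ := by positivity
  refine ⟨C₁ * C₂ + C₃, by positivity, ?_⟩
  filter_upwards [h₁.bound, Metric.ball_mem_nhds (0 : 𝕜) one_pos] with ε hε hε1 x hx
  rw [mem_ball_zero_iff] at hε1
  set S := ∑ m ∈ Finset.range (k + 1),
      ε ^ m • compCoeff (𝕜 := 𝕜) (fderiv 𝕜 G) (coeff z₀) m with hS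
  have hε' : ‖fderiv 𝕜 G (z₀ ε) - S‖ ≤ C₁ * ‖ε‖ ^ (k + 1) := by
    rw [Real.norm_of_nonneg (by positivity)] at hε
    exact hε
  have e1 : fderiv 𝕜 G (z₀ ε) (chain D.Sb D.T j ε x) - ε ^ (j - 1) • normFactor 𝕜 j • D.Sb j x =
      (fderiv 𝕜 G (z₀ ε) - S) (chain D.Sb D.T j ε x) +
      ∑ m ∈ Finset.range (k + 1), ∑ r ∈ Finset.Icc 1 j, if m < r then 0 else
        ε ^ (m + j - r) • compCoeff (𝕜 := 𝕜) (fderiv 𝕜 G) (coeff z₀) m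
          (chainCoeff D.Sb D.T r j x) := by
    have := hD.sum_pow_smul_compCoeff_chain hj hjk hx ε
    rw [sub_apply, hS, sum_apply]
    simp only [smul_apply]
    rw [this]
    abel
  rw [e1]
  have hp : ∀ {a : ℕ}, j ≤ a → ‖ε‖ ^ a ≤ ‖ε‖ ^ j := fun ha =>
    pow_le_pow_of_le_one (norm_nonneg _) hε1.le ha
  calc _ ≤ C₁ * ‖ε‖ ^ (k + 1) * (C₂ * ‖x‖) + C₃ * ‖ε‖ ^ j * ‖x‖ := by
        refine (norm_add_le _ _).trans (add_le_add ?_ ?_)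
        · refine (ContinuousLinearMap.le_opNorm _ _).trans ?_
          refine mul_le_mul hε' ((ContinuousLinearMap.le_opNorm _ _).trans ?_) (norm_nonneg _)
            (by positivity)
          exact mul_le_mul_of_nonneg_right (h₂ ε hε1.le) (norm_nonneg _)
        · rw [hC₃, Finset.sum_mul, Finset.sum_mul]
          refine (norm_sum_le _ _).trans (Finset.sum_le_sum fun m _ => ?_)
          rw [Finset.sum_mul, Finset.sum_mul]
          refine (norm_sum_le _ _).trans (Finset.sum_le_sum fun r hr => ?_)
          split_ifs with h
          · rw [norm_zero]; positivity
          · rw [norm_smul, norm_pow]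
            calc _ ≤ ‖ε‖ ^ j * (‖compCoeff (𝕜 := 𝕜) (fderiv 𝕜 G) (coeff z₀) m‖ *
                  (‖chainCoeff D.Sb D.T r j‖ * ‖x‖)) := by
                    refine mul_le_mul (hp (by omega)) ((ContinuousLinearMap.le_opNorm _ _).trans
                      ?_) (norm_nonneg _) (by positivity)
                    exact mul_le_mul_of_nonneg_left (ContinuousLinearMap.le_opNorm _ _)
                      (norm_nonneg _)
              _ = _ := by ring
    -- The Taylor remainder of order k+1 is admissible because j ≤ k+1.
    _ ≤ C₁ * ‖ε‖ ^ j * (C₂ * ‖x‖) + C₃ * ‖ε‖ ^ j * ‖x‖ := by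
        gcongr ?_ + _
        refine mul_le_mul_of_nonneg_right (mul_le_mul_of_nonneg_left (hp hjk) hC₁.le)
          (by positivity)
    _ = _ := by ring

end ChainEstimates

end

end KTransversal

namespace KTransversal

set_option linter.unusedSectionVars false

noncomputable section

/-! ### A_ε and L̂ as continuous operators and as isomorphisms. -/

section Diagonal

variable {𝕜 : Type*} [RCLike 𝕜] {ι : Type*} {V : ι → Type*}
  [∀ j, NormedAddCommGroup (V j)] [∀ j, NormedSpace 𝕜 (V j)]

/-- Componentwise multiplication by the scalars `a j`. -/
def diagL (a : ι → 𝕜) : (∀ j, V j) →L[𝕜] ∀ j, V j :=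
  ContinuousLinearMap.pi fun j => a j • ContinuousLinearMap.proj j

@[simp] theorem diagL_apply (a : ι → 𝕜) (n : ∀ j, V j) (j : ι) :
    (diagL a n : ∀ j, V j) j = a j • n j := rfl

/-- Componentwise multiplication by non-zero scalars. -/
def diagEquiv (a : ι → 𝕜) (ha : ∀ j, a j ≠ 0) : (∀ j, V j) ≃L[𝕜] ∀ j, V j :=
  ContinuousLinearEquiv.equivOfInverse (diagL a) (diagL fun j => (a j)⁻¹)
    (fun n => by ext j; simp [smul_smul, ha j]) (fun n => by ext j; simp [smul_smul, ha j])

end Diagonal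

namespace Resolution

section Operators

variable {𝕜 B B' : Type*} [RCLike 𝕜] [NormedAddCommGroup B] [NormedSpace 𝕜 B]
  [NormedAddCommGroup B'] [NormedSpace 𝕜 B']

/-- The factorials of M̂ compensate the row weights ε^{2k+2-r}/(2k+2-r)!, so the i-th column is one
scalar times the i-th chain. -/
theorem Acomp_eq (D : Resolution 𝕜 B B') {k i : ℕ} (hi : 1 ≤ i) (hik : i ≤ k + 1) (ε : 𝕜) :
    D.Acomp k ε i = (ε ^ (2 * k + 2 - i) / ((2 * k + 2 - i).factorial : 𝕜)) •
      chain D.Sb D.T i ε := by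
  rw [Acomp, chain, Finset.smul_sum]
  symm
  refine (Finset.sum_congr rfl fun r hr => ?_).trans
    (Finset.sum_subset (Finset.Icc_subset_Icc_right hik) fun r hr hr' => ?_)
  · rw [Finset.mem_Icc] at hr
    rw [Mhat_eq D.Sb D.T hr.1 (by omega) hi hik, smul_smul, smul_smul]
    congr 1
    have h1 := natCast_factorial_ne_zero (𝕜 := 𝕜) (2 * k + 2 - r)
    have h2 := natCast_factorial_ne_zero (𝕜 := 𝕜) (2 * k + 2 - i)
    have e : 2 * k + 2 - r = (2 * k + 2 - i) + (i - r) := by omega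
    have e2 : ε ^ (2 * k + 2 - r) = ε ^ (2 * k + 2 - i) * ε ^ (i - r) := by rw [e, pow_add]
    rw [e2]
    field_simp
  · rw [Finset.mem_Icc] at hr hr'
    rw [Mhat_eq D.Sb D.T hr.1 hr.2 hi hik, chainCoeff_of_lt _ _ (by omega) hi, smul_zero,
      smul_zero]

/-- The sum of the chains `Φ_{j+1}(ε)` as an operator on `N_1^c × ⋯ × N_{k+1}^c`. -/
def chainSum (D : Resolution 𝕜 B B') (k : ℕ) (ε : 𝕜) : D.NcProd k →L[𝕜] B :=
  ∑ j : Fin (k + 1), chain D.Sb D.T (j.val + 1) ε ∘L (D.Nc (j.val + 1)).subtypeL ∘L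
    ContinuousLinearMap.proj j

theorem chainSum_apply (D : Resolution 𝕜 B B') (k : ℕ) (ε : 𝕜) (n : D.NcProd k) :
    D.chainSum k ε n = ∑ j : Fin (k + 1), chain D.Sb D.T (j.val + 1) ε (n j) := by
  simp [chainSum]

variable (𝕜) in
/-- The scalars relating `A_ε` to the sum of the chains. -/
def scale (k : ℕ) (ε : 𝕜) (j : Fin (k + 1)) : 𝕜 :=
  ε ^ (2 * k + 1 - j.val) / ((2 * k + 1 - j.val).factorial : 𝕜)

/-- `A_ε` as a continuous linear operator. -/
def AL (D : Resolution 𝕜 B B') (k : ℕ) (ε : 𝕜) : D.NcProd k →L[𝕜] B :=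
  D.chainSum k ε ∘L diagL (scale 𝕜 k ε)

theorem AL_apply (D : Resolution 𝕜 B B') (k : ℕ) (ε : 𝕜) (n : D.NcProd k) :
    D.AL k ε n = D.A k ε n := by
  rw [AL, ContinuousLinearMap.comp_apply, chainSum_apply, A]
  refine Finset.sum_congr rfl fun j _ => ?_
  have := j.2
  rw [D.Acomp_eq (by omega) (by omega), diagL_apply, Submodule.coe_smul, map_smul, smul_apply,
    scale]
  have e : 2 * k + 2 - (j.val + 1) = 2 * k + 1 - j.val := by omega
  rw [e]

/-- The operator `L̂_{k+1}` as a continuous linear operator. -/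
def LhatL (D : Resolution 𝕜 B B') (k : ℕ) : D.NcProd k →L[𝕜] B' :=
  ∑ j : Fin (k + 1), (normFactor 𝕜 (j.val + 1) / ((2 * k + 1 - j.val).factorial : 𝕜)) •
    (D.Sb (j.val + 1) ∘L (D.Nc (j.val + 1)).subtypeL ∘L ContinuousLinearMap.proj j)

theorem LhatL_apply' (D : Resolution 𝕜 B B') (k : ℕ) (n : D.NcProd k) :
    D.LhatL k n = ∑ j : Fin (k + 1),
      (normFactor 𝕜 (j.val + 1) / ((2 * k + 1 - j.val).factorial : 𝕜)) •
        D.Sb (j.val + 1) (n j) := by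
  simp [LhatL]

theorem LhatL_apply (D : Resolution 𝕜 B B') (k : ℕ) (n : D.NcProd k) :
    D.LhatL k n = D.Lhat k n := by
  rw [LhatL_apply', Lhat]
  refine Finset.sum_congr rfl fun j _ => ?_
  have := j.2
  rw [c_eq (𝕜 := 𝕜) (m := 2 * k + 1) (i := j.val + 1) (by omega) (by omega)]
  congr 1
  have e : 2 * k + 1 + 1 - (j.val + 1) = 2 * k + 1 - j.val := by omega
  rw [e]
  have h1 := natCast_factorial_ne_zero (𝕜 := 𝕜) (2 * k + 1)
  field_simp

theorem contDiff_chain {n : WithTop ℕ∞} (D : Resolution 𝕜 B B') (i : ℕ) :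
    ContDiff 𝕜 n (chain D.Sb D.T i) := by
  unfold chain
  fun_prop

theorem contDiff_chainSum {n : WithTop ℕ∞} (D : Resolution 𝕜 B B') (k : ℕ) :
    ContDiff 𝕜 n (D.chainSum k) := by
  unfold chainSum
  refine ContDiff.sum fun j _ => ?_
  exact (D.contDiff_chain _).clm_comp contDiff_const

theorem contDiff_AL {n : WithTop ℕ∞} (D : Resolution 𝕜 B B') (k : ℕ) :
    ContDiff 𝕜 n (D.AL k) := by
  unfold AL
  refine (D.contDiff_chainSum k).clm_comp ?_
  -- As a finite sum of scalars times fixed operators, the smoothness in operator norm reduces to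
  -- that of the scalars.
  have : (fun ε : 𝕜 => (diagL (scale 𝕜 k ε) : D.NcProd k →L[𝕜] D.NcProd k)) = fun ε =>
      ∑ j : Fin (k + 1), scale 𝕜 k ε j • (ContinuousLinearMap.single 𝕜 _ j ∘L
        ContinuousLinearMap.proj j) := by
    funext ε
    refine ContinuousLinearMap.ext fun n => ?_
    funext i
    simp only [diagL_apply, sum_apply, smul_apply, Finset.sum_apply, Pi.smul_apply,
      ContinuousLinearMap.comp_apply, ContinuousLinearMap.proj_apply,
      ContinuousLinearMap.single_apply]
    rw [Finset.sum_eq_single i]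
    · simp
    · intro j _ hj
      rw [Pi.single_eq_of_ne hj.symm, smul_zero]
    · simp
  rw [this]
  refine ContDiff.sum fun j _ => ContDiff.fun_smul ?_ contDiff_const
  unfold scale
  fun_prop

theorem contDiff_Acomp {n : WithTop ℕ∞} (D : Resolution 𝕜 B B') (k i : ℕ) :
    ContDiff 𝕜 n fun ε => D.Acomp k ε i := by
  unfold Acomp
  refine ContDiff.sum fun r _ => ContDiff.fun_smul ?_ contDiff_const
  fun_prop

end Operators

namespace IsFineResolution

variable {𝕜 B B' : Type*} [RCLike 𝕜] [NormedAddCommGroup B] [NormedSpace 𝕜 B]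
  [NormedAddCommGroup B'] [NormedSpace 𝕜 B']
  [CompleteSpace B] [CompleteSpace B'] {D : Resolution 𝕜 B B'} {G : B → B'} {z : ℕ → B}
  {k l : ℕ}

theorem chain_sub_mem (hD : D.IsFineResolution G z k l) {i : ℕ} (hi : 1 ≤ i) (hik : i ≤ k + 1)
    (ε : 𝕜) (x : B) : chain D.Sb D.T i ε x - x ∈ D.NcPartial (i - 1) := by
  obtain ⟨i, rfl⟩ : ∃ s, i = s + 1 := ⟨i - 1, by omega⟩
  rw [chain, ← Finset.Ico_add_one_right_eq_Icc, Finset.sum_Ico_succ_top (by omega),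
    chainCoeff_self _ _ (by omega)]
  simp only [Nat.sub_self, pow_zero, one_smul, add_apply, ContinuousLinearMap.id_apply,
    add_sub_cancel_right, sum_apply]
  refine Submodule.sum_mem _ fun r hr => ?_
  rw [Finset.mem_Ico] at hr
  exact Submodule.smul_mem _ _ (hD.chainCoeff_mem hr.2 hik x)

theorem chain_mem (hD : D.IsFineResolution G z k l) {i : ℕ} (hi : 1 ≤ i) (hik : i ≤ k + 1)
    (ε : 𝕜) {x : B} (hx : x ∈ D.Nc i) : chain D.Sb D.T i ε x ∈ D.NcPartial i := by
  rw [← sub_add_cancel (chain D.Sb D.T i ε x) x]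
  exact Submodule.add_mem _ (D.NcPartial_mono (by omega) (hD.chain_sub_mem hi hik ε x))
    (D.Nc_le_NcPartial hi le_rfl hx)

theorem completeSpace_Nc (hD : D.IsFineResolution G z k l) (j : Fin (k + 1)) :
    CompleteSpace (D.Nc (j.val + 1)) :=
  (hD.isClosed_Nc _ (by omega) (by omega)).completeSpace_coe

theorem completeSpace_NcProd (hD : D.IsFineResolution G z k l) : CompleteSpace (D.NcProd k) := by
  have := hD.completeSpace_Nc
  infer_instance

theorem isTopCompl_NcSum (hD : D.IsFineResolution G z k l) :
    Submodule.IsTopCompl (D.N (k + 1)) (D.NcSum k) := by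
  rw [NcSum_eq]
  exact hD.isTopCompl_N le_rfl

theorem completeSpace_NcSum (hD : D.IsFineResolution G z k l) : CompleteSpace (D.NcSum k) :=
  (hD.isTopCompl_NcSum.isClosed').completeSpace_coe

theorem completeSpace_P (hD : D.IsFineResolution G z k l) : CompleteSpace D.P :=
  hD.isClosed_P.completeSpace_coe

theorem P_le (hD : D.IsFineResolution G z k l) : D.P ≤ D.N (k + 1) := by
  obtain ⟨w, _, _, _, h⟩ := hD.exists_line
  rw [← h]
  exact le_sup_left

/-- The chains are unitriangular for the filtration N_1^c ⊕ … ⊕ N_j^c, and the open mapping theorem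
gives continuity of the inverse. In contrast to A_ε this holds at ε = 0 too, which the determinant
formula needs. -/
theorem exists_chainEquiv (hD : D.IsFineResolution G z k l) (ε : 𝕜) :
    ∃ e : D.NcProd k ≃L[𝕜] D.NcSum k, ∀ n, (e n : B) = D.chainSum k ε n := by
  have := hD.completeSpace_NcProd
  have := hD.completeSpace_NcSum
  set t : ∀ j : Fin (k + 1), D.Nc (j.val + 1) →ₗ[𝕜] B := fun j =>
    (chain D.Sb D.T (j.val + 1) ε).toLinearMap ∘ₗ (D.Nc (j.val + 1)).subtype with ht
  have hts : ∀ n, D.chainSum k ε n = ∑ j, t j (n j) := fun n => by rw [chainSum_apply]; rfl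
  have h1 : ∀ (j : Fin (k + 1)) v, t j v ∈ D.NcPartial (j + 1) := fun j v =>
    hD.chain_mem (by omega) (by omega) ε v.2
  have h2 : ∀ (j : Fin (k + 1)) v, t j v ∈ D.NcPartial j → v = 0 := by
    intro j v hv
    have hs := hD.chain_sub_mem (i := j.val + 1) (by omega) (by omega) ε v
    have hv' : (v : B) ∈ D.NcPartial j := by
      have := Submodule.sub_mem _ hv hs
      simpa [ht] using this
    have := Submodule.disjoint_def.1 (hD.isTopCompl_N (i := j) (by omega)).isCompl.disjoint v
      (hD.Nc_le (by omega) v.2) hv'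
    exact Subtype.ext this
  have h3 : ∀ j : Fin (k + 1), D.NcPartial (j + 1) ≤ D.NcPartial j ⊔ LinearMap.range (t j) := by
    intro j
    refine sup_le le_sup_left fun v hv => ?_
    have hs := hD.chain_sub_mem (i := j.val + 1) (by omega) (by omega) ε v
    rw [← sub_sub_cancel (chain D.Sb D.T (j.val + 1) ε v) v]
    exact Submodule.sub_mem _ (Submodule.mem_sup_right ⟨⟨v, hv⟩, rfl⟩)
      (Submodule.mem_sup_left hs)
  have hmem : ∀ n, D.chainSum k ε n ∈ D.NcSum k := by
    intro n
    rw [hts, NcSum_eq]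
    exact Submodule.sum_mem _ fun j _ => D.NcPartial_mono (by omega) (h1 j _)
  refine ⟨ContinuousLinearEquiv.ofBijective ((D.chainSum k ε).codRestrict _ hmem) ?_ ?_,
    fun n => rfl⟩
  · rw [LinearMap.ker_eq_bot']
    intro n hn
    refine injective_sum_of_triangular D.NcPartial_mono h1 h2 ?_
    rw [← hts]
    exact congrArg Subtype.val hn
  · rw [LinearMap.range_eq_top]
    intro x
    have hx : (x : B) ∈ D.NcPartial (k + 1) := by
      rw [← NcSum_eq]
      exact x.2
    obtain ⟨n, hn⟩ := exists_sum_eq_of_triangular rfl h3 hx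
    refine ⟨n, Subtype.ext ?_⟩
    rw [← hn, ← hts]
    rfl

theorem scale_ne_zero {ε : 𝕜} (hε : ε ≠ 0) (j : Fin (k + 1)) : scale 𝕜 k ε j ≠ 0 :=
  div_ne_zero (pow_ne_zero _ hε) (natCast_factorial_ne_zero _)

theorem exists_AEquiv (hD : D.IsFineResolution G z k l) {ε : 𝕜} (hε : ε ≠ 0) :
    ∃ e : D.NcProd k ≃L[𝕜] D.NcSum k, ∀ n, (e n : B) = D.A k ε n := by
  obtain ⟨e, he⟩ := hD.exists_chainEquiv ε
  refine ⟨(diagEquiv _ (scale_ne_zero hε)).trans e, fun n => ?_⟩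
  rw [← AL_apply, AL, ContinuousLinearMap.comp_apply, ← he]
  rfl

/-- Triangularity on the side of B': modulo R_1 ⊕ … ⊕ R_j the operator S̄_{j+1} is S_{j+1}, which
maps N_{j+1}^c bijectively onto R_{j+1}. Transversality says that the filtration exhausts B'. -/
theorem exists_LhatEquiv (hD : D.IsFineResolution G z k l) (ht : D.IsTransversal k) :
    ∃ e : D.NcProd k ≃L[𝕜] B', ∀ n, e n = D.LhatL k n := by
  have := hD.completeSpace_NcProd
  rw [isTransversal_iff] at ht
  set a : Fin (k + 1) → 𝕜 := fun j =>
    normFactor 𝕜 (j.val + 1) / ((2 * k + 1 - j.val).factorial : 𝕜) with ha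
  have ha0 : ∀ j, a j ≠ 0 := fun j =>
    div_ne_zero (normFactor_ne_zero _) (natCast_factorial_ne_zero _)
  set t : ∀ j : Fin (k + 1), D.Nc (j.val + 1) →ₗ[𝕜] B' := fun j =>
    a j • (D.Sb (j.val + 1)).toLinearMap ∘ₗ (D.Nc (j.val + 1)).subtype with ht'
  have hts : ∀ n, D.LhatL k n = ∑ j, t j (n j) := fun n => by rw [LhatL_apply']; rfl
  have hSmem : ∀ (j : Fin (k + 1)) (v : D.Nc (j.val + 1)), D.S (j.val + 1) v ∈ D.R (j.val + 1) :=
    fun j v => D.S_mem_R (hD.Nc_le (by omega) v.2)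
  have h1 : ∀ (j : Fin (k + 1)) v, t j v ∈ D.Rsum (j + 1) := by
    intro j v
    refine Submodule.smul_mem _ _ ?_
    have h := hD.Sb_sub_S_mem (i := j.val) (by omega) v
    rw [Rsum_succ]
    have := Submodule.add_mem_sup h (hSmem j v)
    rwa [sub_add_cancel] at this
  have h2 : ∀ (j : Fin (k + 1)) v, t j v ∈ D.Rsum j → v = 0 := by
    intro j v hv
    have hv' : D.Sb (j.val + 1) v ∈ D.Rsum j := (Submodule.smul_mem_iff _ (ha0 j)).1 hv
    have h := hD.Sb_sub_S_mem (i := j.val) (by omega) v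
    have hS : D.S (j.val + 1) v ∈ D.Rsum j := by
      have := Submodule.sub_mem _ hv' h
      rwa [sub_sub_cancel] at this
    have hS0 := Submodule.disjoint_def.1 (hD.isTopCompl_Rc (i := j) (by omega)).isCompl.disjoint _
      (hD.S_mem_Rc (by omega) v) hS
    exact Subtype.ext (hD.eq_zero_of_S_eq_zero (by omega) v.2 hS0)
  have h3 : ∀ j : Fin (k + 1), D.Rsum (j + 1) ≤ D.Rsum j ⊔ LinearMap.range (t j) := by
    intro j
    rw [Rsum_succ]
    refine sup_le le_sup_left fun y hy => ?_
    obtain ⟨x, hx, rfl⟩ := hD.exists_S_eq (by omega) hy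
    have hs := hD.Sb_sub_S_mem (i := j.val) (by omega) x
    rw [← sub_sub_cancel (D.Sb (j.val + 1) x) (D.S (j.val + 1) x)]
    refine Submodule.sub_mem _ (Submodule.mem_sup_right ⟨(a j)⁻¹ • ⟨x, hx⟩, ?_⟩)
      (Submodule.mem_sup_left hs)
    rw [map_smul]
    change (a j)⁻¹ • a j • D.Sb (j.val + 1) x = _
    rw [smul_smul, inv_mul_cancel₀ (ha0 j), one_smul]
  refine ⟨ContinuousLinearEquiv.ofBijective (D.LhatL k) ?_ ?_, fun n => rfl⟩
  · rw [LinearMap.ker_eq_bot']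
    intro n hn
    refine injective_sum_of_triangular D.Rsum_mono h1 h2 ?_
    rw [← hts]
    exact hn
  · rw [LinearMap.range_eq_top]
    intro x
    obtain ⟨n, hn⟩ := exists_sum_eq_of_triangular D.Rsum_zero h3 (x := x) (by
      rw [ht]; exact Submodule.mem_top)
    refine ⟨n, ?_⟩
    rw [← hn, ← hts]
    rfl

end IsFineResolution

end Resolution

end

end KTransversal

namespace KTransversal

set_option linter.unusedSectionVars false

noncomputable section

/-! ### The derivative of G composed with the displacement of the cone. -/

namespace Resolution

variable {𝕜 B B' : Type*} [RCLike 𝕜] [NormedAddCommGroup B] [NormedSpace 𝕜 B]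
  [NormedAddCommGroup B'] [NormedSpace 𝕜 B']

/-- The displacement `(n, p) ↦ A_ε n + A_ε^{k+1} p` of the cone. -/
def coneOp (D : Resolution 𝕜 B B') (k : ℕ) (ε : 𝕜) : D.NcProd k × D.P →L[𝕜] B :=
  D.AL k ε ∘L ContinuousLinearMap.fst 𝕜 _ _ +
    D.Acomp k ε (k + 1) ∘L D.P.subtypeL ∘L ContinuousLinearMap.snd 𝕜 _ _

/-- The leading coefficient of `G'[z₀(ε)]` composed with the displacement of the cone. -/
def coneLead (D : Resolution 𝕜 B B') (k : ℕ) : D.NcProd k × D.P →L[𝕜] B' :=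
  D.LhatL k ∘L ContinuousLinearMap.fst 𝕜 _ _ +
    (normFactor 𝕜 (k + 1) / ((k + 1).factorial : 𝕜)) •
      (D.Sb (k + 1) ∘L D.P.subtypeL ∘L ContinuousLinearMap.snd 𝕜 _ _)

theorem coneOp_apply (D : Resolution 𝕜 B B') (k : ℕ) (ε : 𝕜) (n : D.NcProd k) (p : D.P) :
    D.coneOp k ε (n, p) = D.A k ε n + D.Acomp k ε (k + 1) p := by
  rw [← AL_apply]
  rfl

theorem Z_eq (D : Resolution 𝕜 B B') (z₀ : 𝕜 → B) (k : ℕ) (ε : 𝕜) (n : D.NcProd k) (p : D.P) :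
    D.Z z₀ k ε n p = z₀ ε + D.coneOp k ε (n, p) := by
  rw [coneOp_apply, Z, add_assoc]

theorem contDiff_coneOp {n : WithTop ℕ∞} (D : Resolution 𝕜 B B') (k : ℕ) :
    ContDiff 𝕜 n (D.coneOp k) := by
  unfold coneOp
  exact ((D.contDiff_AL k).clm_comp contDiff_const).add
    ((D.contDiff_Acomp k (k + 1)).clm_comp contDiff_const)

theorem exists_norm_Acomp_le (D : Resolution 𝕜 B B') {k i : ℕ} (hi : 1 ≤ i) (hik : i ≤ k + 1) :
    ∃ C, 0 < C ∧ ∀ ε : 𝕜, ‖ε‖ ≤ 1 → ‖D.Acomp k ε i‖ ≤ C * ‖ε‖ ^ (2 * k + 2 - i) := by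
  obtain ⟨C, hC, h⟩ := norm_chain_le D.Sb D.T i
  refine ⟨C, hC, fun ε hε => ?_⟩
  rw [D.Acomp_eq hi hik, norm_smul, norm_div, norm_pow, RCLike.norm_natCast, mul_comm]
  refine mul_le_mul (h ε hε) (div_le_self (by positivity) ?_) (by positivity) hC.le
  exact_mod_cast (Nat.factorial_pos _)

theorem norm_AL_le (D : Resolution 𝕜 B B') (k : ℕ) :
    ∃ C, 0 < C ∧ ∀ ε : 𝕜, ‖ε‖ ≤ 1 → ‖D.AL k ε‖ ≤ C * ‖ε‖ ^ (k + 1) := by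
  choose C hC h using fun j : Fin (k + 1) => D.exists_norm_Acomp_le (k := k) (i := j.val + 1)
    (by omega) (by omega)
  have hS : 0 < ∑ j, C j := Finset.sum_pos (fun j _ => hC j) Finset.univ_nonempty
  refine ⟨∑ j, C j, hS, fun ε hε => ?_⟩
  refine ContinuousLinearMap.opNorm_le_bound _ (by positivity) fun n => ?_
  rw [AL_apply, A, Finset.sum_mul, Finset.sum_mul]
  refine (norm_sum_le _ _).trans (Finset.sum_le_sum fun j _ => ?_)
  refine (ContinuousLinearMap.le_opNorm _ _).trans ?_
  refine mul_le_mul ((h j ε hε).trans ?_) (norm_le_pi_norm n j) (norm_nonneg _)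
    (mul_nonneg (hC j).le (by positivity))
  exact mul_le_mul_of_nonneg_left (pow_le_pow_of_le_one (norm_nonneg _) hε (by omega)) (hC j).le

theorem norm_coneOp_le (D : Resolution 𝕜 B B') (k : ℕ) :
    ∃ C, 0 < C ∧ ∀ ε : 𝕜, ‖ε‖ ≤ 1 → ‖D.coneOp k ε‖ ≤ C * ‖ε‖ ^ (k + 1) := by
  obtain ⟨C₁, hC₁, h₁⟩ := D.norm_AL_le k
  obtain ⟨C₂, hC₂, h₂⟩ := D.exists_norm_Acomp_le (k := k) (i := k + 1) (by omega) le_rfl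
  refine ⟨C₁ + C₂, by positivity, fun ε hε => ?_⟩
  refine ContinuousLinearMap.opNorm_le_bound _ (by positivity) fun y => ?_
  obtain ⟨n, p⟩ := y
  rw [coneOp_apply, ← AL_apply]
  have h3 := h₂ ε hε
  rw [show 2 * k + 2 - (k + 1) = k + 1 by omega] at h3
  calc _ ≤ C₁ * ‖ε‖ ^ (k + 1) * ‖(n, p)‖ + C₂ * ‖ε‖ ^ (k + 1) * ‖(n, p)‖ := by
        refine (norm_add_le _ _).trans (add_le_add ?_ ?_)
        · exact (ContinuousLinearMap.le_opNorm _ _).trans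
            (mul_le_mul (h₁ ε hε) (norm_fst_le (n, p)) (norm_nonneg _) (by positivity))
        · exact (ContinuousLinearMap.le_opNorm _ _).trans
            (mul_le_mul h3 (norm_snd_le (n, p)) (norm_nonneg _) (by positivity))
    _ = _ := by ring

namespace IsFineResolution

variable [CompleteSpace B] [CompleteSpace B'] {D : Resolution 𝕜 B B'} {G : B → B'}
  {z₀ : 𝕜 → B} {k l : ℕ}

/-- The weight ε^{2k+2-j} of A^j and the damping ε^{j-1} multiply to ε^{2k+1} for every j: the
weights are chosen to balance the components. -/
theorem norm_fderiv_Acomp_sub_le (hD : D.IsFineResolution G (coeff z₀) k l)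
    (hG : ContDiffAt 𝕜 (k + 2 : ℕ) G 0) (hz : ContDiffAt 𝕜 (k + 1 : ℕ) z₀ 0) (hz0 : z₀ 0 = 0)
    {j : ℕ} (hj : 1 ≤ j) (hjk : j ≤ k + 1) :
    ∃ C, 0 < C ∧ ∀ᶠ ε in 𝓝 (0 : 𝕜), ∀ x ∈ D.N (j - 1),
      ‖fderiv 𝕜 G (z₀ ε) (D.Acomp k ε j x) - ε ^ (2 * k + 1) •
        (normFactor 𝕜 j / ((2 * k + 2 - j).factorial : 𝕜)) • D.Sb j x‖ ≤
        C * ‖ε‖ ^ (2 * k + 2) * ‖x‖ := by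
  obtain ⟨C, hC, h⟩ := hD.norm_fderiv_chain_sub_le hG hz hz0 hj hjk
  refine ⟨C, hC, ?_⟩
  filter_upwards [h] with ε hε x hx
  set a : 𝕜 := ((2 * k + 2 - j).factorial : 𝕜) with ha
  have hp : ε ^ (2 * k + 1) = ε ^ (2 * k + 2 - j) * ε ^ (j - 1) := by
    rw [← pow_add]; congr 1; omega
  have e : fderiv 𝕜 G (z₀ ε) (D.Acomp k ε j x) - ε ^ (2 * k + 1) •
      (normFactor 𝕜 j / a) • D.Sb j x = (ε ^ (2 * k + 2 - j) / a) •
      (fderiv 𝕜 G (z₀ ε) (chain D.Sb D.T j ε x) - ε ^ (j - 1) • normFactor 𝕜 j • D.Sb j x) := by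
    rw [D.Acomp_eq hj hjk, smul_apply, map_smul, smul_sub, smul_smul, smul_smul, smul_smul, hp]
    congr 2
    ring
  rw [e, norm_smul, norm_div, norm_pow, ha, RCLike.norm_natCast]
  have hfac : (1 : ℝ) ≤ ((2 * k + 2 - j).factorial : ℝ) := by exact_mod_cast Nat.factorial_pos _
  calc _ ≤ ‖ε‖ ^ (2 * k + 2 - j) * (C * ‖ε‖ ^ j * ‖x‖) :=
        mul_le_mul (div_le_self (by positivity) hfac) (hε x hx) (norm_nonneg _) (by positivity)
    _ = C * ‖ε‖ ^ (2 * k + 2 - j + j) * ‖x‖ := by rw [pow_add]; ring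
    _ = _ := by rw [show 2 * k + 2 - j + j = 2 * k + 2 by omega]

theorem norm_fderiv_coneOp_sub_le (hD : D.IsFineResolution G (coeff z₀) k l)
    (hG : ContDiffAt 𝕜 (k + 2 : ℕ) G 0) (hz : ContDiffAt 𝕜 (k + 1 : ℕ) z₀ 0) (hz0 : z₀ 0 = 0) :
    ∃ C, 0 < C ∧ ∀ᶠ ε in 𝓝 (0 : 𝕜),
      ‖fderiv 𝕜 G (z₀ ε) ∘L D.coneOp k ε - ε ^ (2 * k + 1) • D.coneLead k‖ ≤
        C * ‖ε‖ ^ (2 * k + 2) := by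
  choose C hC h using fun j : Fin (k + 1) => hD.norm_fderiv_Acomp_sub_le hG hz hz0
    (j := j.val + 1) (by omega) (by omega)
  obtain ⟨C', hC', h'⟩ := hD.norm_fderiv_Acomp_sub_le hG hz hz0 (j := k + 1) (by omega) le_rfl
  have hS : 0 < ∑ j, C j := Finset.sum_pos (fun j _ => hC j) Finset.univ_nonempty
  refine ⟨∑ j, C j + C', by positivity, ?_⟩
  filter_upwards [eventually_all.2 h, h'] with ε hε hε'
  refine ContinuousLinearMap.opNorm_le_bound _ (by positivity) fun y => ?_
  obtain ⟨n, p⟩ := y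
  -- p lies in N_{k+1} ⊂ N_k, so the estimate for the last chain covers it. Only S_{k+1} p is known
  -- to vanish, not S̄_{k+1} p, hence the p-term in `coneLead`.
  have hp := hε' p (D.N_anti (by omega) (hD.P_le p.2))
  have e : (fderiv 𝕜 G (z₀ ε) ∘L D.coneOp k ε - ε ^ (2 * k + 1) • D.coneLead k) (n, p) =
      ∑ j : Fin (k + 1), (fderiv 𝕜 G (z₀ ε) (D.Acomp k ε (j.val + 1) (n j)) - ε ^ (2 * k + 1) •
        (normFactor 𝕜 (j.val + 1) / ((2 * k + 2 - (j.val + 1)).factorial : 𝕜)) •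
          D.Sb (j.val + 1) (n j)) + (fderiv 𝕜 G (z₀ ε) (D.Acomp k ε (k + 1) p) -
        ε ^ (2 * k + 1) • (normFactor 𝕜 (k + 1) / ((2 * k + 2 - (k + 1)).factorial : 𝕜)) •
          D.Sb (k + 1) p) := by
    have e1 : D.coneLead k (n, p) = D.LhatL k n +
      (normFactor 𝕜 (k + 1) / ((2 * k + 2 - (k + 1)).factorial : 𝕜)) • D.Sb (k + 1) p := by
      rw [show 2 * k + 2 - (k + 1) = k + 1 by omega]
      rfl
    rw [sub_apply, smul_apply, ContinuousLinearMap.comp_apply, coneOp_apply, e1, map_add,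
      LhatL_apply', A, map_sum, Finset.sum_sub_distrib, ← Finset.smul_sum]
    have e2 : ∀ j : Fin (k + 1), 2 * k + 2 - (j.val + 1) = 2 * k + 1 - j.val := fun j => by omega
    simp only [e2]
    rw [smul_add]
    abel
  rw [e]
  calc _ ≤ (∑ j, C j) * ‖ε‖ ^ (2 * k + 2) * ‖(n, p)‖ + C' * ‖ε‖ ^ (2 * k + 2) * ‖(n, p)‖ := by
        refine (norm_add_le _ _).trans (add_le_add ?_ ?_)
        · rw [Finset.sum_mul, Finset.sum_mul]
          refine (norm_sum_le _ _).trans (Finset.sum_le_sum fun j _ => ?_)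
          refine (hε j (n j) (by simpa using hD.Nc_le (by omega) (n j).2)).trans ?_
          exact mul_le_mul_of_nonneg_left ((norm_le_pi_norm n j).trans (norm_fst_le (n, p)))
            (mul_nonneg (hC j).le (by positivity))
        · exact hp.trans (mul_le_mul_of_nonneg_left (norm_snd_le (n, p)) (by positivity))
    _ = _ := by ring

end IsFineResolution

end Resolution

/-! ### Expansion in the cone, and what a zero there implies for G[z₀(ε)]. -/

section Cone

variable {𝕜 B B' : Type*} [RCLike 𝕜] [NormedAddCommGroup B] [NormedSpace 𝕜 B]
  [NormedAddCommGroup B'] [NormedSpace 𝕜 B'] [CompleteSpace B] [CompleteSpace B']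
  {D : Resolution 𝕜 B B'} {G : B → B'} {z₀ : 𝕜 → B} {k l : ℕ} {q : ℕ∞} {r : ℝ}

theorem natCast_le_of_le {q : ℕ∞} {m n : ℕ} (hq : ((n : ℕ) : ℕ∞) ≤ q) (h : m ≤ n) :
    ((m : ℕ) : WithTop ℕ∞) ≤ (q : WithTop ℕ∞) := by
  have : (m : ℕ∞) ≤ q := le_trans (by exact_mod_cast h) hq
  exact_mod_cast this

variable (𝕜) in
theorem eventually_norm_lt {r : ℝ} (hr : 0 < r) : ∀ᶠ ε in 𝓝 (0 : 𝕜), ‖ε‖ < r := by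
  filter_upwards [Metric.ball_mem_nhds (0 : 𝕜) hr] with ε hε using mem_ball_zero_iff.1 hε

/-- In the cone, `G[Z_k(ε, n, p)] = G[z₀(ε)] + ε^{2k+1} H(ε, (n, p))` with `H` close to a linear
map in the variables `(n, p)`. -/
theorem exists_cone_expansion (hq : ((2 * k + 2 : ℕ) : ℕ∞) ≤ q) (hG : ContDiff 𝕜 q G)
    (hr : 0 < r) (hz₀ : ContDiffOn 𝕜 q z₀ (Metric.ball 0 r)) (hz₀0 : z₀ 0 = 0)
    (hD : D.IsFineResolution G (coeff z₀) k l) :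
    ∃ H : 𝕜 × (D.NcProd k × D.P) → B',
      ContDiffOn 𝕜 (q - (2 * k + 1 : ℕ) : ℕ∞) H (Metric.ball 0 r ×ˢ Set.univ) ∧
      (∀ ε n p, ‖ε‖ < r →
        G (D.Z z₀ k ε n p) = G (z₀ ε) + ε ^ (2 * k + 1) • H (ε, (n, p))) ∧
      (∀ᶠ ε in 𝓝 (0 : 𝕜), H (ε, 0) = 0) ∧
      (∀ y, H (0, y) = D.coneLead k y) ∧
      ∀ ρ, 0 ≤ ρ → ∃ C > 0, ∀ᶠ ε in 𝓝 (0 : 𝕜), ∀ y y', ‖y‖ ≤ ρ → ‖y'‖ ≤ ρ →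
        ‖H (ε, y) - H (ε, y') - D.coneLead k (y - y')‖ ≤ C * ‖ε‖ * ‖y - y'‖ := by
  have hzat : ContDiffAt 𝕜 q z₀ 0 := hz₀.contDiffAt (Metric.ball_mem_nhds 0 hr)
  obtain ⟨C₁, hC₁, h₁⟩ := D.norm_coneOp_le k
  obtain ⟨C₂, hC₂, h₂⟩ := hD.norm_fderiv_coneOp_sub_le
    (hG.contDiffAt.of_le (natCast_le_of_le hq (by omega)))
    (hzat.of_le (natCast_le_of_le hq (by omega))) hz₀0
  obtain ⟨H, hH1, hH2, hH3⟩ := exists_expansion hq hG hr hz₀ hz₀0 (D.contDiff_coneOp k)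
    (Λ := D.coneLead k) (Ca := C₁ + C₂) (by
      filter_upwards [Metric.ball_mem_nhds (0 : 𝕜) one_pos] with ε hε
      refine (h₁ ε (mem_ball_zero_iff.1 hε).le).trans ?_
      gcongr
      linarith) (by
      filter_upwards [h₂] with ε hε
      refine hε.trans ?_
      gcongr
      linarith)
  refine ⟨H, hH1, fun ε n p hε => ?_, hH3⟩
  rw [Resolution.Z_eq]
  exact hH2 ε (n, p) hε

theorem exists_norm_le_of_isBounded {U : (j : Fin (k + 1)) → Set (D.Nc (j.val + 1))}
    (hU : ∀ j, Bornology.IsBounded (U j)) {Up : Set D.P} (hUp : Bornology.IsBounded Up) :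
    ∃ ρ, 0 < ρ ∧ (∀ n : D.NcProd k, (∀ j, n j ∈ U j) → ‖n‖ < ρ) ∧ ∀ p ∈ Up, ‖p‖ < ρ := by
  choose C hC h using fun j => (hU j).exists_pos_norm_lt
  obtain ⟨C', hC', h'⟩ := hUp.exists_pos_norm_lt
  have hS : 0 ≤ ∑ j, C j := Finset.sum_nonneg fun j _ => (hC j).le
  refine ⟨∑ j, C j + C', by positivity, fun n hn => ?_, fun p hp => ?_⟩
  · rw [pi_norm_lt_iff (by positivity)]
    intro j
    refine (h j _ (hn j)).trans_le ?_
    have := Finset.single_le_sum (f := C) (fun j _ => (hC j).le) (Finset.mem_univ j)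
    linarith
  · linarith [h' p hp]

/-- A zero gives G[z₀(ε)] = -ε^{2k+1} H(ε, (n, p)), and H is bounded on bounded sets uniformly in
small ε. -/
theorem norm_map_le_of_zero_in_cone (hq : ((2 * k + 2 : ℕ) : ℕ∞) ≤ q) (hG : ContDiff 𝕜 q G)
    (hr : 0 < r) (hz₀ : ContDiffOn 𝕜 q z₀ (Metric.ball 0 r)) (hz₀0 : z₀ 0 = 0)
    (hD : D.IsFineResolution G (coeff z₀) k l)
    {U : (j : Fin (k + 1)) → Set (D.Nc (j.val + 1))}
    (hU : ∀ j, Bornology.IsBounded (U j)) {Up : Set D.P} (hUp : Bornology.IsBounded Up) :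
    ∃ C δ : ℝ, 0 < δ ∧ ∀ (ε : 𝕜) (n : D.NcProd k) (p : D.P), 0 < ‖ε‖ → ‖ε‖ < δ →
      (∀ j, n j ∈ U j) → p ∈ Up → G (D.Z z₀ k ε n p) = 0 →
      ‖G (z₀ ε)‖ ≤ C * ‖ε‖ ^ (2 * k + 1) := by
  obtain ⟨ρ, hρ, hUρ, hUpρ⟩ := exists_norm_le_of_isBounded hU hUp
  obtain ⟨H, -, hH2, hH0, -, hHL⟩ := exists_cone_expansion hq hG hr hz₀ hz₀0 hD
  obtain ⟨C, hC, h⟩ := hHL ρ hρ.le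
  obtain ⟨δ, hδ, hδ'⟩ := Metric.eventually_nhds_iff_ball.1 (h.and (hH0.and
    ((eventually_norm_lt 𝕜 hr).and (eventually_norm_lt 𝕜 one_pos))))
  refine ⟨C * ρ + ‖D.coneLead k‖ * ρ, δ, hδ, fun ε n p _ hε hn hp hz => ?_⟩
  obtain ⟨h1, h2, h3, h4⟩ := hδ' ε (mem_ball_zero_iff.2 hε)
  rw [hH2 ε n p h3] at hz
  have hy : ‖(n, p)‖ ≤ ρ := max_le (hUρ n hn).le (hUpρ p hp).le
  have h5 := h1 (n, p) 0 hy (by simpa using hρ.le)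
  rw [h2, sub_zero, sub_zero] at h5
  have h6 : ‖H (ε, (n, p))‖ ≤ C * ρ + ‖D.coneLead k‖ * ρ := by
    calc _ = ‖(H (ε, (n, p)) - D.coneLead k (n, p)) + D.coneLead k (n, p)‖ := by
          rw [sub_add_cancel]
      _ ≤ C * ‖ε‖ * ‖(n, p)‖ + ‖D.coneLead k‖ * ‖(n, p)‖ :=
          (norm_add_le _ _).trans (add_le_add h5 (ContinuousLinearMap.le_opNorm _ _))
      _ ≤ C * 1 * ρ + ‖D.coneLead k‖ * ρ := by gcongr
      _ = _ := by ring
  rw [eq_neg_of_add_eq_zero_left hz, norm_neg, norm_smul, norm_pow, mul_comm]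
  gcongr

/-- A single zero is enough because G ∘ z₀ is smooth: if it is not O(ε^{2k+1}), it has an exact
order j ≤ 2k, and its lower bound b|ε|^j excludes all zeros in a sufficiently short cone. -/
theorem isBigO_of_zero_in_cone (hq : ((2 * k + 2 : ℕ) : ℕ∞) ≤ q) (hG : ContDiff 𝕜 q G)
    (hr : 0 < r) (hz₀ : ContDiffOn 𝕜 q z₀ (Metric.ball 0 r)) (hz₀0 : z₀ 0 = 0)
    (hD : D.IsFineResolution G (coeff z₀) k l)
    {U : (j : Fin (k + 1)) → Set (D.Nc (j.val + 1))}
    (hU : ∀ j, Bornology.IsBounded (U j)) {Up : Set D.P} (hUp : Bornology.IsBounded Up) :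
    ∃ δ : ℝ, 0 < δ ∧ ∀ z ∈ D.cone z₀ k U Up δ, G z = 0 →
      (fun ε : 𝕜 => G (z₀ ε)) =O[𝓝 0] (fun ε : 𝕜 => ‖ε‖ ^ (2 * k + 1)) := by
  obtain ⟨C, δ, hδ, h⟩ := norm_map_le_of_zero_in_cone hq hG hr hz₀ hz₀0 hD hU hUp
  rcases isBigO_pow_or_exists_le hr (hG.comp_contDiffOn hz₀) (2 * k + 1)
    (le_trans (by exact_mod_cast (by omega)) hq) with hO | ⟨j, hj, b, hb, hb'⟩
  · exact ⟨δ, hδ, fun _ _ _ => hO⟩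
  · have hsmall : ∀ᶠ ε in 𝓝 (0 : 𝕜), |C| * ‖ε‖ ^ (2 * k + 1 - j) < b := by
      have : Continuous fun ε : 𝕜 => |C| * ‖ε‖ ^ (2 * k + 1 - j) := by fun_prop
      have ht := this.tendsto 0
      rw [norm_zero, zero_pow (by omega), mul_zero] at ht
      exact ht.eventually_lt_const hb
    obtain ⟨δ', hδ', hδ''⟩ := Metric.eventually_nhds_iff_ball.1 (hb'.and hsmall)
    refine ⟨min δ δ', lt_min hδ hδ', ?_⟩
    rintro z ⟨ε, n, p, hε0, hε, hn, hp, rfl⟩ hz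
    exfalso
    have h1 := h ε n p hε0 (hε.trans_le (min_le_left _ _)) hn hp hz
    obtain ⟨h2, h3⟩ := hδ'' ε (mem_ball_zero_iff.2 (hε.trans_le (min_le_right _ _)))
    have h4 : 2 * k + 1 = (2 * k + 1 - j) + j := by omega
    have h5 : b * ‖ε‖ ^ j ≤ |C| * ‖ε‖ ^ (2 * k + 1 - j) * ‖ε‖ ^ j := by
      refine h2.trans (h1.trans ?_)
      rw [mul_assoc, ← pow_add, ← h4]
      exact mul_le_mul_of_nonneg_right (le_abs_self C) (by positivity)
    have := le_of_mul_le_mul_right h5 (by positivity)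
    linarith

end Cone

end

end KTransversal

namespace KTransversal

set_option linter.unusedSectionVars false

noncomputable section

/-! ### Regularity of the parametrisation for ε ≠ 0. -/

section Regularity

variable {𝕜 : Type*} [RCLike 𝕜]

/-- The Taylor polynomial of s' of degree l-1 is the single term a ε^{l-1} with a ≠ 0, and it
dominates its remainder for small ε ≠ 0. -/
theorem eventually_deriv_ne_zero {s : 𝕜 → 𝕜} {l : ℕ} (hl : 1 ≤ l) (hs : ContDiffAt 𝕜 l s 0)
    (hlow : ∀ i, 1 ≤ i → i < l → iteratedDeriv i s 0 = 0) (hlead : iteratedDeriv l s 0 ≠ 0) :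
    ∀ᶠ ε in 𝓝 (0 : 𝕜), ε ≠ 0 → deriv s ε ≠ 0 := by
  obtain ⟨m, rfl⟩ : ∃ m, l = m + 1 := ⟨l - 1, by omega⟩
  have hd : ContDiffAt 𝕜 m (deriv s) 0 := hs.derivWithin (by exact_mod_cast le_rfl)
  set a : 𝕜 := ((m.factorial : 𝕜)⁻¹) * iteratedDeriv (m + 1) s 0 with ha
  have ha0 : a ≠ 0 := mul_ne_zero (inv_ne_zero (natCast_factorial_ne_zero m)) hlead
  have hsum : ∀ ε : 𝕜, ∑ j ∈ Finset.range (m + 1),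
      ((j.factorial : 𝕜)⁻¹) • iteratedFDeriv 𝕜 j (deriv s) 0 (fun _ => ε) = ε ^ m * a := by
    intro ε
    rw [Finset.sum_eq_single m]
    · rw [iteratedFDeriv_const_eq_pow_smul, ← iteratedDeriv_succ', ha]
      simp only [smul_eq_mul]
      ring
    · intro j hj hjm
      rw [Finset.mem_range] at hj
      rw [iteratedFDeriv_const_eq_pow_smul, ← iteratedDeriv_succ', hlow (j + 1) (by omega)
        (by omega), smul_zero, smul_zero]
    · intro h
      simp at h
  have ho := taylor_isLittleO hd
  have := ho.bound (half_pos (norm_pos_iff.2 ha0))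
  filter_upwards [this] with ε hε hε0 h0
  rw [hsum, h0, zero_sub, norm_neg, norm_mul, norm_pow, norm_pow, norm_norm] at hε
  have h1 : 0 < ‖ε‖ ^ m := pow_pos (norm_pos_iff.2 hε0) m
  have h2 : 0 < ‖a‖ := norm_pos_iff.2 ha0
  nlinarith

variable {P : Type*} [NormedAddCommGroup P] [NormedSpace 𝕜 P]

theorem exists_leftInverse_of_triangular {a e : 𝕜} (ha : a ≠ 0) (he : e ≠ 0) (β : P) :
    ∃ T : 𝕜 × P →L[𝕜] 𝕜 × P, ∀ x : 𝕜 × P, T (a * x.1, x.1 • β + e • x.2) = x := by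
  refine ⟨(a⁻¹ • ContinuousLinearMap.fst 𝕜 𝕜 P).prod (e⁻¹ • (ContinuousLinearMap.snd 𝕜 𝕜 P -
    (ContinuousLinearMap.fst 𝕜 𝕜 P).smulRight (a⁻¹ • β))), fun x => ?_⟩
  ext
  · simp [ha]
  · have : a⁻¹ * (a * x.1) = x.1 := inv_mul_cancel_left₀ ha _
    simp [he, smul_smul, mul_comm _ a⁻¹, this]

end Regularity

namespace Resolution.IsFineResolution

variable {𝕜 B B' : Type*} [RCLike 𝕜] [NormedAddCommGroup B] [NormedSpace 𝕜 B]
  [NormedAddCommGroup B'] [NormedSpace 𝕜 B'] [CompleteSpace B] [CompleteSpace B']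
  {D : Resolution 𝕜 B B'} {G : B → B'} {z : ℕ → B} {k l : ℕ}

/-- The coordinates on `B / N^c` determined by the decomposition `N_{k+1} = P ⊕ 𝕜 w`. -/
theorem exists_coordinates (hD : D.IsFineResolution G z k l) :
    ∃ (σ : B →L[𝕜] 𝕜) (π : B →L[𝕜] D.P), (∀ x ∈ D.NcSum k, σ x = 0 ∧ π x = 0) ∧
      (∀ p : D.P, σ p = 0 ∧ π p = p) ∧ σ (z l) ≠ 0 := by
  obtain ⟨w, hw, hzw, hdisj, hsup⟩ := hD.exists_line
  -- This is where the condition z̄_l ∉ N^c enters: z̄_l has a component transversal to N^c.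
  have hw0 : w ≠ 0 := by
    rintro rfl
    rw [sub_zero] at hzw
    exact hD.notMem_Nc hzw
  have hcl : IsClosed ((Submodule.span 𝕜 {w} : Submodule 𝕜 B) : Set B) :=
    Submodule.closed_of_finiteDimensional _
  have h1 := isTopCompl_sup hD.isTopCompl_NcSum hsup hdisj hD.isClosed_P hcl
  have h2 := isTopCompl_sup hD.isTopCompl_NcSum (by rw [sup_comm]; exact hsup) hdisj.symm hcl
    hD.isClosed_P
  refine ⟨(ContinuousLinearEquiv.coord 𝕜 w hw0) ∘L (Submodule.span 𝕜 {w}).projectionOntoL _ h1,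
    D.P.projectionOntoL _ h2, fun x hx => ⟨?_, ?_⟩, fun p => ⟨?_, ?_⟩, ?_⟩
  · rw [ContinuousLinearMap.comp_apply, (Submodule.projectionOntoL_apply_eq_zero_iff h1).2
      (Submodule.mem_sup_left hx), map_zero]
  · exact (Submodule.projectionOntoL_apply_eq_zero_iff h2).2 (Submodule.mem_sup_left hx)
  · rw [ContinuousLinearMap.comp_apply, (Submodule.projectionOntoL_apply_eq_zero_iff h1).2
      (Submodule.mem_sup_right p.2), map_zero]
  · exact Submodule.projectionOntoL_apply_left h2 p
  · rw [← sub_add_cancel (z l) w, map_add, ContinuousLinearMap.comp_apply,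
      (Submodule.projectionOntoL_apply_eq_zero_iff h1).2 (Submodule.mem_sup_left hzw), map_zero,
      zero_add, ContinuousLinearMap.comp_apply,
      Submodule.projectionOntoL_apply_left h1 ⟨w, Submodule.mem_span_singleton_self w⟩,
      ContinuousLinearEquiv.coord_self]
    exact one_ne_zero

theorem A_mem (hD : D.IsFineResolution G z k l) (ε : 𝕜) (n : D.NcProd k) :
    D.A k ε n ∈ D.NcSum k := by
  rw [A, NcSum_eq]
  refine Submodule.sum_mem _ fun j _ => ?_
  rw [D.Acomp_eq (by omega) (by omega)]
  exact Submodule.smul_mem _ _ (D.NcPartial_mono (by omega)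
    (hD.chain_mem (by omega) (by omega) ε (n j).2))

theorem Acomp_sub_mem (hD : D.IsFineResolution G z k l) (ε : 𝕜) (x : B) :
    D.Acomp k ε (k + 1) x - (ε ^ (k + 1) / ((k + 1).factorial : 𝕜)) • x ∈ D.NcSum k := by
  rw [D.Acomp_eq (by omega) le_rfl, show 2 * k + 2 - (k + 1) = k + 1 by omega, smul_apply,
    ← smul_sub, NcSum_eq]
  exact Submodule.smul_mem _ _ (D.NcPartial_mono (by omega)
    (hD.chain_sub_mem (by omega) le_rfl ε x))

/-- Modulo N^c the point Z is z₀(ε) + ε^{k+1} p/(k+1)!, whatever ν is. In the coordinates (σ, π) the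
derivative is therefore triangular with diagonal entries σ(z₀'(ε)) and ε^{k+1}/(k+1)!, both
non-zero, and the range of ε does not depend on ν. -/
theorem exists_leftInverse {z₀ : 𝕜 → B} (hD : D.IsFineResolution G (coeff z₀) k l) (hl : 1 ≤ l)
    (hlk : l ≤ k) (hz : ContDiffAt 𝕜 (k + 1 : ℕ) z₀ 0)
    (hlow : ∀ i, 1 ≤ i → i < l → coeff z₀ i = 0) :
    ∀ᶠ ε in 𝓝 (0 : 𝕜), ε ≠ 0 → ∀ (ν : 𝕜 → D.P → D.NcProd k) (p : D.P),
      DifferentiableAt 𝕜 (fun x : 𝕜 × D.P => D.Z z₀ k x.1 (ν x.1 x.2) x.2) (ε, p) →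
      ∃ Λ : B →L[𝕜] 𝕜 × D.P,
        Λ ∘L fderiv 𝕜 (fun x : 𝕜 × D.P => D.Z z₀ k x.1 (ν x.1 x.2) x.2) (ε, p) =
          ContinuousLinearMap.id 𝕜 (𝕜 × D.P) := by
  obtain ⟨σ, π, hN, hP, hσ⟩ := hD.exists_coordinates
  have hzl : ContDiffAt 𝕜 l z₀ 0 := hz.of_le (by exact_mod_cast (by omega))
  have hs : ContDiffAt 𝕜 l (σ ∘ z₀) 0 := σ.contDiff.contDiffAt.comp 0 hzl
  have hit : ∀ i ≤ l, iteratedDeriv i (σ ∘ z₀) 0 = σ (coeff z₀ i) := by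
    intro i hi
    rw [iteratedDeriv_eq_iteratedFDeriv, σ.iteratedFDeriv_comp_left hzl (by exact_mod_cast hi)]
    rfl
  have hne := eventually_deriv_ne_zero hl hs (fun i hi hil => by
    rw [hit i hil.le, hlow i hi hil, map_zero]) (by rw [hit l le_rfl]; exact hσ)
  have hdz : ∀ᶠ ε in 𝓝 (0 : 𝕜), DifferentiableAt 𝕜 z₀ ε := by
    filter_upwards [hz.eventually (by simp)] with ε hε
    exact hε.differentiableAt (by simp)
  filter_upwards [hne, hdz] with ε hε hdε hε0 ν p hdiff
  set Zf := fun x : 𝕜 × D.P => D.Z z₀ k x.1 (ν x.1 x.2) x.2 with hZf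
  set e : 𝕜 → 𝕜 := fun ε => ε ^ (k + 1) / ((k + 1).factorial : 𝕜) with he
  have hZval : ∀ x : 𝕜 × D.P, (σ.prod π) (Zf x) = (σ (z₀ x.1), π (z₀ x.1) + e x.1 • x.2) := by
    intro x
    have h1 := hN _ (hD.A_mem x.1 (ν x.1 x.2))
    have h2 := hN _ (hD.Acomp_sub_mem x.1 (x.2 : B))
    have h3 := hP x.2
    rw [map_sub, map_sub, map_smul, map_smul, h3.1, h3.2, smul_zero, sub_zero, sub_eq_zero] at h2
    rw [ContinuousLinearMap.prod_apply]
    simp only [hZf, Z, map_add σ, map_add π, h1.1, h1.2, h2.1, h2.2, add_zero, he]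
  have hd1 : HasFDerivAt (fun x : 𝕜 × D.P => z₀ x.1)
      ((ContinuousLinearMap.fst 𝕜 𝕜 D.P).smulRight (deriv z₀ ε)) (ε, p) := by
    have h1 : HasFDerivAt z₀ _ (ε, p).1 := hdε.hasDerivAt.hasFDerivAt
    refine (h1.comp (ε, p) hasFDerivAt_fst).congr_fderiv ?_
    ext <;> simp
  have hde : DifferentiableAt 𝕜 e ε := by
    rw [he]
    fun_prop
  have hd2 : HasFDerivAt (fun x : 𝕜 × D.P => e x.1)
      ((ContinuousLinearMap.fst 𝕜 𝕜 D.P).smulRight (deriv e ε)) (ε, p) := by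
    have h1 : HasFDerivAt e _ (ε, p).1 := hde.hasDerivAt.hasFDerivAt
    refine (h1.comp (ε, p) hasFDerivAt_fst).congr_fderiv ?_
    ext <;> simp
  have hd3 := (σ.hasFDerivAt.comp (ε, p) hd1).prodMk ((π.hasFDerivAt.comp (ε, p) hd1).add
    (hd2.smul hasFDerivAt_snd))
  have hd4 := (σ.prod π).hasFDerivAt.comp (ε, p) hdiff.hasFDerivAt
  have hd5 := hd4.unique (hd3.congr_of_eventuallyEq (Eventually.of_forall hZval))
  have hσ' : σ (deriv z₀ ε) ≠ 0 := by
    have := (σ.hasFDerivAt.comp_hasDerivAt ε hdε.hasDerivAt).deriv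
    rw [← this]
    exact hε hε0
  have he0 : e ε ≠ 0 := div_ne_zero (pow_ne_zero _ hε0) (natCast_factorial_ne_zero _)
  obtain ⟨T, hT⟩ := exists_leftInverse_of_triangular hσ' he0
    (π (deriv z₀ ε) + deriv e ε • p)
  refine ⟨T ∘L σ.prod π, ?_⟩
  rw [ContinuousLinearMap.comp_assoc, hd5]
  refine ContinuousLinearMap.ext fun x => ?_
  rw [ContinuousLinearMap.comp_apply]
  refine Eq.trans (congrArg T ?_) (hT x)
  ext
  · simp [mul_comm]
  · simp [smul_smul]
    abel

end Resolution.IsFineResolution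

end

end KTransversal

namespace KTransversal

set_option linter.unusedSectionVars false

noncomputable section

/-! ### Construction of the solution family. -/

section Solutions

variable {𝕜 B B' : Type*} [RCLike 𝕜] [NormedAddCommGroup B] [NormedSpace 𝕜 B]
  [NormedAddCommGroup B'] [NormedSpace 𝕜 B'] [CompleteSpace B] [CompleteSpace B']
  {D : Resolution 𝕜 B B'} {G : B → B'} {z₀ : 𝕜 → B} {k l : ℕ} {q : ℕ∞} {r : ℝ}

theorem one_le_tsub {m : ℕ} {q : ℕ∞} (hq : ((m + 1 : ℕ) : ℕ∞) ≤ q) : 1 ≤ q - (m : ℕ) := by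
  refine ENat.le_sub_of_add_le_left (ENat.natCast_ne_top m) ?_
  exact_mod_cast hq

theorem coneLead_sub (D : Resolution 𝕜 B B') (x x' : D.NcProd k) (p : D.P) :
    D.coneLead k ((x, p) - (x', p)) = D.LhatL k (x - x') := by
  rw [Prod.mk_sub_mk, sub_self]
  simp [Resolution.coneLead]

/-- With G[z₀(ε)] = ε^{2k+1} g(ε) the equation becomes g(ε) + H(ε, (n, p)) = 0, which is also
meaningful at ε = 0, where it is affine in n with linear part L̂. Solving this divided equation
gives a ν that is smooth across ε = 0. -/
theorem exists_isSolutionFamily (hq : ((2 * k + 2 : ℕ) : ℕ∞) ≤ q) (hG : ContDiff 𝕜 q G)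
    (hr : 0 < r) (hz₀ : ContDiffOn 𝕜 q z₀ (Metric.ball 0 r)) (hz₀0 : z₀ 0 = 0)
    (hl : 1 ≤ l) (hlk : l ≤ k) (hlow : ∀ i, 1 ≤ i → i < l → coeff z₀ i = 0)
    (hD : D.IsFineResolution G (coeff z₀) k l)
    {U : (j : Fin (k + 1)) → Set (D.Nc (j.val + 1))}
    (hU : ∀ j, Bornology.IsBounded (U j)) {Up : Set D.P} (hUpo : IsOpen Up)
    (hUp : Bornology.IsBounded Up) (ht : D.IsTransversal k)
    (hO : (fun ε : 𝕜 => G (z₀ ε)) =O[𝓝 0] (fun ε : 𝕜 => ‖ε‖ ^ (2 * k + 1))) :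
    ∃ (δ : ℝ) (ν : 𝕜 → D.P → D.NcProd k),
      D.IsSolutionFamily G z₀ k U Up (q - (2 * k + 1 : ℕ)) δ ν := by
  have := hD.completeSpace_NcProd
  have := hD.completeSpace_P
  obtain ⟨ρ, hρ, hUρ, hUpρ⟩ := exists_norm_le_of_isBounded hU hUp
  obtain ⟨H, hHs, hH2, -, hHlead, hHL⟩ := exists_cone_expansion hq hG hr hz₀ hz₀0 hD
  obtain ⟨L, hL⟩ := hD.exists_LhatEquiv ht
  obtain ⟨g, hgs, hg⟩ := exists_contDiffOn_pow_smul_of_one_variable hr (2 * k + 1)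
    (le_trans (by exact_mod_cast (by omega)) hq) (hG.comp_contDiffOn hz₀) hO
  have hm : 1 ≤ q - (2 * k + 1 : ℕ) := one_le_tsub hq
  have hzat : ContDiffAt 𝕜 (k + 1 : ℕ) z₀ 0 :=
    (hz₀.contDiffAt (Metric.ball_mem_nhds 0 hr)).of_le (natCast_le_of_le hq (by omega))
  have hball := Metric.ball_mem_nhds (0 : 𝕜) hr
  set κ := ‖(L.symm : B' →L[𝕜] D.NcProd k)‖ with hκ
  set M₀ := ‖g 0‖ + 1 with hM₀
  have hgM : ∀ᶠ ε in 𝓝 (0 : 𝕜), ‖g ε‖ ≤ M₀ := by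
    have := (hgs.continuousOn.continuousAt hball).norm
    exact (this.eventually_lt_const (lt_add_one _)).mono fun ε hε => hε.le
  -- R ≥ ρ makes uniqueness in the ball cover all of U; the second term bounds ‖L⁻¹‖ times the value
  -- of the divided equation at n = 0 by R/4. The solution itself may lie outside U.
  set R := ρ + 4 * κ * (M₀ + ‖D.coneLead k‖ * ρ + 1) with hR
  have hκ0 : 0 ≤ κ := by rw [hκ]; positivity
  have hRρ : ρ ≤ R := le_add_of_nonneg_right (by positivity)
  have hR0 : 0 < R := hρ.trans_le hRρ
  obtain ⟨C, hC, h⟩ := hHL R hR0.le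
  have hz0H : ∀ᶠ ε in 𝓝 (0 : 𝕜), ‖H (ε, 0)‖ ≤ 1 / 2 := by
    have hc : ContinuousAt (fun ε => H (ε, 0)) 0 := by
      have h1 : ContinuousAt H ((0 : 𝕜), (0 : D.NcProd k × D.P)) :=
        hHs.continuousOn.continuousAt (prod_mem_nhds hball univ_mem)
      exact h1.comp (f := fun ε : 𝕜 => (ε, (0 : D.NcProd k × D.P))) (by fun_prop)
    have := hc.norm
    rw [ContinuousAt, hHlead, map_zero, norm_zero] at this
    exact (this.eventually_lt_const one_half_pos).mono fun ε hε => hε.le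
  have hsmall : ∀ c : ℝ, ∀ᶠ ε in 𝓝 (0 : 𝕜), C * ‖ε‖ * c < 1 / 2 := by
    intro c
    have : Continuous fun ε : 𝕜 => C * ‖ε‖ * c := by fun_prop
    have ht := this.tendsto 0
    rw [norm_zero, mul_zero, zero_mul] at ht
    exact ht.eventually_lt_const one_half_pos
  obtain ⟨δ, hδ, hev⟩ := Metric.eventually_nhds_iff_ball.1 (h.and (hgM.and (hz0H.and
    ((hsmall ρ).and ((eventually_norm_lt 𝕜 hr).and
      (hD.exists_leftInverse hl hlk hzat hlow))))))
  -- Shrinking δ makes the Lipschitz error C δ' at most half of 1/‖L⁻¹‖, as the contraction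
  -- requires.
  obtain ⟨δ', hδ', hδ'δ, hη⟩ : ∃ δ', 0 < δ' ∧ δ' ≤ δ ∧ C * δ' * κ ≤ 1 / 2 := by
    refine ⟨min δ (1 / (2 * C * (κ + 1))), lt_min hδ (by positivity), min_le_left _ _, ?_⟩
    calc C * min δ (1 / (2 * C * (κ + 1))) * κ ≤ C * (1 / (2 * C * (κ + 1))) * (κ + 1) := by
          gcongr
          · exact min_le_right _ _
          · linarith
      _ = 1 / 2 := by field_simp
  have hlt : ∀ {ε : 𝕜}, ‖ε‖ < δ' → ε ∈ Metric.ball (0 : 𝕜) δ := fun hε =>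
    mem_ball_zero_iff.2 (hε.trans_le hδ'δ)
  have hrlt : ∀ {ε : 𝕜}, ‖ε‖ < δ' → ‖ε‖ < r := fun hε => (hev _ (hlt hε)).2.2.2.2.1
  have hsub : Metric.ball (0 : 𝕜) δ' ⊆ Metric.ball 0 r := fun ε hε =>
    mem_ball_zero_iff.2 (hrlt (mem_ball_zero_iff.1 hε))
  set s : Set (𝕜 × D.P) := Metric.ball 0 δ' ×ˢ Up with hs
  have hso : IsOpen s := Metric.isOpen_ball.prod hUpo
  obtain ⟨ν, hν, hνs⟩ := exists_contDiffOn_solution (V := 𝕜 × D.P) (X := D.NcProd k) hm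
    (Φ := fun x => g x.1.1 + H (x.1.1, (x.2, x.1.2))) (s := s) hso
    (by
      refine ContDiffOn.add (hgs.comp (by fun_prop) fun x hx => hsub hx.1.1)
        (hHs.comp (by fun_prop) fun x hx => ⟨hsub hx.1.1, Set.mem_univ _⟩)) L (R := R)
    (η := C * δ') hR0 (by positivity) hη
    (fun w hw x x' hx hx' => by
      have hw1 : ‖w.1‖ < δ' := mem_ball_zero_iff.1 hw.1
      have hp : ‖w.2‖ ≤ R := ((hUpρ _ hw.2).le).trans hRρ
      have h1 := (hev _ (hlt hw1)).1 (x, w.2) (x', w.2) (max_le hx hp) (max_le hx' hp)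
      rw [coneLead_sub, Prod.mk_sub_mk, sub_self] at h1
      rw [hL, add_sub_add_left_eq_sub]
      refine h1.trans ?_
      have : ‖(x - x', (0 : D.P))‖ = ‖x - x'‖ := by simp [Prod.norm_def]
      rw [this]
      gcongr)
    (fun w hw => by
      have hw1 : ‖w.1‖ < δ' := mem_ball_zero_iff.1 hw.1
      obtain ⟨e1, e2, e3, e4, -⟩ := hev _ (hlt hw1)
      have hp : ‖((0 : D.NcProd k), w.2)‖ ≤ ρ := by
        refine max_le ?_ (hUpρ _ hw.2).le
        simpa using hρ.le
      have h1 := e1 (0, w.2) 0 (hp.trans hRρ) (by simpa using hR0.le)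
      rw [sub_zero] at h1
      have h2 : ‖g w.1 + H (w.1, (0, w.2))‖ ≤ M₀ + ‖D.coneLead k‖ * ρ + 1 := by
        have e : g w.1 + H (w.1, (0, w.2)) = g w.1 + D.coneLead k (0, w.2) + H (w.1, 0) +
          (H (w.1, (0, w.2)) - H (w.1, 0) - D.coneLead k (0, w.2)) := by abel
        rw [e]
        calc _ ≤ M₀ + ‖D.coneLead k‖ * ρ + 1 / 2 + 1 / 2 := by
              refine (norm_add₄_le).trans (add_le_add (add_le_add (add_le_add e2 ?_) e3) ?_)
              · exact (ContinuousLinearMap.le_opNorm _ _).trans (by gcongr)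
              · refine h1.trans (le_trans ?_ e4.le)
                gcongr
          _ = _ := by ring
      calc _ ≤ κ * (M₀ + ‖D.coneLead k‖ * ρ + 1) := by
            exact mul_le_mul_of_nonneg_left h2 hκ0
        _ ≤ R / 4 := by rw [hR]; linarith)
  have hzs : ContDiffOn 𝕜 (q - (2 * k + 1 : ℕ) : ℕ∞)
      (fun x : 𝕜 × D.P => D.Z z₀ k x.1 (ν x) x.2) s := by
    simp only [Resolution.Z_eq]
    refine ContDiffOn.add ?_ ?_
    · exact ((hz₀.of_le (by exact_mod_cast tsub_le_self)).comp contDiffOn_fst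
        fun x hx => hsub hx.1)
    · exact ((D.contDiff_coneOp k).comp contDiff_fst).contDiffOn.clm_apply
        (hν.prodMk contDiffOn_snd)
  have hG' : ∀ ε n p, ‖ε‖ < r →
      G (D.Z z₀ k ε n p) = ε ^ (2 * k + 1) • (g ε + H (ε, (n, p))) := by
    intro ε n p hε
    rw [hH2 ε n p hε, smul_add]
    congr 1
    exact hg ε (mem_ball_zero_iff.2 hε)
  refine ⟨δ', fun ε p => ν (ε, p), hδ', hν, hzs, fun ε p hε hp => ?_,
    fun ε n p hε0 hε hn hp hz => ?_, fun ε p hε0 hε hp => ?_⟩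
  · rw [hG' _ _ _ (hrlt hε), (hνs (ε, p) ⟨mem_ball_zero_iff.2 hε, hp⟩).2.1, smul_zero]
  · rw [hG' _ _ _ (hrlt hε), smul_eq_zero] at hz
    have h1 := hz.resolve_left (pow_ne_zero _ (norm_pos_iff.1 hε0))
    exact (hνs (ε, p) ⟨mem_ball_zero_iff.2 hε, hp⟩).2.2 n ((hUρ n hn).le.trans hRρ) h1
  · have hmem : (ε, p) ∈ s := ⟨mem_ball_zero_iff.2 hε, hp⟩
    refine (hev _ (hlt hε)).2.2.2.2.2 (norm_pos_iff.1 hε0) (fun ε p => ν (ε, p)) p ?_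
    have hd := (hzs.contDiffAt (hso.mem_nhds hmem)).differentiableAt (by
      have : (q - (2 * k + 1 : ℕ) : ℕ∞) ≠ 0 := (zero_lt_one.trans_le hm).ne'
      exact_mod_cast this)
    exact hd

end Solutions

end

end KTransversal

namespace KTransversal

set_option linter.unusedSectionVars false

noncomputable section

/-! ### Perturbations of G by terms of higher order. -/

section Perturbation

variable {𝕜 B B' : Type*} [RCLike 𝕜] [NormedAddCommGroup B] [NormedSpace 𝕜 B]
  [NormedAddCommGroup B'] [NormedSpace 𝕜 B']
  {D : Resolution 𝕜 B B'} {G h : B → B'} {z₀ : 𝕜 → B} {k l : ℕ} {q : ℕ∞} {r : ℝ}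

theorem iteratedFDeriv_fderiv_eq_zero {f : B → B'} {j : ℕ}
    (hf : iteratedFDeriv 𝕜 (j + 1) f 0 = 0) : iteratedFDeriv 𝕜 j (fderiv 𝕜 f) 0 = 0 := by
  rw [← norm_eq_zero, norm_iteratedFDeriv_fderiv, hf, norm_zero]

/-- Perturbations of order `k + 2` do not change a fine resolution of order `k`. -/
theorem Resolution.IsFineResolution.add {z : ℕ → B} (hD : D.IsFineResolution G z k l)
    (hG : ContDiff 𝕜 (k + 1 : ℕ) G) (hh : ContDiff 𝕜 (k + 1 : ℕ) h)
    (hO : h =O[𝓝 0] (fun z : B => ‖z‖ ^ (k + 2))) :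
    D.IsFineResolution (G + h) z k l := by
  have ho : h =o[𝓝 0] (fun z : B => ‖z‖ ^ (k + 1)) := by
    refine hO.trans_isLittleO ?_
    have : (fun z : B => ‖z‖) =o[𝓝 0] fun _ => (1 : ℝ) :=
      (isLittleO_one_iff ℝ).2 (by simpa using (continuous_norm (E := B)).tendsto 0)
    have h2 := (isBigO_refl (fun z : B => ‖z‖ ^ (k + 1)) (𝓝 0)).mul_isLittleO this
    refine (h2.congr (fun z => ?_) fun z => mul_one _)
    rw [← pow_succ]
  -- h = o(‖z‖^{k+1}) kills all derivatives of h at 0 up to order k+1, that is, those of h' up to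
  -- order k.
  have hzero : ∀ j ≤ k, iteratedFDeriv 𝕜 j (fderiv 𝕜 h) 0 = 0 := fun j hj =>
    iteratedFDeriv_fderiv_eq_zero
      (iteratedFDeriv_eq_zero_of_isLittleO hh.contDiffAt ho (j + 1) (by omega))
  have hne : (((k + 1 : ℕ) : WithTop ℕ∞)) ≠ 0 := by exact_mod_cast k.succ_ne_zero
  have hfd : fderiv 𝕜 (G + h) = fderiv 𝕜 G + fderiv 𝕜 h := by
    funext x
    exact fderiv_add (hG.differentiable hne x) (hh.differentiable hne x)
  have hG' : ContDiff 𝕜 k (fderiv 𝕜 G) := hG.fderiv_right (by norm_cast)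
  have hh' : ContDiff 𝕜 k (fderiv 𝕜 h) := hh.fderiv_right (by norm_cast)
  have hit : ∀ j ≤ k, iteratedFDeriv 𝕜 j (fderiv 𝕜 (G + h)) 0 =
      iteratedFDeriv 𝕜 j (fderiv 𝕜 G) 0 := by
    intro j hj
    rw [hfd, iteratedFDeriv_add (hG'.of_le (by exact_mod_cast hj))
      (hh'.of_le (by exact_mod_cast hj)), Pi.add_apply, hzero j hj, add_zero]
  have hsb1 : fderiv 𝕜 (G + h) 0 = fderiv 𝕜 G 0 := by
    have := DFunLike.congr_fun (hit 0 (Nat.zero_le k)) ![]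
    simpa using this
  have hsb2 : 1 ≤ k → fderiv 𝕜 (fderiv 𝕜 (G + h)) 0 = fderiv 𝕜 (fderiv 𝕜 G) 0 := by
    intro hk
    ext x : 1
    have := DFunLike.congr_fun (hit 1 hk) fun _ => x
    rwa [iteratedFDeriv_one_apply, iteratedFDeriv_one_apply] at this
  have hsucc : ∀ n, 1 ≤ n → n ≤ k → D.Sb (n + 1) = nextSb (G + h) z D.Sb D.T n := by
    intro n hn hnk
    refine (hD.Sb_succ n hn hnk).trans ?_
    -- W involves derivatives of G' of order c.length ≤ i ≤ n ≤ k only.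
    have hW : ∀ i ∈ Finset.Icc 1 n, W 𝕜 (G + h) z (2 * n) (n - 1) (2 * n - i) =
        W 𝕜 G z (2 * n) (n - 1) (2 * n - i) := by
      intro i hi
      rw [Finset.mem_Icc] at hi
      unfold W
      refine congrArg _ (Finset.sum_congr rfl fun c _ => ?_)
      rw [hit c.length (by have := c.length_le; omega)]
    unfold nextSb
    rw [hsb2 (by omega)]
    refine congrArg (· + _) (Finset.sum_congr rfl fun i hi => ?_)
    rw [hW i hi]
  exact ⟨hD.Rc_zero, hD.Sb_one.trans hsb1.symm, hsucc, hD.isClosed_Nc, hD.isClosed_R,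
    hD.isClosed_Rc, hD.disjoint_N, hD.sup_N, hD.disjoint_R, hD.sup_R, hD.notMem_Nc, hD.isClosed_P,
    hD.exists_line⟩

variable [CompleteSpace B] [CompleteSpace B']

theorem isBigO_comp_curve {m : ℕ} (hz : DifferentiableAt 𝕜 z₀ 0) (hz0 : z₀ 0 = 0)
    (hO : h =O[𝓝 0] (fun z : B => ‖z‖ ^ m)) :
    (fun ε : 𝕜 => h (z₀ ε)) =O[𝓝 0] (fun ε : 𝕜 => ‖ε‖ ^ m) := by
  have hc : Tendsto z₀ (𝓝 0) (𝓝 0) := by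
    have := hz.continuousAt.tendsto
    rwa [hz0] at this
  have hzO : z₀ =O[𝓝 0] fun ε : 𝕜 => ‖ε‖ := by
    have := hz.isBigO_sub
    simpa [hz0] using this.norm_right
  exact (hO.comp_tendsto hc).trans (hzO.norm_left.pow m)

/-- The curve z₀ and the p-term cancel; what remains is A_ε(ν' - ν) with ν' - ν bounded and A_ε =
O(ε^{k+1}). -/
theorem isBigO_Z_sub_Z (D : Resolution 𝕜 B B') (z₀ : 𝕜 → B) {ν ν' : 𝕜 → D.NcProd k} (p : D.P)
    (hν : ContinuousAt ν 0) (hν' : ContinuousAt ν' 0) :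
    (fun ε : 𝕜 => D.Z z₀ k ε (ν' ε) p - D.Z z₀ k ε (ν ε) p) =O[𝓝 0]
      (fun ε : 𝕜 => ‖ε‖ ^ (k + 1)) := by
  obtain ⟨C, hC, h⟩ := D.norm_AL_le k
  have hb : ∀ᶠ ε in 𝓝 (0 : 𝕜), ‖ν' ε - ν ε‖ < ‖ν' 0 - ν 0‖ + 1 :=
    ((hν'.sub hν).norm).eventually_lt_const (lt_add_one _)
  refine IsBigO.of_bound (C * (‖ν' 0 - ν 0‖ + 1)) ?_
  filter_upwards [hb, eventually_norm_lt 𝕜 one_pos] with ε h1 h2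
  have e : D.Z z₀ k ε (ν' ε) p - D.Z z₀ k ε (ν ε) p = D.AL k ε (ν' ε - ν ε) := by
    rw [map_sub, D.AL_apply, D.AL_apply, Resolution.Z, Resolution.Z]
    abel
  rw [e, Real.norm_of_nonneg (by positivity)]
  calc _ ≤ C * ‖ε‖ ^ (k + 1) * (‖ν' 0 - ν 0‖ + 1) :=
        (ContinuousLinearMap.le_opNorm _ _).trans
          (mul_le_mul (h ε h2.le) h1.le (norm_nonneg _) (by positivity))
    _ = _ := by ring

theorem iteratedDeriv_eq_of_isBigO {f g : 𝕜 → B} {i : ℕ} (hf : ContDiffAt 𝕜 i f 0)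
    (hg : ContDiffAt 𝕜 i g 0) (hik : i ≤ k)
    (hO : (fun ε => f ε - g ε) =O[𝓝 0] (fun ε : 𝕜 => ‖ε‖ ^ (k + 1))) :
    iteratedDeriv i f 0 = iteratedDeriv i g 0 := by
  have ho : (fun ε => f ε - g ε) =o[𝓝 0] (fun ε : 𝕜 => ‖ε‖ ^ i) := by
    refine hO.trans_isLittleO ?_
    exact (isLittleO_pow_pow (𝕜 := ℝ) (show i < k + 1 by omega)).comp_tendsto
      (by simpa using (continuous_norm (E := 𝕜)).tendsto 0)
  have h1 := iteratedFDeriv_eq_zero_of_isLittleO (hf.sub hg) ho i le_rfl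
  have h2 : iteratedDeriv i (f - g) 0 = 0 := by
    rw [iteratedDeriv_eq_iteratedFDeriv]
    have : f - g = fun ε => f ε - g ε := rfl
    rw [this, h1]
    rfl
  rw [iteratedDeriv_sub hf hg] at h2
  exact sub_eq_zero.1 h2

theorem Resolution.IsSolutionFamily.contDiffAt {m : ℕ∞} {δ : ℝ} {ν : 𝕜 → D.P → D.NcProd k}
    {U : (j : Fin (k + 1)) → Set (D.Nc (j.val + 1))} {Up : Set D.P} (hUp : IsOpen Up)
    (hν : D.IsSolutionFamily G z₀ k U Up m δ ν) {p : D.P} (hp : p ∈ Up) :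
    ContDiffAt 𝕜 m (fun ε => ν ε p) 0 ∧ ContDiffAt 𝕜 m (fun ε => D.Z z₀ k ε (ν ε p) p) 0 := by
  have hmem : Metric.ball (0 : 𝕜) δ ×ˢ Up ∈ 𝓝 ((0 : 𝕜), p) :=
    prod_mem_nhds (Metric.ball_mem_nhds 0 hν.pos) (hUp.mem_nhds hp)
  have hc : ContDiffAt 𝕜 m (fun ε : 𝕜 => (ε, p)) 0 := by fun_prop
  exact ⟨(hν.contDiffOn_ν.contDiffAt hmem).comp (f := fun ε : 𝕜 => (ε, p)) (0 : 𝕜) hc,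
    (hν.contDiffOn_z.contDiffAt hmem).comp (f := fun ε : 𝕜 => (ε, p)) (0 : 𝕜) hc⟩

theorem exists_isSolutionFamily_perturbation (hq : ((2 * k + 2 : ℕ) : ℕ∞) ≤ q)
    (hG : ContDiff 𝕜 q G) (hr : 0 < r) (hz₀ : ContDiffOn 𝕜 q z₀ (Metric.ball 0 r))
    (hz₀0 : z₀ 0 = 0) (hl : 1 ≤ l) (hlk : l ≤ k) (hlow : ∀ i, 1 ≤ i → i < l → coeff z₀ i = 0)
    (hD : D.IsFineResolution G (coeff z₀) k l)
    {U : (j : Fin (k + 1)) → Set (D.Nc (j.val + 1))}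
    (hU : ∀ j, Bornology.IsBounded (U j)) {Up : Set D.P} (hUpo : IsOpen Up)
    (hUp : Bornology.IsBounded Up) (ht : D.IsTransversal k)
    (hO : (fun ε : 𝕜 => G (z₀ ε)) =O[𝓝 0] (fun ε : 𝕜 => ‖ε‖ ^ (2 * k + 1)))
    {δ : ℝ} {ν : 𝕜 → D.P → D.NcProd k}
    (hν : D.IsSolutionFamily G z₀ k U Up (q - (2 * k + 1 : ℕ)) δ ν)
    (hh : ContDiff 𝕜 q h) (hhO : h =O[𝓝 0] (fun z : B => ‖z‖ ^ (2 * k + 1))) :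
    D.IsFineResolution (G + h) (coeff z₀) k l ∧
      ∃ (δ' : ℝ) (ν' : 𝕜 → D.P → D.NcProd k),
        D.IsSolutionFamily (G + h) z₀ k U Up (q - (2 * k + 1 : ℕ)) δ' ν' ∧
        ∀ p ∈ Up,
          (fun ε : 𝕜 => D.Z z₀ k ε (ν' ε p) p - D.Z z₀ k ε (ν ε p) p) =O[𝓝 0]
            (fun ε : 𝕜 => ‖ε‖ ^ (k + 1)) ∧
          ∀ i : ℕ, i ≤ k → (i : ℕ∞) ≤ q - (2 * k + 1 : ℕ) →
            iteratedDeriv i (fun ε : 𝕜 => D.Z z₀ k ε (ν' ε p) p) 0 =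
              iteratedDeriv i (fun ε : 𝕜 => D.Z z₀ k ε (ν ε p) p) 0 := by
  -- 2k+1 ≥ k+2 because k ≥ l ≥ 1; thus the resolution, the cone and transversality carry over to G
  -- + h.
  have hhO' : h =O[𝓝 0] (fun z : B => ‖z‖ ^ (k + 2)) := by
    refine hhO.trans (IsBigO.of_bound 1 ?_)
    filter_upwards [Metric.ball_mem_nhds (0 : B) one_pos] with z hz
    rw [mem_ball_zero_iff] at hz
    rw [one_mul, Real.norm_of_nonneg (by positivity), Real.norm_of_nonneg (by positivity)]
    exact pow_le_pow_of_le_one (norm_nonneg _) hz.le (by omega)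
  have hD' := hD.add (hG.of_le (natCast_le_of_le hq (by omega)))
    (hh.of_le (natCast_le_of_le hq (by omega))) hhO'
  have hzat : DifferentiableAt 𝕜 z₀ 0 :=
    ((hz₀.contDiffAt (Metric.ball_mem_nhds 0 hr)).of_le
      (natCast_le_of_le hq (show 1 ≤ 2 * k + 2 by omega))).differentiableAt (by norm_num)
  obtain ⟨δ', ν', hν'⟩ := exists_isSolutionFamily hq (hG.add hh) hr hz₀ hz₀0 hl hlk hlow hD' hU
    hUpo hUp ht (hO.add (isBigO_comp_curve hzat hz₀0 hhO))
  refine ⟨hD', δ', ν', hν', fun p hp => ?_⟩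
  obtain ⟨h1, h2⟩ := hν.contDiffAt hUpo hp
  obtain ⟨h1', h2'⟩ := hν'.contDiffAt hUpo hp
  have hO' := isBigO_Z_sub_Z D z₀ p h1.continuousAt h1'.continuousAt
  exact ⟨hO', fun i hi him => iteratedDeriv_eq_of_isBigO (h2'.of_le (by exact_mod_cast him))
    (h2.of_le (by exact_mod_cast him)) hi hO'⟩

end Perturbation

end

end KTransversal

namespace KTransversal

set_option linter.unusedSectionVars false

noncomputable section

/-! ### Linearisation of G on the slices of the cone. -/

section Rectification

variable {𝕜 B B' : Type*} [RCLike 𝕜] [NormedAddCommGroup B] [NormedSpace 𝕜 B]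
  [NormedAddCommGroup B'] [NormedSpace 𝕜 B'] [CompleteSpace B] [CompleteSpace B']
  {D : Resolution 𝕜 B B'} {G : B → B'} {z₀ : 𝕜 → B} {k l : ℕ} {q : ℕ∞} {r : ℝ}

/-- For fixed ε and p the map n ↦ G[Z] is ε^{2k+1} L̂ up to a relative Lipschitz error O(ε), so it
can be inverted on U and J = ε^{2k+1} L̂ ∘ (inverse). The relative error controls J' - I. For J - I
both terms are small by themselves: G[z₀(ε)] = O(ε) because G(0) = 0, and the rest carries the
factor ε^{2k+1}. -/
theorem exists_rectification_in_cone (hq : ((2 * k + 2 : ℕ) : ℕ∞) ≤ q) (hG : ContDiff 𝕜 q G)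
    (hG0 : G 0 = 0) (hr : 0 < r) (hz₀ : ContDiffOn 𝕜 q z₀ (Metric.ball 0 r)) (hz₀0 : z₀ 0 = 0)
    (hD : D.IsFineResolution G (coeff z₀) k l)
    {U : (j : Fin (k + 1)) → Set (D.Nc (j.val + 1))} (hUo : ∀ j, IsOpen (U j))
    (hU : ∀ j, Bornology.IsBounded (U j)) {Up : Set D.P}
    (hUp : Bornology.IsBounded Up) (ht : D.IsTransversal k) :
    ∃ (C δ : ℝ) (J : 𝕜 → D.P → B' → B'), 0 < δ ∧
      ∀ (ε : 𝕜) (p : D.P), 0 < ‖ε‖ → ‖ε‖ < δ → p ∈ Up →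
      ∀ Gεp : B → B', (∀ z, Gεp z = G (z₀ ε + z + D.Acomp k ε (k + 1) p)) →
      ∀ V : Set B', V = (fun n => Gεp (D.A k ε n)) '' {n | ∀ j, n j ∈ U j} →
      IsOpen V ∧ ContDiffOn 𝕜 q (J ε p) V ∧
      (∀ b ∈ V, ‖J ε p b - b‖ ≤ C * ‖ε‖) ∧
      (∀ b ∈ V, ‖fderiv 𝕜 (J ε p) b - ContinuousLinearMap.id 𝕜 B'‖ ≤ C * ‖ε‖) ∧
      ∀ n : D.NcProd k, (∀ j, n j ∈ U j) →
        J ε p (Gεp (D.A k ε n)) = ε ^ (2 * k + 1) • D.Lhat k n := by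
  have := hD.completeSpace_NcProd
  obtain ⟨ρ, hρ, hUρ, hUpρ⟩ := exists_norm_le_of_isBounded hU hUp
  obtain ⟨H, -, hH2, hH0, -, hHL⟩ := exists_cone_expansion hq hG hr hz₀ hz₀0 hD
  obtain ⟨L, hL⟩ := hD.exists_LhatEquiv ht
  obtain ⟨C, hC, h⟩ := hHL ρ hρ.le
  set κ := ‖(L.symm : B' →L[𝕜] D.NcProd k)‖ with hκ
  have hκ0 : 0 ≤ κ := by rw [hκ]; positivity
  have hGz : (fun ε => G (z₀ ε)) =O[𝓝 0] fun ε : 𝕜 => ‖ε‖ ^ 1 := by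
    have h1 : ContDiffOn 𝕜 q (G ∘ z₀) (Metric.ball 0 r) := hG.comp_contDiffOn hz₀
    have h2 : DifferentiableAt 𝕜 (G ∘ z₀) 0 :=
      ((h1.contDiffAt (Metric.ball_mem_nhds 0 hr)).of_le
        (natCast_le_of_le hq (show 1 ≤ 2 * k + 2 by omega))).differentiableAt (by norm_num)
    have := h2.isBigO_sub
    simpa [hz₀0, hG0] using this.norm_right
  obtain ⟨C₁, hC₁, hGb⟩ := hGz.exists_pos
  obtain ⟨δ₀, hδ₀, hev⟩ := Metric.eventually_nhds_iff_ball.1 (h.and (hGb.bound.and (hH0.and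
    ((eventually_norm_lt 𝕜 one_pos).and (eventually_norm_lt 𝕜 hr)))))
  set δ := min δ₀ (1 / (2 * C * (κ + 1))) with hδ
  set C₂ := C₁ + (C + ‖D.coneLead k‖) * ρ + ‖D.LhatL k‖ * ρ + 2 * C * κ with hC₂
  have key : ∀ (ε : 𝕜) (p : D.P), 0 < ‖ε‖ → ‖ε‖ < δ → p ∈ Up → ∃ J : B' → B',
      ∀ V : Set B', V = (fun n => G (D.Z z₀ k ε n p)) '' {n | ∀ j, n j ∈ U j} →
      IsOpen V ∧ ContDiffOn 𝕜 q J V ∧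
      (∀ b ∈ V, ‖J b - b‖ ≤ C₂ * ‖ε‖) ∧
      (∀ b ∈ V, ‖fderiv 𝕜 J b - ContinuousLinearMap.id 𝕜 B'‖ ≤ C₂ * ‖ε‖) ∧
      ∀ n : D.NcProd k, (∀ j, n j ∈ U j) →
        J (G (D.Z z₀ k ε n p)) = ε ^ (2 * k + 1) • D.Lhat k n := by
    intro ε p hε0 hε hp
    obtain ⟨e1, e2, e3, e4, e5⟩ := hev ε (mem_ball_zero_iff.2 (hε.trans_le (min_le_left _ _)))
    have hη : C * ‖ε‖ * κ ≤ 1 / 2 := by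
      calc C * ‖ε‖ * κ ≤ C * (1 / (2 * C * (κ + 1))) * (κ + 1) := by
            gcongr
            · exact hε.le.trans (min_le_right _ _)
            · linarith
        _ = 1 / 2 := by field_simp
    have hpρ := (hUpρ p hp).le
    have hs : ε ^ (2 * k + 1) ≠ 0 := pow_ne_zero _ (norm_pos_iff.1 hε0)
    have hf : ContDiff 𝕜 q fun n => G (D.Z z₀ k ε n p) := by
      simp only [Resolution.Z_eq]
      exact hG.comp (contDiff_const.add ((D.coneOp k ε).contDiff.comp (by fun_prop)))
    obtain ⟨hV, J, hJs, hJ, hJ'⟩ := exists_contDiffOn_rectification (R := ρ) (η := C * ‖ε‖)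
      (le_trans (by exact_mod_cast (show 1 ≤ 2 * k + 2 by omega)) hq) hf L hs (by positivity) hη
      (fun x x' hx hx' => by
        have h1 := e1 (x, p) (x', p) (max_le hx hpρ) (max_le hx' hpρ)
        rw [coneLead_sub, Prod.mk_sub_mk, sub_self] at h1
        have hnorm : ‖(x - x', (0 : D.P))‖ = ‖x - x'‖ := by simp [Prod.norm_def]
        rw [hnorm] at h1
        rw [hH2 ε x p e5, hH2 ε x' p e5, add_sub_add_left_eq_sub, ← smul_sub, ← smul_sub, hL,
          norm_smul, mul_assoc]
        exact mul_le_mul_of_nonneg_left h1 (norm_nonneg _))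
      (U := {n | ∀ j, n j ∈ U j})
      (by
        have : {n : D.NcProd k | ∀ j, n j ∈ U j} = Set.univ.pi U := by
          ext n
          simp
        rw [this]
        exact isOpen_set_pi Set.finite_univ fun j _ => hUo j) hUρ
    refine ⟨J, fun V hVe => ?_⟩
    subst hVe
    have hpow : ‖ε ^ (2 * k + 1)‖ ≤ ‖ε‖ := by
      rw [norm_pow]
      exact pow_le_of_le_one (norm_nonneg _) e4.le (by omega)
    refine ⟨hV, hJs, ?_, fun b hb => ?_, fun n hn => ?_⟩
    · rintro b ⟨n, hn, rfl⟩
      have hnρ := (hUρ n hn).le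
      have hy : ‖(n, p)‖ ≤ ρ := max_le hnρ hpρ
      have h1 : ‖H (ε, (n, p))‖ ≤ (C + ‖D.coneLead k‖) * ρ := by
        have h5 := e1 (n, p) 0 hy (by simpa using hρ.le)
        rw [e3, sub_zero, sub_zero] at h5
        calc _ = ‖(H (ε, (n, p)) - D.coneLead k (n, p)) + D.coneLead k (n, p)‖ := by
              rw [sub_add_cancel]
          _ ≤ C * ‖ε‖ * ‖(n, p)‖ + ‖D.coneLead k‖ * ‖(n, p)‖ :=
              (norm_add_le _ _).trans (add_le_add h5 (ContinuousLinearMap.le_opNorm _ _))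
          _ ≤ C * 1 * ρ + ‖D.coneLead k‖ * ρ := by gcongr
          _ = _ := by ring
      have h2 : ‖L n‖ ≤ ‖D.LhatL k‖ * ρ := by
        rw [hL]
        exact (ContinuousLinearMap.le_opNorm _ _).trans (by gcongr)
      rw [pow_one, Real.norm_of_nonneg (norm_nonneg _)] at e2
      have h3 : ‖G (D.Z z₀ k ε n p)‖ ≤ C₁ * ‖ε‖ + ‖ε‖ * ((C + ‖D.coneLead k‖) * ρ) := by
        rw [hH2 ε n p e5]
        refine (norm_add_le _ _).trans (add_le_add e2 ?_)
        rw [norm_smul]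
        exact mul_le_mul hpow h1 (norm_nonneg _) (norm_nonneg _)
      have h4 := hJ n hn
      simp only at h4 ⊢
      rw [h4]
      calc _ ≤ ‖ε‖ * (‖D.LhatL k‖ * ρ) + (C₁ * ‖ε‖ + ‖ε‖ * ((C + ‖D.coneLead k‖) * ρ)) := by
            refine (norm_sub_le _ _).trans (add_le_add ?_ h3)
            rw [norm_smul]
            exact mul_le_mul hpow h2 (norm_nonneg _) (norm_nonneg _)
        _ = (C₂ - 2 * C * κ) * ‖ε‖ := by rw [hC₂]; ring
        _ ≤ C₂ * ‖ε‖ := by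
            gcongr
            have : 0 ≤ 2 * C * κ := by positivity
            linarith
    · refine (hJ' b hb).trans ?_
      calc 2 * (C * ‖ε‖) * κ = (2 * C * κ) * ‖ε‖ := by ring
        _ ≤ C₂ * ‖ε‖ := by
            gcongr
            have : 0 ≤ C₁ + (C + ‖D.coneLead k‖) * ρ + ‖D.LhatL k‖ * ρ := by positivity
            linarith
    · have h4 := hJ n hn
      rw [h4, hL, D.LhatL_apply]
  choose! J hJ using key
  refine ⟨C₂, δ, J, lt_min hδ₀ (by positivity), fun ε p hε0 hε hp Gεp hGεp V hV => ?_⟩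
  have hZ : ∀ n, Gεp (D.A k ε n) = G (D.Z z₀ k ε n p) := fun n => by
    rw [hGεp, Resolution.Z]
  simp only [hZ] at hV ⊢
  exact hJ ε p hε0 hε hp V hV

end Rectification

/-! ### Growth rates of G'[z₀(ε)] on the images of N_i^c and of its inverse on N^c. -/

section Derivative

variable {𝕜 B B' : Type*} [RCLike 𝕜] [NormedAddCommGroup B] [NormedSpace 𝕜 B]
  [NormedAddCommGroup B'] [NormedSpace 𝕜 B'] [CompleteSpace B] [CompleteSpace B']
  {D : Resolution 𝕜 B B'} {G : B → B'} {z₀ : 𝕜 → B} {k l : ℕ}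

/-- Φ_i(0) = I. The lower bound is needed because operator norms on A^i_ε(N_i^c) are measured
against the image vector, not against x. -/
theorem half_norm_le_norm_chain (D : Resolution 𝕜 B B') {i : ℕ} (hi : 1 ≤ i) :
    ∀ᶠ ε in 𝓝 (0 : 𝕜), ∀ x : B, ‖x‖ / 2 ≤ ‖chain D.Sb D.T i ε x‖ := by
  have hc : ContinuousAt (fun ε => chain D.Sb D.T i ε - ContinuousLinearMap.id 𝕜 B) (0 : 𝕜) :=
    ((D.contDiff_chain (n := 0) i).continuous.sub continuous_const).continuousAt
  have h0 : chain D.Sb D.T i (0 : 𝕜) = ContinuousLinearMap.id 𝕜 B := by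
    rw [chain, ← Finset.Ico_add_one_right_eq_Icc, Finset.sum_Ico_succ_top hi,
      chainCoeff_self _ _ hi, Finset.sum_eq_zero]
    · simp
    · intro r hr
      rw [Finset.mem_Ico] at hr
      rw [zero_pow (by omega), zero_smul]
  have := hc.norm
  rw [ContinuousAt, h0, sub_self, norm_zero] at this
  filter_upwards [this.eventually_lt_const one_half_pos] with ε hε x
  have h1 := (ContinuousLinearMap.le_opNorm
    (chain D.Sb D.T i ε - ContinuousLinearMap.id 𝕜 B) x).trans
    (mul_le_mul_of_nonneg_right hε.le (norm_nonneg x))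
  rw [sub_apply, ContinuousLinearMap.id_apply] at h1
  have h2 := norm_le_norm_add_norm_sub (chain D.Sb D.T i ε x) x
  linarith

namespace Resolution.IsFineResolution

theorem Sb_ne_zero {z : ℕ → B} (hD : D.IsFineResolution G z k l) {i : ℕ} (hi : 1 ≤ i)
    (hik : i ≤ k + 1) {x : B} (hx : x ∈ D.Nc i) (hx0 : x ≠ 0) : D.Sb i x ≠ 0 := by
  obtain ⟨i, rfl⟩ : ∃ s, i = s + 1 := ⟨i - 1, by omega⟩
  intro h0
  refine hx0 (hD.eq_zero_of_S_eq_zero hik hx ?_)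
  rw [hD.S_apply (by omega), h0, map_zero]

/-- The scalar relating A^i_ε to Φ_i(ε) cancels in ‖G' A^i x‖ / ‖A^i x‖, so the chain estimate gives
the rate directly. -/
theorem isBigO_fderiv_restrict (hD : D.IsFineResolution G (coeff z₀) k l)
    (hG : ContDiffAt 𝕜 (k + 2 : ℕ) G 0) (hz : ContDiffAt 𝕜 (k + 1 : ℕ) z₀ 0) (hz0 : z₀ 0 = 0)
    {i : ℕ} (hi : 1 ≤ i) (hik : i ≤ k + 1) :
    (fun ε : 𝕜 => ‖fderiv 𝕜 G (z₀ ε) ∘L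
      ((D.Nc i).map (D.Acomp k ε i).toLinearMap).subtypeL‖)
        =O[𝓝[≠] 0] (fun ε : 𝕜 => ‖ε‖ ^ (i - 1)) := by
  obtain ⟨C, hC, h⟩ := hD.norm_fderiv_chain_sub_le hG hz hz0 hi hik
  set K := ‖normFactor 𝕜 i • D.Sb i‖ with hK
  have hK0 : 0 ≤ K := by rw [hK]; positivity
  refine IsBigO.of_bound (2 * (K + C)) ?_
  filter_upwards [nhdsWithin_le_nhds h, nhdsWithin_le_nhds (half_norm_le_norm_chain D hi),
    nhdsWithin_le_nhds (eventually_norm_lt 𝕜 one_pos)] with ε h1 h2 h3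
  rw [norm_norm, Real.norm_of_nonneg (by positivity)]
  refine ContinuousLinearMap.opNorm_le_bound _ (by positivity) ?_
  rintro ⟨_, x, hx, rfl⟩
  have hxN : x ∈ D.N (i - 1) := by
    obtain ⟨i, rfl⟩ : ∃ s, i = s + 1 := ⟨i - 1, by omega⟩
    exact hD.Nc_le hik hx
  have h4 : ‖fderiv 𝕜 G (z₀ ε) (chain D.Sb D.T i ε x)‖ ≤ (K + C) * ‖ε‖ ^ (i - 1) * ‖x‖ := by
    calc _ ≤ ‖ε ^ (i - 1) • normFactor 𝕜 i • D.Sb i x‖ + C * ‖ε‖ ^ i * ‖x‖ :=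
          (norm_le_norm_add_norm_sub' _ _).trans (add_le_add_right (h1 x hxN) _)
      _ ≤ ‖ε‖ ^ (i - 1) * (K * ‖x‖) + C * ‖ε‖ ^ (i - 1) * ‖x‖ := by
          refine add_le_add ?_ ?_
          · rw [norm_smul, norm_pow]
            exact mul_le_mul_of_nonneg_left
              (ContinuousLinearMap.le_opNorm (normFactor 𝕜 i • D.Sb i) x) (by positivity)
          · have := pow_le_pow_of_le_one (norm_nonneg ε) h3.le (show i - 1 ≤ i by omega)
            gcongr
      _ = _ := by ring
  have hA : D.Acomp k ε i x = (ε ^ (2 * k + 2 - i) / ((2 * k + 2 - i).factorial : 𝕜)) •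
      chain D.Sb D.T i ε x := by rw [D.Acomp_eq hi hik]; rfl
  change ‖fderiv 𝕜 G (z₀ ε) (D.Acomp k ε i x)‖ ≤ _ * ‖D.Acomp k ε i x‖
  rw [hA, map_smul, norm_smul, norm_smul]
  set a := ‖ε ^ (2 * k + 2 - i) / ((2 * k + 2 - i).factorial : 𝕜)‖ with ha
  have ha0 : 0 ≤ a := by rw [ha]; positivity
  calc a * _ ≤ a * ((K + C) * ‖ε‖ ^ (i - 1) * (2 * ‖chain D.Sb D.T i ε x‖)) := by
        gcongr
        refine h4.trans ?_
        gcongr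
        linarith [h2 x]
    _ = _ := by ring

/-- One vector x ≠ 0 in N_i^c suffices: S̄_i x ≠ 0, so ε^{i-1} S̄_i x dominates the remainder of
order i. -/
theorem isTheta_fderiv_restrict (hD : D.IsFineResolution G (coeff z₀) k l)
    (hG : ContDiffAt 𝕜 (k + 2 : ℕ) G 0) (hz : ContDiffAt 𝕜 (k + 1 : ℕ) z₀ 0) (hz0 : z₀ 0 = 0)
    {i : ℕ} (hi : 1 ≤ i) (hik : i ≤ k + 1) (hne : D.Nc i ≠ ⊥) :
    (fun ε : 𝕜 => ‖fderiv 𝕜 G (z₀ ε) ∘L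
      ((D.Nc i).map (D.Acomp k ε i).toLinearMap).subtypeL‖)
        =Θ[𝓝[≠] 0] (fun ε : 𝕜 => ‖ε‖ ^ (i - 1)) := by
  refine ⟨hD.isBigO_fderiv_restrict hG hz hz0 hi hik, ?_⟩
  obtain ⟨C, hC, h⟩ := hD.norm_fderiv_chain_sub_le hG hz hz0 hi hik
  obtain ⟨C', hC', h'⟩ := norm_chain_le D.Sb D.T i
  obtain ⟨x, hx, hx0⟩ := Submodule.exists_mem_ne_zero_of_ne_bot hne
  have hxN : x ∈ D.N (i - 1) := by
    obtain ⟨i, rfl⟩ : ∃ s, i = s + 1 := ⟨i - 1, by omega⟩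
    exact hD.Nc_le hik hx
  set b := ‖normFactor 𝕜 i • D.Sb i x‖ with hb
  have hb0 : 0 < b := norm_pos_iff.2
    (smul_ne_zero (normFactor_ne_zero i) (hD.Sb_ne_zero hi hik hx hx0))
  have hx0' : 0 < ‖x‖ := norm_pos_iff.2 hx0
  have hsmall : ∀ᶠ ε in 𝓝 (0 : 𝕜), C * ‖ε‖ * ‖x‖ < b / 2 := by
    have : Continuous fun ε : 𝕜 => C * ‖ε‖ * ‖x‖ := by fun_prop
    have ht := this.tendsto 0
    rw [norm_zero, mul_zero, zero_mul] at ht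
    exact ht.eventually_lt_const (half_pos hb0)
  refine IsBigO.of_bound (2 * C' * ‖x‖ / b) ?_
  filter_upwards [nhdsWithin_le_nhds h, self_mem_nhdsWithin,
    nhdsWithin_le_nhds (eventually_norm_lt 𝕜 one_pos), nhdsWithin_le_nhds hsmall]
    with ε h1 h2 h3 h4
  have hε0 : ε ≠ 0 := h2
  rw [norm_norm, Real.norm_of_nonneg (by positivity)]
  set N := ‖fderiv 𝕜 G (z₀ ε) ∘L ((D.Nc i).map (D.Acomp k ε i).toLinearMap).subtypeL‖ with hN
  have hN0 : 0 ≤ N := by rw [hN]; positivity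
  have h5 : ‖fderiv 𝕜 G (z₀ ε) (chain D.Sb D.T i ε x)‖ ≤ N * ‖chain D.Sb D.T i ε x‖ := by
    set a : 𝕜 := ε ^ (2 * k + 2 - i) / ((2 * k + 2 - i).factorial : 𝕜) with ha
    have ha0 : a ≠ 0 := div_ne_zero (pow_ne_zero _ hε0) (natCast_factorial_ne_zero _)
    have hA : D.Acomp k ε i x = a • chain D.Sb D.T i ε x := by rw [D.Acomp_eq hi hik]; rfl
    have hmem : chain D.Sb D.T i ε x ∈ (D.Nc i).map (D.Acomp k ε i).toLinearMap := by
      refine ⟨a⁻¹ • x, Submodule.smul_mem _ _ hx, ?_⟩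
      change D.Acomp k ε i (a⁻¹ • x) = _
      rw [map_smul, hA, smul_smul, inv_mul_cancel₀ ha0, one_smul]
    exact (fderiv 𝕜 G (z₀ ε) ∘L
      ((D.Nc i).map (D.Acomp k ε i).toLinearMap).subtypeL).le_opNorm ⟨_, hmem⟩
  have h6 : ‖chain D.Sb D.T i ε x‖ ≤ C' * ‖x‖ :=
    (ContinuousLinearMap.le_opNorm _ _).trans (mul_le_mul_of_nonneg_right (h' ε h3.le)
      (norm_nonneg _))
  have h7 : ‖ε‖ ^ (i - 1) * b ≤ N * (C' * ‖x‖) + ‖ε‖ ^ (i - 1) * (b / 2) := by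
    have e : ‖ε‖ ^ i = ‖ε‖ ^ (i - 1) * ‖ε‖ := by rw [← pow_succ]; congr 1; omega
    calc _ = ‖ε ^ (i - 1) • normFactor 𝕜 i • D.Sb i x‖ := by rw [norm_smul, norm_pow]
      _ ≤ ‖fderiv 𝕜 G (z₀ ε) (chain D.Sb D.T i ε x)‖ + C * ‖ε‖ ^ i * ‖x‖ :=
          (norm_le_norm_add_norm_sub _ _).trans (add_le_add_right (h1 x hxN) _)
      _ ≤ N * (C' * ‖x‖) + ‖ε‖ ^ (i - 1) * (C * ‖ε‖ * ‖x‖) := by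
          refine add_le_add (h5.trans (by gcongr)) (le_of_eq ?_)
          rw [e]
          ring
      _ ≤ _ := by gcongr
  rw [div_mul_eq_mul_div, le_div_iff₀ hb0]
  linarith

/-- G'[z₀(ε)] A_ε = ε^{2k+1} (L̂ + O(ε)), so the inverse on N^c is A_ε (L̂ + O(ε))⁻¹ ε^{-2k-1}. With
A_ε = O(ε^{k+1}) this is O(ε^{-k}). -/
theorem exists_fderiv_equiv (hD : D.IsFineResolution G (coeff z₀) k l)
    (hG : ContDiffAt 𝕜 (k + 2 : ℕ) G 0) (hz : ContDiffAt 𝕜 (k + 1 : ℕ) z₀ 0) (hz0 : z₀ 0 = 0)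
    (ht : D.IsTransversal k) :
    ∃ C δ : ℝ, 0 < δ ∧ ∀ ε : 𝕜, 0 < ‖ε‖ → ‖ε‖ < δ →
      ∃ e : D.NcSum k ≃L[𝕜] B', (∀ x, e x = fderiv 𝕜 G (z₀ ε) x) ∧
        ‖(e.symm : B' →L[𝕜] D.NcSum k)‖ ≤ C / ‖ε‖ ^ k := by
  have := hD.completeSpace_NcProd
  obtain ⟨L, hL⟩ := hD.exists_LhatEquiv ht
  obtain ⟨C, hC, h⟩ := hD.norm_fderiv_coneOp_sub_le hG hz hz0
  obtain ⟨C₁, hC₁, h₁⟩ := D.norm_AL_le k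
  set κ := ‖(L.symm : B' →L[𝕜] D.NcProd k)‖ with hκ
  have hκ0 : 0 ≤ κ := by rw [hκ]; positivity
  obtain ⟨δ₀, hδ₀, hev⟩ := Metric.eventually_nhds_iff_ball.1 (h.and (eventually_norm_lt 𝕜 one_pos))
  refine ⟨C₁ * (2 * κ), min δ₀ (1 / (2 * C * (κ + 1))), lt_min hδ₀ (by positivity),
    fun ε hε0 hε => ?_⟩
  obtain ⟨e1, e2⟩ := hev ε (mem_ball_zero_iff.2 (hε.trans_le (min_le_left _ _)))
  have hε0' : ε ≠ 0 := norm_pos_iff.1 hε0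
  have hη : C * ‖ε‖ * κ ≤ 1 / 2 := by
    calc C * ‖ε‖ * κ ≤ C * (1 / (2 * C * (κ + 1))) * (κ + 1) := by
          gcongr
          · exact hε.le.trans (min_le_right _ _)
          · linarith
      _ = 1 / 2 := by field_simp
  set s : 𝕜 := ε ^ (2 * k + 1) with hs
  have hs0 : s ≠ 0 := pow_ne_zero _ hε0'
  have hs0' : 0 < ‖s‖ := norm_pos_iff.2 hs0
  have hdiff : ‖s⁻¹ • (fderiv 𝕜 G (z₀ ε) ∘L D.AL k ε) - (L : D.NcProd k →L[𝕜] B')‖ ≤ C * ‖ε‖ := by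
    have e3 : s⁻¹ • (fderiv 𝕜 G (z₀ ε) ∘L D.AL k ε) - (L : D.NcProd k →L[𝕜] B') =
        s⁻¹ • ((fderiv 𝕜 G (z₀ ε) ∘L D.coneOp k ε - s • D.coneLead k) ∘L
          ContinuousLinearMap.inl 𝕜 (D.NcProd k) D.P) := by
      refine ContinuousLinearMap.ext fun n => ?_
      have h1 : D.coneOp k ε (n, 0) = D.AL k ε n := by rw [coneOp_apply, AL_apply]; simp
      have h2 : D.coneLead k (n, 0) = D.LhatL k n := by simp [coneLead]
      simp only [sub_apply, smul_apply, ContinuousLinearMap.comp_apply,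
        ContinuousLinearMap.inl_apply, h1, h2, smul_sub, smul_smul, inv_mul_cancel₀ hs0, one_smul,
        ContinuousLinearEquiv.coe_coe, hL]
    rw [e3]
    refine (ContinuousLinearMap.opNorm_smul_le _ _).trans ?_
    rw [norm_inv, inv_mul_le_iff₀ hs0']
    refine (ContinuousLinearMap.opNorm_comp_le _ _).trans ((mul_le_of_le_one_right (norm_nonneg _)
      (ContinuousLinearMap.norm_inl_le_one 𝕜 _ _)).trans (e1.trans (le_of_eq ?_)))
    rw [hs, norm_pow, show 2 * k + 2 = (2 * k + 1) + 1 by omega, pow_succ]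
    ring
  obtain ⟨e, he, hen⟩ := exists_equiv_of_norm_sub_le L hdiff hη
  obtain ⟨eA, heA⟩ := hD.exists_AEquiv hε0'
  set f : D.NcSum k ≃L[𝕜] B' := (eA.symm.trans e).trans
    (ContinuousLinearEquiv.smulLeft (Units.mk0 s hs0)) with hf
  have hf0 : ∀ n, f (eA n) = s • e n := fun n => by simp [hf, ContinuousLinearEquiv.smulLeft]
  have hf1 : ∀ n, f (eA n) = fderiv 𝕜 G (z₀ ε) (eA n) := by
    intro n
    have h2 : e n = s⁻¹ • fderiv 𝕜 G (z₀ ε) (D.AL k ε n) := DFunLike.congr_fun he n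
    rw [hf0, h2, smul_smul, mul_inv_cancel₀ hs0, one_smul, heA, D.AL_apply]
  refine ⟨f, fun x => ?_, ?_⟩
  · have := hf1 (eA.symm x)
    rwa [ContinuousLinearEquiv.apply_symm_apply] at this
  · refine ContinuousLinearMap.opNorm_le_bound _ (by positivity) fun y => ?_
    have h1 : f (eA (s⁻¹ • e.symm y)) = y := by
      rw [hf0, map_smul, smul_smul, mul_inv_cancel₀ hs0, one_smul,
        ContinuousLinearEquiv.apply_symm_apply]
    have h2 : f.symm y = eA (s⁻¹ • e.symm y) := by
      rw [ContinuousLinearEquiv.symm_apply_eq, h1]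
    have h3 : ‖(eA (s⁻¹ • e.symm y) : B)‖ ≤ C₁ * ‖ε‖ ^ (k + 1) * (‖s‖⁻¹ * (2 * κ * ‖y‖)) := by
      rw [heA, ← D.AL_apply]
      refine (ContinuousLinearMap.le_opNorm _ _).trans (mul_le_mul (h₁ ε e2.le) ?_
        (norm_nonneg _) (by positivity))
      rw [norm_smul, norm_inv]
      exact mul_le_mul_of_nonneg_left (((e.symm : B' →L[𝕜] D.NcProd k).le_opNorm y).trans
        (mul_le_mul_of_nonneg_right hen (norm_nonneg _))) (by positivity)
    change ‖f.symm y‖ ≤ _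
    rw [h2]
    refine h3.trans (le_of_eq ?_)
    rw [hs, norm_pow, show 2 * k + 1 = (k + 1) + k by omega, pow_add]
    field_simp
    ring

end Resolution.IsFineResolution

end Derivative

end

end KTransversal

namespace KTransversal

set_option linter.unusedSectionVars false

noncomputable section

/-! ### Determinants of diagonal operators and their smooth dependence. -/

section Determinants

variable {𝕜 : Type*} [RCLike 𝕜]

theorem det_diagL {ι : Type*} [Fintype ι] {V : ι → Type*}
    [∀ j, NormedAddCommGroup (V j)] [∀ j, NormedSpace 𝕜 (V j)] [∀ j, FiniteDimensional 𝕜 (V j)]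
    (a : ι → 𝕜) : LinearMap.det (diagL a : (∀ j, V j) →L[𝕜] ∀ j, V j).toLinearMap =
      ∏ j, a j ^ Module.finrank 𝕜 (V j) := by
  classical
  set b := Pi.basis fun j => Module.finBasis 𝕜 (V j) with hb
  have h : LinearMap.toMatrix b b (diagL a : (∀ j, V j) →L[𝕜] ∀ j, V j).toLinearMap =
      Matrix.diagonal fun x => a x.1 := by
    ext x y
    have h1 : (diagL a : (∀ j, V j) →L[𝕜] ∀ j, V j) (b y) = a y.1 • b y := by
      funext j
      rw [diagL_apply, Pi.smul_apply, hb, Pi.basis_apply]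
      by_cases hj : j = y.1
      · rw [hj]
      · rw [Pi.single_eq_of_ne hj, smul_zero, smul_zero]
    rw [LinearMap.toMatrix_apply, ContinuousLinearMap.coe_coe, h1, map_smul, b.repr_self,
      Finsupp.smul_apply, Matrix.diagonal_apply, Finsupp.single_apply]
    split_ifs with h2 h3 h3
    · rw [h2, smul_eq_mul, mul_one]
    · exact absurd h2.symm h3
    · exact absurd h3.symm h2
    · rw [smul_zero]
  rw [← LinearMap.det_toMatrix b, h, Matrix.det_diagonal, Fintype.prod_sigma]
  simp

theorem contDiffOn_det {V : Type*} [NormedAddCommGroup V] [NormedSpace 𝕜 V] {d : ℕ}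
    {n : WithTop ℕ∞} {s : Set V} {M : V → Matrix (Fin d) (Fin d) 𝕜}
    (hM : ∀ i j, ContDiffOn 𝕜 n (fun x => M x i j) s) : ContDiffOn 𝕜 n (fun x => (M x).det) s := by
  simp only [Matrix.det_apply']
  exact ContDiffOn.sum fun σ _ => contDiffOn_const.mul (contDiffOn_prod fun i _ => hM _ _)

end Determinants

/-! ### Factorisation of G' along the whole cone and the characteristic exponent. -/

section Factorization

variable {𝕜 B B' : Type*} [RCLike 𝕜] [NormedAddCommGroup B] [NormedSpace 𝕜 B]
  [NormedAddCommGroup B'] [NormedSpace 𝕜 B'] [CompleteSpace B] [CompleteSpace B']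
  {D : Resolution 𝕜 B B'} {G : B → B'} {z₀ : 𝕜 → B} {k l : ℕ} {q : ℕ∞} {r : ℝ}

/-- Moving the base point from z₀(ε) to a point of the cone changes G' by O(ε^{k+1}), which is
within the remainder O(ε^i) since i ≤ k+1. -/
theorem norm_fderiv_cone_chain_sub_le (hD : D.IsFineResolution G (coeff z₀) k l)
    (hG : ContDiffAt 𝕜 (k + 2 : ℕ) G 0) (hz : ContDiffAt 𝕜 (k + 1 : ℕ) z₀ 0) (hz0 : z₀ 0 = 0)
    {i : ℕ} (hi : 1 ≤ i) (hik : i ≤ k + 1) {ρ : ℝ} (hρ : 0 ≤ ρ) :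
    ∃ C, 0 < C ∧ ∀ᶠ ε in 𝓝 (0 : 𝕜), ∀ y, ‖y‖ ≤ ρ →
      ‖fderiv 𝕜 G (z₀ ε + D.coneOp k ε y) ∘L chain D.Sb D.T i ε ∘L (D.Nc i).subtypeL -
        ε ^ (i - 1) • normFactor 𝕜 i • (D.Sb i ∘L (D.Nc i).subtypeL)‖ ≤ C * ‖ε‖ ^ i := by
  have hG' : ContDiffAt 𝕜 1 (fderiv 𝕜 G) 0 := hG.fderiv_right (by norm_cast; omega)
  obtain ⟨K, s, hs, hK⟩ := hG'.exists_lipschitzOnWith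
  obtain ⟨R, hR, hRs⟩ := Metric.mem_nhds_iff.1 hs
  have hzc : ∀ᶠ ε in 𝓝 (0 : 𝕜), ‖z₀ ε‖ < R / 2 := by
    have := hz.continuousAt.norm
    rw [ContinuousAt, hz0, norm_zero] at this
    exact this.eventually_lt_const (half_pos hR)
  obtain ⟨C₁, hC₁, h₁⟩ := D.norm_coneOp_le k
  obtain ⟨C₂, hC₂, h₂⟩ := norm_chain_le D.Sb D.T i
  obtain ⟨C₃, hC₃, h₃⟩ := hD.norm_fderiv_chain_sub_le hG hz hz0 hi hik
  have hsmall : ∀ᶠ ε in 𝓝 (0 : 𝕜), C₁ * ‖ε‖ ^ (k + 1) * ρ < R / 2 := by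
    have : Continuous fun ε : 𝕜 => C₁ * ‖ε‖ ^ (k + 1) * ρ := by fun_prop
    have ht := this.tendsto 0
    rw [norm_zero, zero_pow (by omega), mul_zero, zero_mul] at ht
    exact ht.eventually_lt_const (half_pos hR)
  refine ⟨K * (C₁ * ρ) * C₂ + C₃, by positivity, ?_⟩
  filter_upwards [hzc, h₃, hsmall, eventually_norm_lt 𝕜 one_pos] with ε e1 e2 e3 e4 y hy
  have ha : ‖D.coneOp k ε y‖ ≤ C₁ * ‖ε‖ ^ (k + 1) * ρ :=
    (ContinuousLinearMap.le_opNorm _ _).trans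
      (mul_le_mul (h₁ ε e4.le) hy (norm_nonneg _) (by positivity))
  have hmem1 : z₀ ε ∈ s := hRs (mem_ball_zero_iff.2 (e1.trans (half_lt_self hR)))
  have hmem2 : z₀ ε + D.coneOp k ε y ∈ s := hRs (mem_ball_zero_iff.2
    ((norm_add_le _ _).trans_lt (by linarith)))
  have hlip := hK.dist_le_mul _ hmem2 _ hmem1
  rw [dist_eq_norm, dist_eq_norm, add_sub_cancel_left] at hlip
  refine ContinuousLinearMap.opNorm_le_bound _ (by positivity) fun x => ?_
  have hxN : (x : B) ∈ D.N (i - 1) := by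
    obtain ⟨i, rfl⟩ : ∃ s, i = s + 1 := ⟨i - 1, by omega⟩
    exact hD.Nc_le hik x.2
  set w := chain D.Sb D.T i ε x with hw
  have e : (fderiv 𝕜 G (z₀ ε + D.coneOp k ε y) ∘L chain D.Sb D.T i ε ∘L (D.Nc i).subtypeL -
      ε ^ (i - 1) • normFactor 𝕜 i • (D.Sb i ∘L (D.Nc i).subtypeL)) x =
      (fderiv 𝕜 G (z₀ ε + D.coneOp k ε y) - fderiv 𝕜 G (z₀ ε)) w +
      (fderiv 𝕜 G (z₀ ε) w - ε ^ (i - 1) • normFactor 𝕜 i • D.Sb i x) := by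
    rw [sub_apply, sub_apply, sub_add_sub_cancel]
    rfl
  rw [e]
  have hpow : ‖ε‖ ^ (k + 1) ≤ ‖ε‖ ^ i := pow_le_pow_of_le_one (norm_nonneg _) e4.le hik
  calc _ ≤ K * (C₁ * ‖ε‖ ^ (k + 1) * ρ) * (C₂ * ‖x‖) + C₃ * ‖ε‖ ^ i * ‖x‖ := by
        refine (norm_add_le _ _).trans (add_le_add ?_ (e2 x hxN))
        refine (ContinuousLinearMap.le_opNorm _ _).trans (mul_le_mul
          (hlip.trans (mul_le_mul_of_nonneg_left ha K.2)) ?_ (norm_nonneg _) (by positivity))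
        exact (ContinuousLinearMap.le_opNorm _ _).trans
          (mul_le_mul_of_nonneg_right (h₂ ε e4.le) (norm_nonneg _))
    _ ≤ K * (C₁ * ‖ε‖ ^ i * ρ) * (C₂ * ‖x‖) + C₃ * ‖ε‖ ^ i * ‖x‖ := by gcongr
    _ = _ := by ring

/-- Division of the chain estimate by ε^{i-1}; the quotient is ε-close to a multiple of S̄_i on
N_i^c. -/
theorem exists_chain_quotient (hq : ((2 * k + 2 : ℕ) : ℕ∞) ≤ q) (hG : ContDiff 𝕜 q G)
    (hr : 0 < r) (hz₀ : ContDiffOn 𝕜 q z₀ (Metric.ball 0 r)) (hz₀0 : z₀ 0 = 0)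
    (hD : D.IsFineResolution G (coeff z₀) k l) {i : ℕ} (hi : 1 ≤ i) (hik : i ≤ k + 1) :
    ∃ K : 𝕜 × (D.NcProd k × D.P) → D.Nc i →L[𝕜] B',
      ContDiffOn 𝕜 (q - (2 * k + 1 : ℕ) : ℕ∞) K (Metric.ball 0 r ×ˢ Set.univ) ∧
      (∀ ε y, ‖ε‖ < r →
        fderiv 𝕜 G (z₀ ε + D.coneOp k ε y) ∘L chain D.Sb D.T i ε ∘L (D.Nc i).subtypeL =
          ε ^ (i - 1) • K (ε, y)) ∧
      ∀ ρ, 0 ≤ ρ → ∃ C > 0, ∀ᶠ ε in 𝓝 (0 : 𝕜), ∀ y, ‖y‖ ≤ ρ →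
        ‖K (ε, y) - normFactor 𝕜 i • (D.Sb i ∘L (D.Nc i).subtypeL)‖ ≤ C * ‖ε‖ := by
  have hzat : ContDiffAt 𝕜 q z₀ 0 := hz₀.contDiffAt (Metric.ball_mem_nhds 0 hr)
  set Λ := normFactor 𝕜 i • (D.Sb i ∘L (D.Nc i).subtypeL) with hΛ
  set f : 𝕜 × (D.NcProd k × D.P) → D.Nc i →L[𝕜] B' := fun x =>
    fderiv 𝕜 G (z₀ x.1 + D.coneOp k x.1 x.2) ∘L chain D.Sb D.T i x.1 ∘L (D.Nc i).subtypeL with hf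
  have hest := fun ρ (hρ : (0 : ℝ) ≤ ρ) => norm_fderiv_cone_chain_sub_le hD
    (hG.contDiffAt.of_le (natCast_le_of_le hq (by omega)))
    (hzat.of_le (natCast_le_of_le hq (by omega))) hz₀0 hi hik hρ
  have hq1 : (((q - 1 : ℕ∞) : WithTop ℕ∞)) + 1 ≤ q := by
    have : (q - 1 : ℕ∞) + 1 ≤ q := by
      rw [tsub_add_cancel_of_le]
      exact le_trans (by exact_mod_cast (show 1 ≤ 2 * k + 2 by omega)) hq
    exact_mod_cast this
  have hfs : ContDiffOn 𝕜 (q - 1 : ℕ∞) f (Metric.ball 0 r ×ˢ Set.univ) := by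
    have h1 : ContDiffOn 𝕜 (q - 1 : ℕ∞) (fun x : 𝕜 × (D.NcProd k × D.P) =>
        z₀ x.1 + D.coneOp k x.1 x.2) (Metric.ball 0 r ×ˢ Set.univ) :=
      ((hz₀.of_le (by exact_mod_cast tsub_le_self)).comp contDiffOn_fst fun x hx => hx.1).add
        (((D.contDiff_coneOp k).comp contDiff_fst).clm_apply contDiff_snd).contDiffOn
    have h2 : ContDiff 𝕜 (q - 1 : ℕ∞) (fderiv 𝕜 G) := hG.fderiv_right hq1
    exact (h2.comp_contDiffOn h1).clm_comp
      ((((D.contDiff_chain i).comp contDiff_fst).clm_comp contDiff_const).contDiffOn)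
  have hfO : ∀ y, (fun ε => f (ε, y)) =O[𝓝 0] fun ε : 𝕜 => ‖ε‖ ^ (i - 1) := by
    intro y
    obtain ⟨C, hC, h⟩ := hest ‖y‖ (norm_nonneg y)
    refine IsBigO.of_bound (C + ‖Λ‖) ?_
    filter_upwards [h, eventually_norm_lt 𝕜 one_pos] with ε h1 h2
    rw [Real.norm_of_nonneg (by positivity)]
    have h3 : ‖ε ^ (i - 1) • Λ‖ ≤ ‖ε‖ ^ (i - 1) * ‖Λ‖ := by
      refine (ContinuousLinearMap.opNorm_smul_le _ _).trans ?_
      rw [norm_pow]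
    calc _ ≤ ‖ε ^ (i - 1) • Λ‖ + C * ‖ε‖ ^ i :=
          (norm_le_norm_add_norm_sub' _ _).trans (add_le_add_right (h1 y le_rfl) _)
      _ ≤ ‖ε‖ ^ (i - 1) * ‖Λ‖ + C * ‖ε‖ ^ (i - 1) := by
          refine add_le_add h3 (mul_le_mul_of_nonneg_left
            (pow_le_pow_of_le_one (norm_nonneg _) h2.le (by omega)) hC.le)
      _ = _ := by ring
  have hq2 : ((i - 1 : ℕ) : ℕ∞) ≤ q - 1 := by
    refine ENat.le_sub_of_add_le_left (by simp) ?_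
    refine le_trans ?_ hq
    exact_mod_cast (by omega)
  obtain ⟨K, hK, hfK⟩ := exists_contDiffOn_pow_smul hr (i - 1) hq2 hfs hfO
  -- One derivative is lost in G' and i-1 ≤ k in the division, fewer than the 2k+1 allowed.
  have hq3 : q - (2 * k + 1 : ℕ) ≤ q - 1 - ((i - 1 : ℕ) : ℕ∞) := by
    rw [tsub_tsub]
    refine tsub_le_tsub_left ?_ q
    exact_mod_cast (by omega)
  have hK' := hK.of_le (m := (q - (2 * k + 1 : ℕ) : ℕ∞)) (by exact_mod_cast hq3)
  have hbound : ∀ ρ, 0 ≤ ρ → ∃ C > 0, ∀ᶠ ε in 𝓝 (0 : 𝕜), ε ≠ 0 → ∀ y, ‖y‖ ≤ ρ →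
      ‖K (ε, y) - Λ‖ ≤ C * ‖ε‖ := by
    intro ρ hρ
    obtain ⟨C, hC, h⟩ := hest ρ hρ
    refine ⟨C, hC, ?_⟩
    filter_upwards [h, eventually_norm_lt 𝕜 hr] with ε h1 h2 h3 y hy
    have h4 := h1 y hy
    have h5 : ε ^ (i - 1) ≠ 0 := pow_ne_zero _ h3
    have h6 : K (ε, y) - Λ = (ε ^ (i - 1))⁻¹ • (f (ε, y) - ε ^ (i - 1) • Λ) := by
      rw [hfK (ε, y) ⟨mem_ball_zero_iff.2 h2, Set.mem_univ _⟩, ← smul_sub, smul_smul,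
        inv_mul_cancel₀ h5, one_smul]
    rw [h6]
    refine (ContinuousLinearMap.opNorm_smul_le _ _).trans ?_
    rw [norm_inv, inv_mul_le_iff₀ (norm_pos_iff.2 h5)]
    refine h4.trans (le_of_eq ?_)
    obtain ⟨j, rfl⟩ : ∃ s, i = s + 1 := ⟨i - 1, by omega⟩
    rw [norm_pow, Nat.add_sub_cancel, pow_succ]
    ring
  have hzero : ∀ y, K (0, y) = Λ := by
    intro y
    have hc : ContinuousAt (fun ε => K (ε, y)) 0 := by
      have h1 : ContinuousAt K ((0 : 𝕜), y) :=
        hK.continuousOn.continuousAt (prod_mem_nhds (Metric.ball_mem_nhds 0 hr) univ_mem)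
      exact h1.comp (f := fun ε : 𝕜 => (ε, y)) (by fun_prop)
    have h1 : Tendsto (fun ε => K (ε, y)) (𝓝[≠] 0) (𝓝 (K (0, y))) :=
      hc.tendsto.mono_left nhdsWithin_le_nhds
    refine tendsto_nhds_unique h1 ?_
    obtain ⟨C, hC, h⟩ := hbound ‖y‖ (norm_nonneg y)
    rw [tendsto_iff_norm_sub_tendsto_zero]
    have h2 : Tendsto (fun ε : 𝕜 => C * ‖ε‖) (𝓝[≠] 0) (𝓝 0) := by
      have : Continuous fun ε : 𝕜 => C * ‖ε‖ := by fun_prop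
      have ht := this.tendsto 0
      rw [norm_zero, mul_zero] at ht
      exact ht.mono_left nhdsWithin_le_nhds
    refine squeeze_zero' (Eventually.of_forall fun _ => norm_nonneg _) ?_ h2
    filter_upwards [nhdsWithin_le_nhds h, self_mem_nhdsWithin] with ε h3 h4
    exact h3 h4 y le_rfl
  refine ⟨K, hK', fun ε y hε => hfK (ε, y) ⟨mem_ball_zero_iff.2 hε, Set.mem_univ _⟩,
    fun ρ hρ => ?_⟩
  obtain ⟨C, hC, h⟩ := hbound ρ hρ
  refine ⟨C, hC, ?_⟩
  filter_upwards [h] with ε h1 y hy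
  by_cases h0 : ε = 0
  · rw [h0, hzero, sub_self, norm_zero, norm_zero, mul_zero]
  · exact h1 h0 y hy

/-- Factorization of the derivative of `G` along the cone, restricted to `N^c`, into an invertible
factor and a diagonal one. -/
theorem exists_factorization (hq : ((2 * k + 2 : ℕ) : ℕ∞) ≤ q) (hG : ContDiff 𝕜 q G)
    (hr : 0 < r) (hz₀ : ContDiffOn 𝕜 q z₀ (Metric.ball 0 r)) (hz₀0 : z₀ 0 = 0)
    (hD : D.IsFineResolution G (coeff z₀) k l) (ht : D.IsTransversal k) :
    ∃ K : 𝕜 × (D.NcProd k × D.P) → D.NcProd k →L[𝕜] B',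
      ContDiffOn 𝕜 (q - (2 * k + 1 : ℕ) : ℕ∞) K (Metric.ball 0 r ×ˢ Set.univ) ∧
      (∀ ε n p, ‖ε‖ < r → fderiv 𝕜 G (D.Z z₀ k ε n p) ∘L D.chainSum k ε =
        K (ε, (n, p)) ∘L diagL fun j : Fin (k + 1) => ε ^ j.val) ∧
      ∀ ρ, 0 ≤ ρ → ∀ᶠ ε in 𝓝 (0 : 𝕜), ∀ y, ‖y‖ ≤ ρ →
        ∃ e : D.NcProd k ≃L[𝕜] B', (e : D.NcProd k →L[𝕜] B') = K (ε, y) := by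
  have := hD.completeSpace_NcProd
  choose K hK hfK hKΛ using fun j : Fin (k + 1) => exists_chain_quotient hq hG hr hz₀ hz₀0 hD
    (i := j.val + 1) (by omega) (by omega)
  obtain ⟨L, hL⟩ := hD.exists_LhatEquiv ht
  -- The limit of K at ε = 0: L̂ with its factorials (2k+1-j)! removed, hence still an isomorphism.
  set L₀ : D.NcProd k ≃L[𝕜] B' := (diagEquiv (fun j : Fin (k + 1) =>
    ((2 * k + 1 - j.val).factorial : 𝕜)) fun j => natCast_factorial_ne_zero _).trans L with hL₀
  have hL₀' : ∀ n, L₀ n = ∑ j : Fin (k + 1),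
      (normFactor 𝕜 (j.val + 1) • (D.Sb (j.val + 1) ∘L (D.Nc (j.val + 1)).subtypeL)) (n j) := by
    intro n
    have h1 : L₀ n = L (diagL (fun j : Fin (k + 1) => ((2 * k + 1 - j.val).factorial : 𝕜)) n) := rfl
    rw [h1, hL, D.LhatL_apply']
    refine Finset.sum_congr rfl fun j _ => ?_
    rw [diagL_apply, Submodule.coe_smul, map_smul, smul_smul,
      div_mul_cancel₀ _ (natCast_factorial_ne_zero _)]
    rfl
  set Kt : 𝕜 × (D.NcProd k × D.P) → D.NcProd k →L[𝕜] B' := fun x =>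
    ∑ j : Fin (k + 1), K j x ∘L ContinuousLinearMap.proj j with hKt
  have hKta : ∀ x n, Kt x n = ∑ j : Fin (k + 1), K j x (n j) := fun x n => by simp [hKt]
  refine ⟨Kt, ?_, fun ε n p hε => ?_, fun ρ hρ => ?_⟩
  · exact ContDiffOn.sum fun j _ => (hK j).clm_comp contDiffOn_const
  · refine ContinuousLinearMap.ext fun m => ?_
    rw [ContinuousLinearMap.comp_apply, ContinuousLinearMap.comp_apply, D.chainSum_apply, hKta,
      map_sum]
    refine Finset.sum_congr rfl fun j _ => ?_
    have := DFunLike.congr_fun (hfK j ε (n, p) hε) (m j)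
    rw [Nat.add_sub_cancel] at this
    rw [diagL_apply, map_smul, Resolution.Z_eq]
    exact this
  · choose C hC h using fun j => hKΛ j ρ hρ
    have hS : 0 < ∑ j, C j := Finset.sum_pos (fun j _ => hC j) Finset.univ_nonempty
    have hsmall : ∀ᶠ ε in 𝓝 (0 : 𝕜),
        (∑ j, C j) * ‖ε‖ * ‖(L₀.symm : B' →L[𝕜] D.NcProd k)‖ < 1 / 2 := by
      have : Continuous fun ε : 𝕜 =>
        (∑ j, C j) * ‖ε‖ * ‖(L₀.symm : B' →L[𝕜] D.NcProd k)‖ := by fun_prop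
      have ht := this.tendsto 0
      rw [norm_zero, mul_zero, zero_mul] at ht
      exact ht.eventually_lt_const one_half_pos
    filter_upwards [eventually_all.2 h, hsmall] with ε h1 h2 y hy
    have h3 : ‖Kt (ε, y) - (L₀ : D.NcProd k →L[𝕜] B')‖ ≤ (∑ j, C j) * ‖ε‖ := by
      refine ContinuousLinearMap.opNorm_le_bound _ (by positivity) fun n => ?_
      rw [sub_apply, hKta, ContinuousLinearEquiv.coe_coe, hL₀', ← Finset.sum_sub_distrib,
        Finset.sum_mul, Finset.sum_mul]
      refine (norm_sum_le _ _).trans (Finset.sum_le_sum fun j _ => ?_)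
      rw [← sub_apply]
      exact (ContinuousLinearMap.le_opNorm _ _).trans (mul_le_mul (h1 j y hy)
        (norm_le_pi_norm n j) (norm_nonneg _) (mul_nonneg (hC j).le (norm_nonneg _)))
    obtain ⟨e, he, -⟩ := exists_equiv_of_norm_sub_le L₀ h3 h2.le
    exact ⟨e, he⟩

/-- Taking determinants in G' ∘ (sum of chains) = K ∘ Diag(ε^j) gives ε^χ det K divided by the
determinant of the sum of chains. The latter never vanishes, not even at ε = 0, so r is smooth and
non-zero; A_ε in its place would bring in powers of ε. -/
theorem exists_det_factorization (hq : ((2 * k + 2 : ℕ) : ℕ∞) ≤ q) (hG : ContDiff 𝕜 q G)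
    (hr : 0 < r) (hz₀ : ContDiffOn 𝕜 q z₀ (Metric.ball 0 r)) (hz₀0 : z₀ 0 = 0)
    (hD : D.IsFineResolution G (coeff z₀) k l) (ht : D.IsTransversal k)
    {U : (j : Fin (k + 1)) → Set (D.Nc (j.val + 1))}
    (hU : ∀ j, Bornology.IsBounded (U j)) {Up : Set D.P} (hUp : Bornology.IsBounded Up)
    (hfin : FiniteDimensional 𝕜 (D.NcSum k)) :
    ∃ δ : ℝ, 0 < δ ∧ ∀ (d : ℕ) (b : Module.Basis (Fin d) 𝕜 (D.NcSum k))
      (b' : Module.Basis (Fin d) 𝕜 B'),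
      ∃ ρ : 𝕜 → D.NcProd k → D.P → 𝕜,
        ContDiffOn 𝕜 (q - (2 * k + 1 : ℕ) : ℕ∞)
          (fun x : 𝕜 × D.NcProd k × D.P => ρ x.1 x.2.1 x.2.2)
          (Metric.ball 0 δ ×ˢ {n | ∀ j, n j ∈ U j} ×ˢ Up) ∧
        ∀ (ε : 𝕜) (n : D.NcProd k) (p : D.P), ‖ε‖ < δ → (∀ j, n j ∈ U j) → p ∈ Up →
          ρ ε n p ≠ 0 ∧
          (LinearMap.toMatrix b b' ((fderiv 𝕜 G (D.Z z₀ k ε n p)).toLinearMap ∘ₗ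
            (D.NcSum k).subtype)).det = ε ^ D.chi k * ρ ε n p := by
  obtain ⟨M, hM, hUM, hUpM⟩ := exists_norm_le_of_isBounded hU hUp
  obtain ⟨K, hK, hfK, hKe⟩ := exists_factorization hq hG hr hz₀ hz₀0 hD ht
  obtain ⟨δ, hδ, hev⟩ := Metric.eventually_nhds_iff_ball.1
    ((hKe M hM.le).and (eventually_norm_lt 𝕜 hr))
  choose e he using hD.exists_chainEquiv
  refine ⟨δ, hδ, fun d b b' => ?_⟩
  have hfin' : FiniteDimensional 𝕜 B' := Module.Finite.of_basis b'
  have hfinN : ∀ j : Fin (k + 1), FiniteDimensional 𝕜 (D.Nc (j.val + 1)) := fun j =>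
    Submodule.finiteDimensional_of_le (S₂ := D.NcSum k)
      (by rw [D.NcSum_eq]; exact D.Nc_le_NcPartial (by omega) (by omega))
  -- Any fixed basis of N_1^c × ⋯ × N_{k+1}^c of size d would do; this one is transported from b by
  -- the isomorphism at ε = 0.
  set bc := b.map (e 0).symm.toLinearEquiv with hbc
  set m₁ : 𝕜 × D.NcProd k × D.P → Matrix (Fin d) (Fin d) 𝕜 := fun x =>
    LinearMap.toMatrix bc b' (K x).toLinearMap with hm₁
  set m₂ : 𝕜 → Matrix (Fin d) (Fin d) 𝕜 := fun ε =>
    LinearMap.toMatrix bc b (e ε).toLinearEquiv.toLinearMap with hm₂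
  have hm₂0 : ∀ ε, (m₂ ε).det ≠ 0 := fun ε =>
    ((e ε).toLinearEquiv.isUnit_det bc b).ne_zero
  have hsub : Metric.ball (0 : 𝕜) δ ×ˢ {n : D.NcProd k | ∀ j, n j ∈ U j} ×ˢ Up ⊆
      Metric.ball (0 : 𝕜) r ×ˢ Set.univ := fun x hx =>
    ⟨mem_ball_zero_iff.2 (hev x.1 hx.1).2, Set.mem_univ _⟩
  refine ⟨fun ε n p => (m₁ (ε, (n, p))).det / (m₂ ε).det, ?_, fun ε n p hε hn hp => ?_⟩
  · refine ContDiffOn.div ?_ ?_ fun x _ => hm₂0 x.1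
    · refine (contDiffOn_det fun i j => ?_).mono hsub
      simp only [hm₁, LinearMap.toMatrix_apply]
      exact (LinearMap.toContinuousLinearMap (b'.coord i)).contDiff.comp_contDiffOn
        (hK.clm_apply contDiffOn_const)
    · refine contDiffOn_det fun i j => ?_
      have hc := hD.isTopCompl_NcSum.symm
      -- The isomorphisms e ε were chosen separately for each ε; writing them through the fixed
      -- projection onto N^c exhibits their smooth dependence on ε.
      have h1 : ∀ ε n, e ε n = (D.NcSum k).projectionOntoL _ hc (D.chainSum k ε n) := by
        intro ε n
        rw [← he, Submodule.projectionOntoL_apply_left]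
      have h2 : ∀ x : 𝕜 × D.NcProd k × D.P, m₂ x.1 i j =
          LinearMap.toContinuousLinearMap (b.coord i)
            ((D.NcSum k).projectionOntoL _ hc (D.chainSum k x.1 (bc j))) := by
        intro x
        rw [← h1, hm₂]
        simp only [LinearMap.toMatrix_apply]
        rfl
      simp only [h2]
      exact ((LinearMap.toContinuousLinearMap (b.coord i)).contDiff.comp
        (((D.NcSum k).projectionOntoL _ hc).contDiff.comp
          (((D.contDiff_chainSum k).comp contDiff_fst).clm_apply contDiff_const))).contDiffOn
  · obtain ⟨h1, h2⟩ := hev ε (mem_ball_zero_iff.2 hε)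
    obtain ⟨eK, heK⟩ := h1 (n, p) (max_le (hUM n hn).le (hUpM p hp).le)
    have hm₁0 : (m₁ (ε, (n, p))).det ≠ 0 := by
      have : m₁ (ε, (n, p)) = LinearMap.toMatrix bc b' eK.toLinearEquiv.toLinearMap := by
        simp only [hm₁, ← heK]
        rfl
      rw [this]
      exact (eK.toLinearEquiv.isUnit_det bc b').ne_zero
    refine ⟨div_ne_zero hm₁0 (hm₂0 ε), ?_⟩
    have hcomp : ((fderiv 𝕜 G (D.Z z₀ k ε n p)).toLinearMap ∘ₗ (D.NcSum k).subtype) ∘ₗ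
        (e ε).toLinearEquiv.toLinearMap = (K (ε, (n, p))).toLinearMap ∘ₗ
        (diagL fun j : Fin (k + 1) => ε ^ j.val : D.NcProd k →L[𝕜] D.NcProd k).toLinearMap := by
      refine LinearMap.ext fun x => ?_
      have := DFunLike.congr_fun (hfK ε n p h2) x
      refine Eq.trans ?_ this
      exact congrArg (fderiv 𝕜 G (D.Z z₀ k ε n p)) (he ε x)
    have hdet := congrArg (fun f => (LinearMap.toMatrix bc b' f).det) hcomp
    simp only [LinearMap.toMatrix_comp bc b b', LinearMap.toMatrix_comp bc bc b',
      Matrix.det_mul] at hdet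
    rw [LinearMap.det_toMatrix, det_diagL] at hdet
    -- The factor ε^j occurs dim N_{j+1}^c times; j = 0 does not contribute.
    have hchi : ∏ j : Fin (k + 1), (ε ^ j.val) ^ Module.finrank 𝕜 (D.Nc (j.val + 1)) =
        ε ^ D.chi k := by
      simp only [← pow_mul]
      rw [Finset.prod_pow_eq_pow_sum, Resolution.chi, Fin.sum_univ_eq_sum_range
        (fun j => j * Module.finrank 𝕜 (D.Nc (j + 1))) (k + 1), Finset.range_eq_Ico,
        Finset.sum_eq_sum_Ico_succ_bot (by omega), zero_mul, zero_add,
        Finset.Ico_add_one_right_eq_Icc]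
    rw [hchi] at hdet
    rw [← mul_div_assoc, eq_div_iff (hm₂0 ε), mul_comm (ε ^ D.chi k)]
    exact hdet

end Factorization

end

end KTransversal

/-! ### The main theorem. -/

theorem theorem2 {𝕜 B B' : Type*} [RCLike 𝕜]
    [NormedAddCommGroup B] [NormedSpace 𝕜 B] [CompleteSpace B]
    [NormedAddCommGroup B'] [NormedSpace 𝕜 B'] [CompleteSpace B']
    (k l : ℕ) (q : ℕ∞) (hq : ((2 * k + 2 : ℕ) : ℕ∞) ≤ q)
    (G : B → B') (hG : ContDiff 𝕜 q G) (hG0 : G 0 = 0)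
    (z₀ : 𝕜 → B) (r : ℝ) (hr : 0 < r) (hz₀ : ContDiffOn 𝕜 q z₀ (Metric.ball 0 r))
    (hz₀0 : z₀ 0 = 0) (hl : 1 ≤ l) (hlk : l ≤ k)
    (hlow : ∀ i, 1 ≤ i → i < l → coeff z₀ i = 0) (hlead : coeff z₀ l ≠ 0)
    (D : Resolution 𝕜 B B') (hD : D.IsFineResolution G (coeff z₀) k l)
    (U : (j : Fin (k + 1)) → Set (D.Nc (j.val + 1)))
    (hUopen : ∀ j, IsOpen (U j)) (hUbdd : ∀ j, Bornology.IsBounded (U j)) (hU0 : ∀ j, 0 ∈ U j)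
    (Up : Set D.P) (hUpopen : IsOpen Up) (hUpbdd : Bornology.IsBounded Up) (hUp0 : 0 ∈ Up) :
    -- (i)
    (∃ C δ : ℝ, 0 < δ ∧ ∀ (ε : 𝕜) (n : D.NcProd k) (p : D.P), 0 < ‖ε‖ → ‖ε‖ < δ →
      (∀ j, n j ∈ U j) → p ∈ Up → G (D.Z z₀ k ε n p) = 0 →
      ‖G (z₀ ε)‖ ≤ C * ‖ε‖ ^ (2 * k + 1)) ∧
    (∃ δ : ℝ, 0 < δ ∧ ∀ z ∈ D.cone z₀ k U Up δ, G z = 0 →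
      (fun ε : 𝕜 => G (z₀ ε)) =O[𝓝 0] (fun ε : 𝕜 => ‖ε‖ ^ (2 * k + 1))) ∧
    (D.IsTransversal k →
      -- (ii) and the first part of (iii)
      ((fun ε : 𝕜 => G (z₀ ε)) =O[𝓝 0] (fun ε : 𝕜 => ‖ε‖ ^ (2 * k + 1)) →
        (∃ (δ : ℝ) (ν : 𝕜 → D.P → D.NcProd k),
          D.IsSolutionFamily G z₀ k U Up (q - (2 * k + 1 : ℕ)) δ ν) ∧
        (∀ (δ : ℝ) (ν : 𝕜 → D.P → D.NcProd k),
          D.IsSolutionFamily G z₀ k U Up (q - (2 * k + 1 : ℕ)) δ ν →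
          ∀ h : B → B', ContDiff 𝕜 q h → h =O[𝓝 0] (fun z : B => ‖z‖ ^ (2 * k + 1)) →
          D.IsFineResolution (G + h) (coeff z₀) k l ∧
          ∃ (δ' : ℝ) (ν' : 𝕜 → D.P → D.NcProd k),
            D.IsSolutionFamily (G + h) z₀ k U Up (q - (2 * k + 1 : ℕ)) δ' ν' ∧
            ∀ p ∈ Up,
              (fun ε : 𝕜 => D.Z z₀ k ε (ν' ε p) p - D.Z z₀ k ε (ν ε p) p) =O[𝓝 0]
                (fun ε : 𝕜 => ‖ε‖ ^ (k + 1)) ∧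
              ∀ i : ℕ, i ≤ k → (i : ℕ∞) ≤ q - (2 * k + 1 : ℕ) →
                iteratedDeriv i (fun ε : 𝕜 => D.Z z₀ k ε (ν' ε p) p) 0 =
                  iteratedDeriv i (fun ε : 𝕜 => D.Z z₀ k ε (ν ε p) p) 0)) ∧
      -- second part of (iii); the cone, the operators `S_i`, the spaces `N_i`, `R_i` and the
      -- transversality are functions of `D`, `z₀`, `k` alone, hence are unchanged
      (∀ h : B → B', ContDiff 𝕜 q h → h =O[𝓝 0] (fun z : B => ‖z‖ ^ (k + 2)) →
        D.IsFineResolution (G + h) (coeff z₀) k l) ∧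
      -- (iv)
      ((∃ eL : D.NcProd k ≃L[𝕜] B', ∀ n, eL n = D.Lhat k n) ∧
        (∀ ε : 𝕜, ε ≠ 0 → ∃ eA : D.NcProd k ≃L[𝕜] D.NcSum k, ∀ n, (eA n : B) = D.A k ε n) ∧
        ∃ (C δ : ℝ) (J : 𝕜 → D.P → B' → B'), 0 < δ ∧
          ∀ (ε : 𝕜) (p : D.P), 0 < ‖ε‖ → ‖ε‖ < δ → p ∈ Up →
          ∀ Gεp : B → B', (∀ z, Gεp z = G (z₀ ε + z + D.Acomp k ε (k + 1) p)) →
          ∀ V : Set B', V = (fun n => Gεp (D.A k ε n)) '' {n | ∀ j, n j ∈ U j} →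
          IsOpen V ∧ ContDiffOn 𝕜 q (J ε p) V ∧
          (∀ b ∈ V, ‖J ε p b - b‖ ≤ C * ‖ε‖) ∧
          (∀ b ∈ V, ‖fderiv 𝕜 (J ε p) b - ContinuousLinearMap.id 𝕜 B'‖ ≤ C * ‖ε‖) ∧
          ∀ n : D.NcProd k, (∀ j, n j ∈ U j) →
            J ε p (Gεp (D.A k ε n)) = ε ^ (2 * k + 1) • D.Lhat k n) ∧
      -- (v)
      ((∀ i : ℕ, 1 ≤ i → i ≤ k + 1 →
          (fun ε : 𝕜 => ‖fderiv 𝕜 G (z₀ ε) ∘L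
              ((D.Nc i).map (D.Acomp k ε i).toLinearMap).subtypeL‖)
            =O[𝓝[≠] 0] (fun ε : 𝕜 => ‖ε‖ ^ (i - 1)) ∧
          (D.Nc i ≠ ⊥ →
            (fun ε : 𝕜 => ‖fderiv 𝕜 G (z₀ ε) ∘L
                ((D.Nc i).map (D.Acomp k ε i).toLinearMap).subtypeL‖)
              =Θ[𝓝[≠] 0] (fun ε : 𝕜 => ‖ε‖ ^ (i - 1)))) ∧
        ∃ C δ : ℝ, 0 < δ ∧ ∀ ε : 𝕜, 0 < ‖ε‖ → ‖ε‖ < δ →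
          ∃ e : D.NcSum k ≃L[𝕜] B', (∀ x, e x = fderiv 𝕜 G (z₀ ε) x) ∧
            ‖(e.symm : B' →L[𝕜] D.NcSum k)‖ ≤ C / ‖ε‖ ^ k) ∧
      -- (vi)
      (FiniteDimensional 𝕜 (D.NcSum k) →
        ∃ δ : ℝ, 0 < δ ∧ ∀ (d : ℕ) (b : Module.Basis (Fin d) 𝕜 (D.NcSum k))
          (b' : Module.Basis (Fin d) 𝕜 B'),
          ∃ ρ : 𝕜 → D.NcProd k → D.P → 𝕜,
            ContDiffOn 𝕜 (q - (2 * k + 1 : ℕ) : ℕ∞)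
              (fun x : 𝕜 × D.NcProd k × D.P => ρ x.1 x.2.1 x.2.2)
              (Metric.ball 0 δ ×ˢ {n | ∀ j, n j ∈ U j} ×ˢ Up) ∧
            ∀ (ε : 𝕜) (n : D.NcProd k) (p : D.P), ‖ε‖ < δ → (∀ j, n j ∈ U j) → p ∈ Up →
              ρ ε n p ≠ 0 ∧
              (LinearMap.toMatrix b b' ((fderiv 𝕜 G (D.Z z₀ k ε n p)).toLinearMap ∘ₗ
                (D.NcSum k).subtype)).det = ε ^ D.chi k * ρ ε n p)) := by
  have hzat : ContDiffAt 𝕜 (k + 1 : ℕ) z₀ 0 :=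
    (hz₀.contDiffAt (Metric.ball_mem_nhds 0 hr)).of_le (natCast_le_of_le hq (by omega))
  have hGat : ContDiffAt 𝕜 (k + 2 : ℕ) G 0 :=
    hG.contDiffAt.of_le (natCast_le_of_le hq (by omega))
  refine ⟨norm_map_le_of_zero_in_cone hq hG hr hz₀ hz₀0 hD hUbdd hUpbdd,
    isBigO_of_zero_in_cone hq hG hr hz₀ hz₀0 hD hUbdd hUpbdd, fun ht => ⟨fun hO => ⟨?_, ?_⟩, ?_,
    ⟨?_, fun ε hε => hD.exists_AEquiv hε, ?_⟩, ⟨fun i hi hik =>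
      ⟨hD.isBigO_fderiv_restrict hGat hzat hz₀0 hi hik,
        hD.isTheta_fderiv_restrict hGat hzat hz₀0 hi hik⟩,
      hD.exists_fderiv_equiv hGat hzat hz₀0 ht⟩,
    exists_det_factorization hq hG hr hz₀ hz₀0 hD ht hUbdd hUpbdd⟩⟩
  · exact exists_isSolutionFamily hq hG hr hz₀ hz₀0 hl hlk hlow hD hUbdd hUpopen hUpbdd ht hO
  · exact fun δ ν hν h hh hhO => exists_isSolutionFamily_perturbation hq hG hr hz₀ hz₀0 hl hlk hlow
      hD hUbdd hUpopen hUpbdd ht hO hν hh hhO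
  · exact fun h hh hhO => hD.add (hG.of_le (natCast_le_of_le hq (by omega)))
      (hh.of_le (natCast_le_of_le hq (by omega))) hhO
  · obtain ⟨e, he⟩ := hD.exists_LhatEquiv ht
    exact ⟨e, fun n => by rw [he, D.LhatL_apply]⟩
  · exact exists_rectification_in_cone hq hG hG0 hr hz₀ hz₀0 hD hUopen hUbdd hUpbdd ht
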